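/- Let $F$ be a field of characteristic $2$, let $Q$ be a Hurwitz algebra over $F$ (a unital, not necessarily associative, algebra with a regular multiplicative quadratic form $q$) with $\dim Q\in\{2,4\}$, and let $0\neq\alpha\in F$. Write $\bar x=q(x,1)1-x$, where $q(\cdot,\cdot)$ is the polar form, and let $C=\mathrm{CD}(Q,\alpha)=Q\oplus Qu_0$ be the Hurwitz superalgebra with product $$(a+bu_0)(c+du_0)=(ac-\alpha\bar d b)+(da+b\bar c)u_0\qquad(a,b,c,d\in Q),$$ even part $C_{\bar0}=Q$, odd part $C_{\bar1}=Qu_0$; as an algebra it carries the norm $q(a+bu_0)=q(a)+\alpha q(b)$. The decomposition $C=C_{\bar0}\oplus C_{\bar1}$ is the main $\mathbb Z_2$-grading. An algebra is called split if its norm has a nonzero isotropic vector. A grading of the superalgebra $C$ by a group $G$ is a decomposition $C=\bigoplus_{g\in G}C^g$ with $C^gC^h\subseteq C^{gh}$ and $C^g=(C^g\cap C_{\bar0})\oplus(C^g\cap C_{\bar1})$ for all $g,h\in G$. A grading $\Delta$ refines a grading $\Gamma$ if each component of $\Delta$ is contained in a component of $\Gamma$; $\Gamma$ is fine if it has no proper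 refinement among the group gradings of the superalgebra $C$. The universal grading group of $\Gamma$ is the group generated by the support $\{g: C^g\neq0\}$ with the relations $s_1s_2=s_3$ whenever $0\ne C^{s_1}C^{s_2}\subseteq C^{s_3}$. A canonical basis of a split Cayley algebra is a basis $\{e_1,e_2,u_1,u_2,u_3,v_1,v_2,v_3\}$ such that $e_1,e_2$ are orthogonal idempotents, $e_1u_i=u_i=u_ie_2$, $e_2v_i=v_i=v_ie_1$, $e_2u_i=u_ie_1=e_1v_i=v_ie_2=0$, $u_i^2=v_i^2=0$, $u_iu_{i+1}=-u_{i+1}u_i=v_{i+2}$, $v_iv_{i+1}=-v_{i+1}v_i=u_{i+2}$ (indices modulo $3$), $u_iv_j=-\delta_{ij}e_1$, $v_iu_j=-\delta_{ij}e_2$. A canonical basis of a split quaternion algebra is a basis $\{e_1,e_2,u_1,v_1\}$ satisfying those of these relations that involve only $e_1,e_2,u_1,v_1$. **Theorem.** Let $\Gamma: C=\bigoplus_{g\in G}C^g$ be a grading of the superalgebra $C$ by its universal grading group $G$. * If $\dim Q=2$ ($\dim C=4$), then $\Gamma$ is fine if and only if, up to an isomorphism relabelling $G$, one of the following holds: 1.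 $G=\mathbb Z_2$, $Q$ is not split and $\Gamma$ is the main grading; or 2. $G=\mathbb Z$, $Q$ is split, and there is a canonical basis $\{e_1,e_2,u_1,v_1\}$ of $C$ with $C_{\bar0}=\mathrm{span}\{e_1,e_2\}$, $C_{\bar1}=\mathrm{span}\{u_1,v_1\}$, such that $C^0=\mathrm{span}\{e_1,e_2\}$, $C^1=\mathrm{span}\{u_1\}$, $C^{-1}=\mathrm{span}\{v_1\}$. * If $\dim Q=4$ ($\dim C=8$), then $\Gamma$ is fine if and only if, up to an isomorphism relabelling $G$, one of the following holds: 1. $G=\mathbb Z_2^2$ and there are $w,v\in C_{\bar0}$ and $u\in C_{\bar1}$ with $q(w,1)\neq0$, $q(v,1)=q(v,w)=0$, $q(v)\neq0$, $q(u)\neq0$ such that $K=F1+Fw$ is not split and $$C^{(\bar0,\bar0)}=K,\quad C^{(\bar1,\bar0)}=Kv,\quad C^{(\bar0,\bar1)}=Ku,\quad C^{(\bar1,\bar1)}=K(vu);$$ or 2. $G=\mathbb Z^2$, $Q$ is split, and there is a canonical basis of $C$ with $C_{\bar0}=\mathrm{span}\{e_1,e_2,u_3,v_3\}$, $C_{\bar1}=\mathrm{span}\{u_1,u_2,v_1,v_2\}$,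 such that $\Gamma$ is the Cartan grading $$C^{(0,0)}=\mathrm{span}\{e_1,e_2\},\ C^{(1,1)}=Fv_3,\ C^{(-1,-1)}=Fu_3,\ C^{(1,0)}=Fu_1,\ C^{(-1,0)}=Fv_1,\ C^{(0,1)}=Fu_2,\ C^{(0,-1)}=Fv_2.$$ -/

import Mathlib

universe u v w t

/-! ## Group gradings -/

/-- A grading of the (not necessarily associative or unital) `F`-algebra `A` by the group `G`:
a direct sum decomposition `A = ⨁ g, A^g` with `A^g A^h ⊆ A^(gh)`. -/
structure GroupGrading (F : Type u) (A : Type v) (G : Type t)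
    [Field F] [NonUnitalNonAssocRing A] [Module F A] [Group G] where
  component : G → Submodule F A
  indep : iSupIndep component
  iSup_eq_top : ⨆ g, component g = ⊤
  mul_mem : ∀ {g h : G} {x y : A},
    x ∈ component g → y ∈ component h → x * y ∈ component (g * h)

namespace GroupGrading

/-- The support of a grading. -/
def support {F : Type u} {A : Type v} {G : Type t}
    [Field F] [NonUnitalNonAssocRing A] [Module F A] [Group G]
    (Γ : GroupGrading F A G) : Set G :=
  {g | Γ.component g ≠ ⊥}

/-- The defining relations `s₁ s₂ = s₃` of the universal grading group, one for each triple in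
the support with `0 ≠ A^{s₁} A^{s₂} ⊆ A^{s₃}`. -/
def universalRels {F : Type u} {A : Type v} {G : Type t}
    [Field F] [NonUnitalNonAssocRing A] [Module F A] [Group G]
    (Γ : GroupGrading F A G) : Set (FreeGroup Γ.support) :=
  {r | ∃ s₁ s₂ s₃ : Γ.support,
    (∃ x ∈ Γ.component s₁, ∃ y ∈ Γ.component s₂, x * y ≠ 0) ∧
    (∀ x ∈ Γ.component s₁, ∀ y ∈ Γ.component s₂, x * y ∈ Γ.component s₃) ∧
    r = FreeGroup.of s₁ * FreeGroup.of s₂ * (FreeGroup.of s₃)⁻¹}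

/-- The universal grading group: generated by the support, subject to `universalRels`. -/
abbrev UniversalGroup {F : Type u} {A : Type v} {G : Type t}
    [Field F] [NonUnitalNonAssocRing A] [Module F A] [Group G]
    (Γ : GroupGrading F A G) : Type t :=
  PresentedGroup Γ.universalRels

/-- `G` is the universal grading group of the `G`-grading `Γ`: there is an isomorphism from the
universal grading group to `G` that is the identity on the support. -/
def IsUniversal {F : Type u} {A : Type v} {G : Type t}
    [Field F] [NonUnitalNonAssocRing A] [Module F A] [Group G]
    (Γ : GroupGrading F A G) : Prop :=
  ∃ φ : Γ.UniversalGroup ≃* G, ∀ s : Γ.support, φ (PresentedGroup.of s) = (s : G)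

/-- `Δ` is a refinement of `Γ` (that is, `Γ` is a coarsening of `Δ`). -/
def Refines {F : Type u} {A : Type v} {H : Type w} {G : Type t}
    [Field F] [NonUnitalNonAssocRing A] [Module F A] [Group H] [Group G]
    (Δ : GroupGrading F A H) (Γ : GroupGrading F A G) : Prop :=
  ∀ h : H, ∃ g : G, Δ.component h ≤ Γ.component g

/-- `Γ` is a grading on the superalgebra with main grading `P`:
`A^g = (A^g ∩ A_0) ⊕ (A^g ∩ A_1)` for every `g`. -/
def IsSuper {F : Type u} {A : Type v} {G : Type t}
    [Field F] [NonUnitalNonAssocRing A] [Module F A] [Group G]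
    (P : GroupGrading F A (Multiplicative (ZMod 2))) (Γ : GroupGrading F A G) : Prop :=
  ∀ g : G, Γ.component g =
    (Γ.component g ⊓ P.component (Multiplicative.ofAdd 0)) ⊔
      (Γ.component g ⊓ P.component (Multiplicative.ofAdd 1))

/-- `Γ` is fine: it has no proper refinement among the group gradings on the superalgebra with
main grading `P`, i.e. each such grading refining `Γ` is itself refined by `Γ`. -/
def IsFine.{w', u', v', t'} {F : Type u'} {A : Type v'} {G : Type t'}
    [Field F] [NonUnitalNonAssocRing A] [Module F A] [Group G]
    (P : GroupGrading F A (Multiplicative (ZMod 2))) (Γ : GroupGrading F A G) : Prop :=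
  ∀ (H : Type w') [Group H] (Δ : GroupGrading F A H),
    IsSuper P Δ → Δ.Refines Γ → Γ.Refines Δ

end GroupGrading

/-! ## Hurwitz algebras and the Cayley-Dickson doubling -/

/-- `q` makes the unital algebra `Q` a Hurwitz algebra: it is regular and multiplicative. -/
structure IsHurwitzNorm {F : Type u} {Q : Type v} [Field F] [NonAssocRing Q] [Module F Q]
    (q : QuadraticForm F Q) : Prop where
  regular : q.Nondegenerate
  map_mul : ∀ x y : Q, q (x * y) = q x * q y

/-- A Hurwitz algebra is split if its norm has a nonzero isotropic vector. -/
def IsSplitNorm {F : Type u} {Q : Type v} [Field F] [NonAssocRing Q] [Module F Q]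
    (q : QuadraticForm F Q) : Prop :=
  ∃ x : Q, x ≠ 0 ∧ q x = 0

/-- The canonical conjugation `x̄ = q(x,1) 1 - x`. -/
def hurwitzConj {F : Type u} {Q : Type v} [Field F] [NonAssocRing Q] [Module F Q]
    (q : QuadraticForm F Q) : Q →ₗ[F] Q :=
  (q.polarBilin.flip 1).smulRight 1 - LinearMap.id

/-- The Cayley-Dickson double `CD(Q, α) = Q ⊕ Qu`; the pair `(a, b)` stands for `a + bu`. -/
@[nolint unusedArguments]
def CD {F : Type u} {Q : Type v} [Field F] [NonAssocRing Q] [Module F Q]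
    (_q : QuadraticForm F Q) (_α : F) : Type v :=
  Q × Q

namespace CD

instance instAddCommGroup {F : Type u} {Q : Type v} [Field F] [NonAssocRing Q] [Module F Q]
    (q : QuadraticForm F Q) (α : F) : AddCommGroup (CD q α) :=
  inferInstanceAs (AddCommGroup (Q × Q))

instance instModule {F : Type u} {Q : Type v} [Field F] [NonAssocRing Q] [Module F Q]
    (q : QuadraticForm F Q) (α : F) : Module F (CD q α) :=
  inferInstanceAs (Module F (Q × Q))

/-- `(a + bu)(c + du) = (ac - α d̄ b) + (da + b c̄)u`. -/
instance instMul {F : Type u} {Q : Type v} [Field F] [NonAssocRing Q] [Module F Q]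
    (q : QuadraticForm F Q) (α : F) : Mul (CD q α) where
  mul x y :=
    (x.1 * y.1 - α • (hurwitzConj q y.2 * x.2), y.2 * x.1 + x.2 * hurwitzConj q y.1)

theorem mul_def {F : Type u} {Q : Type v} [Field F] [NonAssocRing Q] [Module F Q]
    {q : QuadraticForm F Q} {α : F} (x y : CD q α) :
    x * y = ((x.1 * y.1 - α • (hurwitzConj q y.2 * x.2),
      y.2 * x.1 + x.2 * hurwitzConj q y.1) : Q × Q) :=
  rfl

@[ext]
theorem ext {F : Type u} {Q : Type v} [Field F] [NonAssocRing Q] [Module F Q]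
    {q : QuadraticForm F Q} {α : F} {x y : CD q α} (h₁ : x.1 = y.1) (h₂ : x.2 = y.2) : x = y :=
  Prod.ext h₁ h₂

@[simp]
theorem fst_mul {F : Type u} {Q : Type v} [Field F] [NonAssocRing Q] [Module F Q]
    {q : QuadraticForm F Q} {α : F} (x y : CD q α) :
    (x * y).1 = x.1 * y.1 - α • (hurwitzConj q y.2 * x.2) :=
  rfl

@[simp]
theorem snd_mul {F : Type u} {Q : Type v} [Field F] [NonAssocRing Q] [Module F Q]
    {q : QuadraticForm F Q} {α : F} (x y : CD q α) :
    (x * y).2 = y.2 * x.1 + x.2 * hurwitzConj q y.1 :=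
  rfl

@[simp]
theorem fst_add {F : Type u} {Q : Type v} [Field F] [NonAssocRing Q] [Module F Q]
    {q : QuadraticForm F Q} {α : F} (x y : CD q α) : (x + y).1 = x.1 + y.1 :=
  rfl

@[simp]
theorem snd_add {F : Type u} {Q : Type v} [Field F] [NonAssocRing Q] [Module F Q]
    {q : QuadraticForm F Q} {α : F} (x y : CD q α) : (x + y).2 = x.2 + y.2 :=
  rfl

@[simp]
theorem fst_zero {F : Type u} {Q : Type v} [Field F] [NonAssocRing Q] [Module F Q]
    {q : QuadraticForm F Q} {α : F} : (0 : CD q α).1 = 0 :=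
  rfl

@[simp]
theorem snd_zero {F : Type u} {Q : Type v} [Field F] [NonAssocRing Q] [Module F Q]
    {q : QuadraticForm F Q} {α : F} : (0 : CD q α).2 = 0 :=
  rfl

@[simp]
theorem fst_smul {F : Type u} {Q : Type v} [Field F] [NonAssocRing Q] [Module F Q]
    {q : QuadraticForm F Q} {α : F} (c : F) (x : CD q α) : (c • x).1 = c • x.1 :=
  rfl

@[simp]
theorem snd_smul {F : Type u} {Q : Type v} [Field F] [NonAssocRing Q] [Module F Q]
    {q : QuadraticForm F Q} {α : F} (c : F) (x : CD q α) : (c • x).2 = c • x.2 :=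
  rfl

instance instRing {F : Type u} {Q : Type v} [Field F] [NonAssocRing Q] [Module F Q]
    (q : QuadraticForm F Q) (α : F) : NonUnitalNonAssocRing (CD q α) where
  __ := instAddCommGroup q α
  __ := instMul q α
  left_distrib x y z := by
    ext <;> simp [mul_add, add_mul, smul_add] <;> abel
  right_distrib x y z := by
    ext <;> simp [mul_add, add_mul, smul_add] <;> abel
  zero_mul x := by ext <;> simp
  mul_zero x := by ext <;> simp

instance instIsScalarTower {F : Type u} {Q : Type v} [Field F] [NonAssocRing Q] [Module F Q]
    [IsScalarTower F Q Q] [SMulCommClass F Q Q]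
    (q : QuadraticForm F Q) (α : F) : IsScalarTower F (CD q α) (CD q α) where
  smul_assoc c x y := by
    ext <;> simp [smul_sub, smul_add, smul_mul_assoc, mul_smul_comm, smul_comm α c]

instance instSMulCommClass {F : Type u} {Q : Type v} [Field F] [NonAssocRing Q] [Module F Q]
    [IsScalarTower F Q Q] [SMulCommClass F Q Q]
    (q : QuadraticForm F Q) (α : F) : SMulCommClass F (CD q α) (CD q α) where
  smul_comm c x y := by
    ext <;> simp [smul_sub, smul_add, smul_mul_assoc, mul_smul_comm, smul_comm α c]

/-- The inclusion `a ↦ a` of `Q` in `CD(Q, α) = Q ⊕ Qu`. -/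
def incl {F : Type u} {Q : Type v} [Field F] [NonAssocRing Q] [Module F Q]
    (q : QuadraticForm F Q) (α : F) : Q →ₗ[F] CD q α :=
  LinearMap.inl F Q Q

/-- The map `b ↦ bu` from `Q` to `CD(Q, α) = Q ⊕ Qu`. -/
def inclU {F : Type u} {Q : Type v} [Field F] [NonAssocRing Q] [Module F Q]
    (q : QuadraticForm F Q) (α : F) : Q →ₗ[F] CD q α :=
  LinearMap.inr F Q Q

/-- The norm `q(a + bu) = q(a) + α q(b)` of `CD(Q, α)`. -/
def norm {F : Type u} {Q : Type v} [Field F] [NonAssocRing Q] [Module F Q]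
    (q : QuadraticForm F Q) (α : F) : QuadraticForm F (CD q α) :=
  QuadraticMap.prod q (α • q)

@[simp]
theorem norm_apply {F : Type u} {Q : Type v} [Field F] [NonAssocRing Q] [Module F Q]
    (q : QuadraticForm F Q) (α : F) (x : CD q α) : norm q α x = q x.1 + α * q x.2 :=
  rfl

/-- The even part `C_0 = Q`. -/
def even {F : Type u} {Q : Type v} [Field F] [NonAssocRing Q] [Module F Q]
    (q : QuadraticForm F Q) (α : F) : Submodule F (CD q α) :=
  LinearMap.range (incl q α)

/-- The odd part `C_1 = Qu`. -/
def odd {F : Type u} {Q : Type v} [Field F] [NonAssocRing Q] [Module F Q]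
    (q : QuadraticForm F Q) (α : F) : Submodule F (CD q α) :=
  LinearMap.range (inclU q α)

theorem mem_even {F : Type u} {Q : Type v} [Field F] [NonAssocRing Q] [Module F Q]
    {q : QuadraticForm F Q} {α : F} {x : CD q α} : x ∈ even q α ↔ x.2 = 0 := by
  constructor
  · rintro ⟨a, rfl⟩
    rfl
  · intro h
    exact ⟨x.1, ext rfl h.symm⟩

theorem mem_odd {F : Type u} {Q : Type v} [Field F] [NonAssocRing Q] [Module F Q]
    {q : QuadraticForm F Q} {α : F} {x : CD q α} : x ∈ odd q α ↔ x.1 = 0 := by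
  constructor
  · rintro ⟨a, rfl⟩
    rfl
  · intro h
    exact ⟨x.2, ext h.symm rfl⟩

/-- The components of the main grading: `C_0 = Q` and `C_1 = Qu`. -/
def mainComponent {F : Type u} {Q : Type v} [Field F] [NonAssocRing Q] [Module F Q]
    (q : QuadraticForm F Q) (α : F)
    (i : Multiplicative (ZMod 2)) : Submodule F (CD q α) :=
  if i = Multiplicative.ofAdd 0 then even q α else odd q α

theorem mainComponent_of_eq {F : Type u} {Q : Type v} [Field F] [NonAssocRing Q] [Module F Q]
    (q : QuadraticForm F Q) (α : F)
    {i : Multiplicative (ZMod 2)} (hi : i = Multiplicative.ofAdd 0) :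
    mainComponent q α i = even q α :=
  if_pos hi

theorem mainComponent_of_ne {F : Type u} {Q : Type v} [Field F] [NonAssocRing Q] [Module F Q]
    (q : QuadraticForm F Q) (α : F)
    {i : Multiplicative (ZMod 2)} (hi : i ≠ Multiplicative.ofAdd 0) :
    mainComponent q α i = odd q α :=
  if_neg hi

theorem disjoint_even_odd {F : Type u} {Q : Type v} [Field F] [NonAssocRing Q] [Module F Q]
    (q : QuadraticForm F Q) (α : F) :
    Disjoint (even q α) (odd q α) := by
  rw [Submodule.disjoint_def]
  intro x hx hy
  exact ext (mem_odd.1 hy) (mem_even.1 hx)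

/-- The main `ℤ/2`-grading of the superalgebra `CD(Q, α)`. -/
def mainGrading {F : Type u} {Q : Type v} [Field F] [NonAssocRing Q] [Module F Q]
    (q : QuadraticForm F Q) (α : F) :
    GroupGrading F (CD q α) (Multiplicative (ZMod 2)) where
  component := mainComponent q α
  indep := by
    intro i
    by_cases hi : i = Multiplicative.ofAdd 0
    · rw [mainComponent_of_eq q α hi]
      refine (disjoint_even_odd q α).mono_right (iSup₂_le fun j hj => ?_)
      rw [mainComponent_of_ne q α (hi ▸ hj)]
    · rw [mainComponent_of_ne q α hi]
      refine (disjoint_even_odd q α).symm.mono_right (iSup₂_le fun j hj => ?_)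
      have h0 : j = Multiplicative.ofAdd 0 := by
        revert i j
        decide
      rw [mainComponent_of_eq q α h0]
  iSup_eq_top := by
    rw [eq_top_iff]
    intro x _
    have hx : x = incl q α x.1 + inclU q α x.2 :=
      ext (add_zero x.1).symm (zero_add x.2).symm
    rw [hx]
    refine Submodule.add_mem _ ?_ ?_
    · refine Submodule.mem_iSup_of_mem (Multiplicative.ofAdd 0) ?_
      rw [mainComponent_of_eq q α rfl]
      exact ⟨x.1, rfl⟩
    · refine Submodule.mem_iSup_of_mem (Multiplicative.ofAdd 1) ?_
      rw [mainComponent_of_ne q α (by decide)]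
      exact ⟨x.2, rfl⟩
  mul_mem := by
    intro g h x y hx hy
    by_cases hg : g = Multiplicative.ofAdd 0 <;> by_cases hh : h = Multiplicative.ofAdd 0
    · rw [mainComponent_of_eq q α hg, mem_even] at hx
      rw [mainComponent_of_eq q α hh, mem_even] at hy
      rw [mainComponent_of_eq q α (by rw [hg, hh]; rfl), mem_even]
      simp [hx, hy]
    · rw [mainComponent_of_eq q α hg, mem_even] at hx
      rw [mainComponent_of_ne q α hh, mem_odd] at hy
      rw [mainComponent_of_ne q α (by rw [hg]; simpa using hh), mem_odd]
      simp [hx, hy]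
    · rw [mainComponent_of_ne q α hg, mem_odd] at hx
      rw [mainComponent_of_eq q α hh, mem_even] at hy
      rw [mainComponent_of_ne q α (by rw [hh]; simpa using hg), mem_odd]
      simp [hx, hy]
    · rw [mainComponent_of_ne q α hg, mem_odd] at hx
      rw [mainComponent_of_ne q α hh, mem_odd] at hy
      rw [mainComponent_of_eq q α (by revert g h; decide), mem_even]
      simp [hx, hy]

end CD

/-! ## Canonical bases -/

/-- `{e₁, e₂, u₁, v₁}` is a canonical basis of the split quaternion algebra `A`. -/
structure IsCanonicalBasisFour (F : Type u) {A : Type v} [Field F] [NonUnitalNonAssocRing A]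
    [Module F A] (e₁ e₂ u₁ v₁ : A) : Prop where
  linearIndependent : LinearIndependent F ![e₁, e₂, u₁, v₁]
  span_eq_top : Submodule.span F {e₁, e₂, u₁, v₁} = ⊤
  e₁_e₁ : e₁ * e₁ = e₁
  e₁_e₂ : e₁ * e₂ = 0
  e₂_e₁ : e₂ * e₁ = 0
  e₂_e₂ : e₂ * e₂ = e₂
  e₁_u₁ : e₁ * u₁ = u₁
  e₂_u₁ : e₂ * u₁ = 0
  u₁_e₁ : u₁ * e₁ = 0
  u₁_e₂ : u₁ * e₂ = u₁
  e₁_v₁ : e₁ * v₁ = 0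
  e₂_v₁ : e₂ * v₁ = v₁
  v₁_e₁ : v₁ * e₁ = v₁
  v₁_e₂ : v₁ * e₂ = 0
  u₁_u₁ : u₁ * u₁ = 0
  v₁_v₁ : v₁ * v₁ = 0
  u₁_v₁ : u₁ * v₁ = -e₁
  v₁_u₁ : v₁ * u₁ = -e₂

/-- `{e₁, e₂, u₁, u₂, u₃, v₁, v₂, v₃}` is a canonical basis of the split Cayley algebra `A`, with
`u₁, u₂, u₃ = u 0, u 1, u 2` and `v₁, v₂, v₃ = v 0, v 1, v 2`. Indices are added modulo `3`, so
that `u_u_succ` reads `u₁ u₂ = v₃`, `u₂ u₃ = v₁`, `u₃ u₁ = v₂`. -/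
structure IsCanonicalBasisEight (F : Type u) {A : Type v} [Field F] [NonUnitalNonAssocRing A]
    [Module F A] (e₁ e₂ : A) (u v : Fin 3 → A) : Prop where
  linearIndependent : LinearIndependent F ![e₁, e₂, u 0, u 1, u 2, v 0, v 1, v 2]
  span_eq_top : Submodule.span F {e₁, e₂, u 0, u 1, u 2, v 0, v 1, v 2} = ⊤
  e₁_e₁ : e₁ * e₁ = e₁
  e₁_e₂ : e₁ * e₂ = 0
  e₂_e₁ : e₂ * e₁ = 0
  e₂_e₂ : e₂ * e₂ = e₂
  e₁_u : ∀ i, e₁ * u i = u i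
  e₂_u : ∀ i, e₂ * u i = 0
  u_e₁ : ∀ i, u i * e₁ = 0
  u_e₂ : ∀ i, u i * e₂ = u i
  e₁_v : ∀ i, e₁ * v i = 0
  e₂_v : ∀ i, e₂ * v i = v i
  v_e₁ : ∀ i, v i * e₁ = v i
  v_e₂ : ∀ i, v i * e₂ = 0
  u_u_self : ∀ i, u i * u i = 0
  u_u_succ : ∀ i, u i * u (i + 1) = v (i + 2)
  succ_u_u : ∀ i, u (i + 1) * u i = -v (i + 2)
  v_v_self : ∀ i, v i * v i = 0
  v_v_succ : ∀ i, v i * v (i + 1) = u (i + 2)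
  succ_v_v : ∀ i, v (i + 1) * v i = -u (i + 2)
  u_v_self : ∀ i, u i * v i = -e₁
  v_u_self : ∀ i, v i * u i = -e₂
  u_v_of_ne : ∀ i j, i ≠ j → u i * v j = 0
  v_u_of_ne : ∀ i j, i ≠ j → v i * u j = 0

/-! ## The gradings of the classification -/

namespace CD

/-- Up to an identification of `G` with `ℤ/2`, `Γ` is the main grading. -/
def IsMainGrading {F : Type u} {Q : Type v} {G : Type t} [Field F] [NonAssocRing Q] [Module F Q]
    [Group G] {q : QuadraticForm F Q} {α : F} (Γ : GroupGrading F (CD q α) G) : Prop :=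
  ∃ φ : G ≃* Multiplicative (ZMod 2),
    ∀ i, Γ.component (φ.symm i) = (mainGrading q α).component i

/-- Up to an identification of `G` with `ℤ`, `Γ` is the 3-grading of a canonical basis
`{e₁, e₂, u₁, v₁}` with `C_0 = span {e₁, e₂}`, `C_1 = span {u₁, v₁}`:
`C^0 = span {e₁, e₂}`, `C^1 = span {u₁}`, `C^{-1} = span {v₁}`. -/
def IsThreeGrading {F : Type u} {Q : Type v} {G : Type t} [Field F] [NonAssocRing Q] [Module F Q]
    [Group G] {q : QuadraticForm F Q} {α : F} (Γ : GroupGrading F (CD q α) G) : Prop :=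
  ∃ φ : G ≃* Multiplicative ℤ, ∃ e₁ e₂ u₁ v₁ : CD q α,
    IsCanonicalBasisFour F e₁ e₂ u₁ v₁ ∧
    even q α = Submodule.span F {e₁, e₂} ∧
    odd q α = Submodule.span F {u₁, v₁} ∧
    Γ.component (φ.symm (Multiplicative.ofAdd 0)) = Submodule.span F {e₁, e₂} ∧
    Γ.component (φ.symm (Multiplicative.ofAdd 1)) = Submodule.span F {u₁} ∧
    Γ.component (φ.symm (Multiplicative.ofAdd (-1))) = Submodule.span F {v₁}

/-- Up to an identification of `G` with `(ℤ/2)²`, `Γ` is the refinement of the main grading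
obtained from a Cayley-Dickson doubling process `C = Q ⊕ Qu`, `Q = K ⊕ Kv` whose starting
algebra `K = F1 + Fw` (where `w` has nonzero trace) is not split:
`C^{(0,0)} = K`, `C^{(1,0)} = Kv`, `C^{(0,1)} = Ku`, `C^{(1,1)} = K(vu)`. -/
def IsNonsplitDoublingGrading {F : Type u} {Q : Type v} {G : Type t} [Field F] [NonAssocRing Q]
    [Module F Q] [IsScalarTower F Q Q] [SMulCommClass F Q Q]
    [Group G] {q : QuadraticForm F Q} {α : F} (Γ : GroupGrading F (CD q α) G) : Prop :=
  ∃ φ : G ≃* Multiplicative (ZMod 2 × ZMod 2),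
  ∃ (w v u : CD q α) (K : Submodule F (CD q α)),
    w ∈ even q α ∧ v ∈ even q α ∧ u ∈ odd q α ∧
    (norm q α).polarBilin w (incl q α 1) ≠ 0 ∧
    (norm q α).polarBilin v (incl q α 1) = 0 ∧
    (norm q α).polarBilin v w = 0 ∧
    norm q α v ≠ 0 ∧ norm q α u ≠ 0 ∧
    K = Submodule.span F {incl q α 1, w} ∧
    (∀ x ∈ K, norm q α x = 0 → x = 0) ∧
    Γ.component (φ.symm (Multiplicative.ofAdd (0, 0))) = K ∧
    Γ.component (φ.symm (Multiplicative.ofAdd (1, 0))) = K.map (LinearMap.mulRight F v) ∧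
    Γ.component (φ.symm (Multiplicative.ofAdd (0, 1))) = K.map (LinearMap.mulRight F u) ∧
    Γ.component (φ.symm (Multiplicative.ofAdd (1, 1))) = K.map (LinearMap.mulRight F (v * u))

/-- Up to an identification of `G` with `ℤ²`, `Γ` is the Cartan grading of a canonical basis with
`C_0 = span {e₁, e₂, u₃, v₃}` and `C_1 = span {u₁, u₂, v₁, v₂}`. -/
def IsCartanGrading {F : Type u} {Q : Type v} {G : Type t} [Field F] [NonAssocRing Q]
    [Module F Q] [Group G] {q : QuadraticForm F Q} {α : F}
    (Γ : GroupGrading F (CD q α) G) : Prop :=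
  ∃ φ : G ≃* Multiplicative (ℤ × ℤ), ∃ (e₁ e₂ : CD q α) (u v : Fin 3 → CD q α),
    IsCanonicalBasisEight F e₁ e₂ u v ∧
    even q α = Submodule.span F {e₁, e₂, u 2, v 2} ∧
    odd q α = Submodule.span F {u 0, u 1, v 0, v 1} ∧
    Γ.component (φ.symm (Multiplicative.ofAdd (0, 0))) = Submodule.span F {e₁, e₂} ∧
    Γ.component (φ.symm (Multiplicative.ofAdd (1, 1))) = Submodule.span F {v 2} ∧
    Γ.component (φ.symm (Multiplicative.ofAdd (-1, -1))) = Submodule.span F {u 2} ∧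
    Γ.component (φ.symm (Multiplicative.ofAdd (1, 0))) = Submodule.span F {u 0} ∧
    Γ.component (φ.symm (Multiplicative.ofAdd (-1, 0))) = Submodule.span F {v 0} ∧
    Γ.component (φ.symm (Multiplicative.ofAdd (0, 1))) = Submodule.span F {u 1} ∧
    Γ.component (φ.symm (Multiplicative.ofAdd (0, -1))) = Submodule.span F {v 1}

end CD

set_option linter.unusedSectionVars false

open QuadraticMap (polar)

/-! ## Composition algebras -/

namespace QuadraticForm

variable {F : Type u} {A : Type v} [Field F] [NonUnitalNonAssocRing A] [Module F A]
  {n : QuadraticForm F A}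

/-! The algebra `C` is a composition algebra with unit `e`: it is the double of an associative
Hurwitz algebra, so its norm `n` is multiplicative and its polar form is nondegenerate. Each `x`
satisfies `x² = t(x)x - n(x)e` with `t(x) = n(x,e)`. Comparing degrees in this equation shows that
`e` has degree 1 and that the trace vanishes in every other degree; since `n(x,y) = t(xȳ)`, the
component of degree `g` pairs only with the one of degree `g⁻¹` (`polar_unit_eq_zero`,
`polar_eq_zero`).

Every grading is a coarsening of a listed one. By nondegeneracy there is an even `w` of degree 1 and
nonzero trace. If some isotropic element of `C_0 ∩ C^1` has nonzero trace, a multiple of it is an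
idempotent `c`. The Peirce components of `c` are spanned by elements homogeneous for `Γ` and for the
parity, and dual vectors in opposite Peirce components assemble into a homogeneous canonical basis
(`exists_canonicalBasisFour`, `exists_canonicalBasisEight`). If there is none, `K = Fe + Fw` is
anisotropic. In dimension 8, homogeneous anisotropic `v` (even, orthogonal to `K`) and `u` (odd)
exist, and doubling `K` by `v` and then by `u` gives a refinement of `Γ` (`exists_doublingTriple`).
In dimension 4 the even part is `K` itself and the main grading refines `Γ` (`main_refines`).

A fine `Γ` and the listed grading that refines it therefore refine each other. Both groups have the
universal property, so the bijection of the supports extends to an isomorphism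
(`HasUniversalProperty.exists_mulEquiv`).

Conversely, the listed gradings are fine by `Refines.symm_of_composition`. In characteristic 2 the
unit has trace zero, so the trace-zero elements of the neutral component are only the multiples of
`e`; a refinement cannot split that component, and every other component is a line or zero, or is
anisotropic and hence generated over the neutral component by any one of its nonzero elements. -/

theorem polar_mul_mul_left (h : ∀ x y, n (x * y) = n x * n y) (x y z : A) :
    polar n (x * y) (x * z) = n x * polar n y z := by
  simp only [QuadraticMap.polar, ← mul_add, h]
  ring

theorem polar_mul_mul_right (h : ∀ x y, n (x * y) = n x * n y) (x y z : A) :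
    polar n (y * x) (z * x) = polar n y z * n x := by
  simp only [QuadraticMap.polar, ← add_mul, h]
  ring

/-- The linearization of `polar_mul_mul_left` in the repeated factor; the adjoint formulas for left
and right multiplication are its cases with one argument equal to the unit. -/
theorem polar_mul_mul_add (h : ∀ x y, n (x * y) = n x * n y) (x y w z : A) :
    polar n (x * y) (w * z) + polar n (w * y) (x * z) = polar n x w * polar n y z := by
  have h1 := polar_mul_mul_left h (x + w) y z
  have h2 := polar_mul_mul_left h x y z
  have h3 := polar_mul_mul_left h w y z
  have h4 : n (x + w) = n x + n w + polar n x w := QuadraticMap.map_add n x w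
  rw [h4] at h1
  simp only [add_mul, QuadraticMap.polar_add_left, QuadraticMap.polar_add_right] at h1
  linear_combination h1 - h2 - h3

end QuadraticForm

/-- The nondegenerate quadratic form `n` makes `A` a composition algebra with unit `e`. -/
structure IsCompositionNorm {F : Type u} {A : Type v} [Field F] [NonUnitalNonAssocRing A]
    [Module F A] (n : QuadraticForm F A) (e : A) : Prop where
  protected one_mul : ∀ x, e * x = x
  protected mul_one : ∀ x, x * e = x
  protected map_one : n e = 1
  protected map_mul : ∀ x y, n (x * y) = n x * n y
  eq_zero_of_polar : ∀ x, (∀ y, polar n x y = 0) → x = 0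

/-- The conjugation `x ↦ n(x, e) e - x`. -/
def compConj {F : Type u} {A : Type v} [Field F] [NonUnitalNonAssocRing A] [Module F A]
    (n : QuadraticForm F A) (e x : A) : A :=
  polar n x e • e - x

namespace IsCompositionNorm

section General

variable {F : Type u} {A : Type v} [Field F] [NonUnitalNonAssocRing A] [Module F A]
  {n : QuadraticForm F A} {e : A}

theorem ext_polar (h : IsCompositionNorm n e) {x y : A}
    (hxy : ∀ z, polar n x z = polar n y z) : x = y := by
  rw [← sub_eq_zero]
  refine h.eq_zero_of_polar _ fun z => ?_
  rw [QuadraticMap.polar_sub_left, hxy, sub_self]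

theorem unit_ne_zero (h : IsCompositionNorm n e) : e ≠ 0 := by
  rintro rfl
  simpa using h.map_one

theorem polar_mul_mul_left (h : IsCompositionNorm n e) (x y z : A) :
    polar n (x * y) (x * z) = n x * polar n y z :=
  QuadraticForm.polar_mul_mul_left h.map_mul x y z

theorem polar_mul_mul_right (h : IsCompositionNorm n e) (x y z : A) :
    polar n (y * x) (z * x) = polar n y z * n x :=
  QuadraticForm.polar_mul_mul_right h.map_mul x y z

theorem polar_mul_mul_add (h : IsCompositionNorm n e) (x y w z : A) :
    polar n (x * y) (w * z) + polar n (w * y) (x * z) = polar n x w * polar n y z :=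
  QuadraticForm.polar_mul_mul_add h.map_mul x y w z

theorem polar_mul_self (h : IsCompositionNorm n e) (x y : A) :
    polar n (y * x) x = polar n y e * n x := by
  simpa only [h.one_mul] using h.polar_mul_mul_right x y e

theorem polar_mul_self' (h : IsCompositionNorm n e) (x y : A) :
    polar n (x * y) x = n x * polar n y e := by
  simpa only [h.mul_one] using h.polar_mul_mul_left x y e

theorem polar_unit_unit (h : IsCompositionNorm n e) : polar n e e = 2 := by
  rw [QuadraticMap.polar_self, h.map_one, two_nsmul]
  norm_num

theorem compConj_unit (h : IsCompositionNorm n e) : compConj n e e = e := by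
  rw [compConj, h.polar_unit_unit, two_smul, add_sub_cancel_right]

theorem compConj_of_polar_eq_zero {x : A} (hx : polar n x e = 0) : compConj n e x = -x := by
  rw [compConj, hx, zero_smul, zero_sub]

theorem compConj_add (x y : A) : compConj n e (x + y) = compConj n e x + compConj n e y := by
  simp only [compConj, QuadraticMap.polar_add_left, add_smul]
  abel

theorem polar_compConj_unit (h : IsCompositionNorm n e) (x : A) :
    polar n (compConj n e x) e = polar n x e := by
  rw [compConj, QuadraticMap.polar_sub_left, QuadraticMap.polar_smul_left, h.polar_unit_unit,
    smul_eq_mul]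
  ring

theorem compConj_compConj (h : IsCompositionNorm n e) (x : A) :
    compConj n e (compConj n e x) = x := by
  rw [compConj, h.polar_compConj_unit, compConj, sub_sub_cancel]

theorem polar_compConj_left (x y : A) :
    polar n (compConj n e x) y = polar n x (compConj n e y) := by
  simp only [compConj, QuadraticMap.polar_sub_left, QuadraticMap.polar_smul_left,
    QuadraticMap.polar_sub_right, QuadraticMap.polar_smul_right, smul_eq_mul,
    QuadraticMap.polar_comm n e y]
  ring

/-- Expand the norm of `x̄ + x = t(x)e`, which is `t(x)²`, using `n(x̄,x) = t(x)² - 2n(x)`. -/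
theorem map_compConj (h : IsCompositionNorm n e) (x : A) : n (compConj n e x) = n x := by
  have h1 := QuadraticMap.map_add n (compConj n e x) x
  have h2 : compConj n e x + x = polar n x e • e := by rw [compConj, sub_add_cancel]
  have h3 : polar n (compConj n e x) x = polar n x e * polar n x e - 2 * n x := by
    rw [compConj, QuadraticMap.polar_sub_left, QuadraticMap.polar_smul_left,
      QuadraticMap.polar_self, smul_eq_mul, QuadraticMap.polar_comm n e x, two_nsmul]
    ring
  rw [h2, h3, QuadraticMap.map_smul, h.map_one, smul_eq_mul] at h1
  linear_combination -h1

theorem polar_mul_left [IsScalarTower F A A] (h : IsCompositionNorm n e) (x y z : A) :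
    polar n (x * y) z = polar n y (compConj n e x * z) := by
  have h1 := h.polar_mul_mul_add x y e z
  rw [h.one_mul, h.one_mul] at h1
  rw [compConj, sub_mul, smul_mul_assoc, h.one_mul, QuadraticMap.polar_sub_right,
    QuadraticMap.polar_smul_right, smul_eq_mul]
  linear_combination h1

theorem polar_mul_right [SMulCommClass F A A] (h : IsCompositionNorm n e) (x y z : A) :
    polar n (x * y) z = polar n x (z * compConj n e y) := by
  have h1 := h.polar_mul_mul_add x y z e
  rw [h.mul_one, h.mul_one, QuadraticMap.polar_comm n (z * y)] at h1
  rw [compConj, mul_sub, mul_smul_comm, h.mul_one, QuadraticMap.polar_sub_right,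
    QuadraticMap.polar_smul_right, smul_eq_mul]
  linear_combination h1

end General

section Algebra

variable {F : Type u} {A : Type v} [Field F] [NonUnitalNonAssocRing A] [Module F A]
  [IsScalarTower F A A] [SMulCommClass F A A] {n : QuadraticForm F A} {e : A}

theorem polar_eq_polar_mul_compConj (h : IsCompositionNorm n e) (x y : A) :
    polar n x y = polar n (x * compConj n e y) e := by
  rw [h.polar_mul_right, h.compConj_compConj, h.one_mul]

/-- Left multiplications by `x` and by `x̄` are adjoint, so both sides have the same polar value
with every `z`; nondegeneracy turns this into an identity in the algebra. -/
theorem compConj_mul_mul (h : IsCompositionNorm n e) (x y : A) :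
    compConj n e x * (x * y) = n x • y := by
  refine h.ext_polar fun z => ?_
  rw [h.polar_mul_left, h.compConj_compConj, h.polar_mul_mul_left, QuadraticMap.polar_smul_left,
    smul_eq_mul]

theorem mul_compConj_mul (h : IsCompositionNorm n e) (x y : A) :
    x * (compConj n e x * y) = n x • y := by
  have h1 := h.compConj_mul_mul (compConj n e x) y
  rwa [h.compConj_compConj, h.map_compConj] at h1

theorem mul_mul_compConj (h : IsCompositionNorm n e) (x y : A) :
    y * x * compConj n e x = n x • y := by
  refine h.ext_polar fun z => ?_
  rw [h.polar_mul_right, h.compConj_compConj, h.polar_mul_mul_right,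
    QuadraticMap.polar_smul_left, smul_eq_mul, mul_comm]

theorem mul_compConj_mul' (h : IsCompositionNorm n e) (x y : A) :
    y * compConj n e x * x = n x • y := by
  have h1 := h.mul_mul_compConj (compConj n e x) y
  rwa [h.compConj_compConj, h.map_compConj] at h1

protected theorem mul_self (h : IsCompositionNorm n e) (x : A) :
    x * x = polar n x e • x - n x • e := by
  have h1 := h.compConj_mul_mul x e
  rw [h.mul_one, compConj, sub_mul, smul_mul_assoc, h.one_mul] at h1
  rw [← h1, sub_sub_cancel]

theorem left_linearized (h : IsCompositionNorm n e) (x y z : A) :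
    x * (compConj n e y * z) + y * (compConj n e x * z) = polar n x y • z := by
  have h1 := h.mul_compConj_mul (x + y) z
  have h2 := h.mul_compConj_mul x z
  have h3 := h.mul_compConj_mul y z
  rw [QuadraticMap.map_add n, compConj_add] at h1
  simp only [add_mul, mul_add, add_smul, h2, h3] at h1
  rw [← sub_eq_zero] at h1 ⊢
  rw [← h1]
  abel

theorem right_linearized (h : IsCompositionNorm n e) (x y z : A) :
    z * compConj n e x * y + z * compConj n e y * x = polar n x y • z := by
  have h1 := h.mul_compConj_mul' (x + y) z
  have h2 := h.mul_compConj_mul' x z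
  have h3 := h.mul_compConj_mul' y z
  rw [QuadraticMap.map_add n, compConj_add] at h1
  simp only [add_mul, mul_add, add_smul, h2, h3] at h1
  rw [← sub_eq_zero] at h1 ⊢
  rw [← h1]
  abel

theorem compConj_mul (h : IsCompositionNorm n e) (x y : A) :
    compConj n e (x * y) = compConj n e y * compConj n e x := by
  refine h.ext_polar fun z => ?_
  have h1 := h.polar_mul_left (compConj n e y) (compConj n e x) z
  rw [h.compConj_compConj] at h1
  have h2 := h.polar_mul_left x y (compConj n e z)
  have h3 := h.polar_mul_right y z (compConj n e x)
  rw [polar_compConj_left, h2, h1, ← h3, QuadraticMap.polar_comm]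

theorem eq_zero_of_mul_right_eq_zero (h : IsCompositionNorm n e) {x y : A} (hy : n y ≠ 0)
    (hxy : x * y = 0) : x = 0 := by
  have h1 := h.mul_mul_compConj y x
  rw [hxy, zero_mul] at h1
  exact (smul_eq_zero.1 h1.symm).resolve_left hy

theorem eq_zero_of_mul_left_eq_zero (h : IsCompositionNorm n e) {x y : A} (hx : n x ≠ 0)
    (hxy : x * y = 0) : y = 0 := by
  have h1 := h.compConj_mul_mul x y
  rw [hxy, mul_zero] at h1
  exact (smul_eq_zero.1 h1.symm).resolve_left hx

/-! ### Multiplication in a doubling -/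

/-- For `x` of trace zero `x̄ = -x`, so for orthogonal `a` and `x` the linearized identity has no
right-hand side: moving `a` past `x` conjugates it. All the doubling rules rest on this. -/
theorem mul_mul_of_polar_eq_zero (h : IsCompositionNorm n e) {a x : A} (hx : polar n x e = 0)
    (hax : polar n a x = 0) (z : A) : a * (x * z) = x * (compConj n e a * z) := by
  have h1 := h.left_linearized a x z
  rw [compConj_of_polar_eq_zero hx, hax, zero_smul, neg_mul, mul_neg, neg_add_eq_zero] at h1
  exact h1

theorem mul_mul_of_polar_eq_zero' (h : IsCompositionNorm n e) {a x : A} (hx : polar n x e = 0)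
    (hax : polar n a x = 0) (z : A) : z * x * a = z * compConj n e a * x := by
  have h1 := h.right_linearized x a z
  rw [compConj_of_polar_eq_zero hx, QuadraticMap.polar_comm, hax, zero_smul, mul_neg, neg_mul,
    neg_add_eq_zero] at h1
  exact h1

theorem mul_comm_of_polar_eq_zero (h : IsCompositionNorm n e) {a x : A} (hx : polar n x e = 0)
    (hax : polar n a x = 0) : x * a = compConj n e a * x := by
  have h1 := h.mul_mul_of_polar_eq_zero' hx hax e
  rwa [h.one_mul, h.one_mul] at h1

theorem mul_comm_of_polar_eq_zero' (h : IsCompositionNorm n e) {a x : A} (hx : polar n x e = 0)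
    (hax : polar n a x = 0) : a * x = x * compConj n e a := by
  have h1 := h.mul_mul_of_polar_eq_zero hx hax e
  rwa [h.mul_one, h.mul_one] at h1

/-- `a(bx) = (ba)x` when `a` and `ba` are orthogonal to `x`. -/
theorem mul_mul_double (h : IsCompositionNorm n e) {a b x : A} (hx : polar n x e = 0)
    (ha : polar n a x = 0) (hb : polar n b x = 0) (hba : polar n (b * a) x = 0) :
    a * (b * x) = b * a * x := by
  rw [h.mul_comm_of_polar_eq_zero' hx hb, h.mul_mul_of_polar_eq_zero hx ha, ← h.compConj_mul,
    ← h.mul_comm_of_polar_eq_zero' hx hba]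

/-- `(ax)(bx) = -n(x) b̄a`. -/
theorem double_mul_double (h : IsCompositionNorm n e) {a b x : A} (hx : polar n x e = 0)
    (hax : polar n (a * x) e = 0)
    (hbax : polar n (compConj n e b) (a * x) = 0) :
    a * x * (b * x) = -(n x • (compConj n e b * a)) := by
  -- Move `b̄` past the trace-zero element `ax`: `b̄((ax)x) = (ax)(bx)`; then `(ax)x = -n(x)a`.
  have h1 := h.mul_mul_of_polar_eq_zero hax hbax x
  rw [h.compConj_compConj] at h1
  have h2 := h.mul_mul_compConj x a
  rw [compConj_of_polar_eq_zero hx, mul_neg, neg_eq_iff_eq_neg] at h2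
  rw [← h1, h2, mul_neg, mul_smul_comm]

end Algebra

end IsCompositionNorm

/-! ## Homogeneous components -/

namespace GroupGrading

section Proj

variable {F : Type u} {A : Type v} {G : Type t} [Field F] [NonUnitalNonAssocRing A] [Module F A]
  [Group G]

theorem isCompl (Γ : GroupGrading F A G) (g : G) :
    IsCompl (Γ.component g) (⨆ (h) (_ : h ≠ g), Γ.component h) := by
  refine ⟨Γ.indep g, codisjoint_iff.2 ?_⟩
  rw [eq_top_iff, ← Γ.iSup_eq_top]
  refine iSup_le fun h => ?_
  by_cases hg : h = g
  · exact hg ▸ le_sup_left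
  · exact (le_iSup₂_of_le (f := fun h (_ : h ≠ g) => Γ.component h) h hg le_rfl).trans le_sup_right

/-- The projection onto the component of degree `g`. -/
noncomputable def proj (Γ : GroupGrading F A G) (g : G) : A →ₗ[F] A :=
  Submodule.projection _ _ (Γ.isCompl g)

variable (Γ : GroupGrading F A G)

theorem proj_mem (g : G) (x : A) : Γ.proj g x ∈ Γ.component g :=
  Submodule.projection_apply_mem (Γ.isCompl g) x

theorem proj_of_mem {g : G} {x : A} (hx : x ∈ Γ.component g) : Γ.proj g x = x :=
  Submodule.projection_apply_left (Γ.isCompl g) ⟨x, hx⟩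

theorem proj_of_mem_of_ne {g h : G} {x : A} (hx : x ∈ Γ.component h) (hgh : h ≠ g) :
    Γ.proj g x = 0 :=
  (Submodule.projection_apply_eq_zero_iff (Γ.isCompl g)).2
    ((le_iSup₂_of_le (f := fun h (_ : h ≠ g) => Γ.component h) h hgh le_rfl) hx)

@[elab_as_elim]
theorem homogeneous_induction {p : A → Prop} (x : A)
    (hom : ∀ g, ∀ y ∈ Γ.component g, p y) (zero : p 0)
    (add : ∀ y z, p y → p z → p (y + z)) : p x :=
  Submodule.iSup_induction Γ.component (motive := p) (by rw [Γ.iSup_eq_top]; trivial) hom zero add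

theorem linearMap_ext {M : Type*} [AddCommGroup M] [Module F M] {f f' : A →ₗ[F] M}
    (hf : ∀ g, ∀ y ∈ Γ.component g, f y = f' y) : f = f' := by
  ext x
  refine Γ.homogeneous_induction x hf (by simp) fun y z hy hz => ?_
  rw [map_add, map_add, hy, hz]

/-- An element lies in each submodule that contains its homogeneous components. -/
theorem mem_of_proj_mem {W : Submodule F A} {x : A} (hx : ∀ g, Γ.proj g x ∈ W) : x ∈ W := by
  classical
  obtain ⟨f, hf, rfl⟩ := (Submodule.mem_iSup_iff_exists_finsupp Γ.component x).1
    (by rw [Γ.iSup_eq_top]; trivial)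
  refine Submodule.sum_mem _ fun g hg => ?_
  have h1 : Γ.proj g (f.sum fun _ a => a) = f g := by
    rw [Finsupp.sum, map_sum, Finset.sum_eq_single_of_mem g hg, Γ.proj_of_mem (hf g)]
    exact fun h _ hgh => Γ.proj_of_mem_of_ne (hf h) hgh
  exact h1 ▸ hx g

theorem exists_proj_ne_zero {M : Type*} [AddCommGroup M] [Module F M] (f : A →ₗ[F] M) {x : A}
    (hx : f x ≠ 0) : ∃ g, f (Γ.proj g x) ≠ 0 := by
  by_contra! h
  exact hx (Γ.mem_of_proj_mem (W := LinearMap.ker f) h)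

theorem eq_of_mem_component {g h : G} {x : A} (hx : x ≠ 0) (hg : x ∈ Γ.component g)
    (hh : x ∈ Γ.component h) : g = h := by
  by_contra hne
  exact hx ((Γ.proj_of_mem hh).symm.trans (Γ.proj_of_mem_of_ne hg hne))

theorem proj_mul_left {a : A} (ha : a ∈ Γ.component 1) (g : G) (x : A) :
    Γ.proj g (a * x) = a * Γ.proj g x := by
  refine Γ.homogeneous_induction x (fun h y hy => ?_) (by simp) fun y z hy hz => ?_
  · have h1 := Γ.mul_mem ha hy
    rw [one_mul] at h1
    by_cases hgh : h = g
    · subst hgh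
      rw [Γ.proj_of_mem h1, Γ.proj_of_mem hy]
    · rw [Γ.proj_of_mem_of_ne h1 hgh, Γ.proj_of_mem_of_ne hy hgh, mul_zero]
  · rw [mul_add, map_add, map_add, mul_add, hy, hz]

/-- The projections of a grading preserve the parity. -/
theorem IsSuper.proj_mem {P : GroupGrading F A (Multiplicative (ZMod 2))} {Γ : GroupGrading F A G}
    (hΓ : IsSuper P Γ) (g : G) {i : Multiplicative (ZMod 2)} {x : A} (hx : x ∈ P.component i) :
    Γ.proj g x ∈ P.component i := by
  -- The parity projections preserve the components of `Γ`, so the two families of projections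
  -- commute.
  have h1 : ∀ h, ∀ y ∈ Γ.component h, P.proj i y ∈ Γ.component h := by
    intro h y hy
    rw [hΓ h] at hy
    obtain ⟨a, ⟨ha, ha'⟩, b, ⟨hb, hb'⟩, rfl⟩ := Submodule.mem_sup.1 hy
    rw [map_add]
    refine add_mem ?_ ?_
    · by_cases hi : Multiplicative.ofAdd 0 = i
      · exact (P.proj_of_mem (hi ▸ ha')).symm ▸ ha
      · exact (P.proj_of_mem_of_ne ha' hi).symm ▸ zero_mem _
    · by_cases hi : Multiplicative.ofAdd 1 = i
      · exact (P.proj_of_mem (hi ▸ hb')).symm ▸ hb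
      · exact (P.proj_of_mem_of_ne hb' hi).symm ▸ zero_mem _
  have h2 : Γ.proj g (P.proj i x) = P.proj i (Γ.proj g x) := by
    refine Γ.homogeneous_induction x (fun h y hy => ?_) (by simp) fun y z hy hz => ?_
    · by_cases hgh : h = g
      · subst hgh
        rw [Γ.proj_of_mem (h1 _ y hy), Γ.proj_of_mem hy]
      · rw [Γ.proj_of_mem_of_ne (h1 _ y hy) hgh, Γ.proj_of_mem_of_ne hy hgh, map_zero]
    · simp only [map_add, hy, hz]
  rw [P.proj_of_mem hx] at h2
  exact h2 ▸ P.proj_mem i _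

/-- The component of `Δ` of degree `h` lies in the component of `Γ` of degree `d h`, so `Δ.proj h`
factors through `Γ.proj (d h)`. -/
theorem Refines.proj_mem {H : Type w} [Group H] {Δ : GroupGrading F A H} {Γ : GroupGrading F A G}
    (hΔ : Δ.Refines Γ) (h : H) {g : G} {x : A} (hx : x ∈ Γ.component g) :
    Δ.proj h x ∈ Γ.component g := by
  choose d hd using hΔ
  have h1 : Δ.proj h (Γ.proj (d h) x) = Δ.proj h x := by
    refine Δ.homogeneous_induction x (fun k y hy => ?_) (by simp) fun y z hy hz => ?_
    · by_cases hk : d k = d h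
      · rw [Γ.proj_of_mem (hk ▸ hd k hy)]
      · rw [Γ.proj_of_mem_of_ne (hd k hy) hk, map_zero,
          Δ.proj_of_mem_of_ne hy fun hkh => hk (congrArg d hkh)]
    · simp only [map_add, hy, hz]
  by_cases hg : g = d h
  · exact hg ▸ hd h (Δ.proj_mem h x)
  · rw [← h1, Γ.proj_of_mem_of_ne hx hg, map_zero]
    exact zero_mem _

/-- A nonzero component of `Γ` contains a nonzero `Δ`-homogeneous element, a projection of any of
its nonzero vectors. It is enough to show that such an element pulls the whole component into its
own degree. -/
theorem Refines.exists_of_le {H : Type w} [Group H] {Δ : GroupGrading F A H}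
    {Γ : GroupGrading F A G} (hΔ : Δ.Refines Γ) {g : G}
    (hg : ∀ h, ∀ y ∈ Δ.component h, y ∈ Γ.component g → y ≠ 0 → Γ.component g ≤ Δ.component h) :
    ∃ h, Γ.component g ≤ Δ.component h := by
  by_cases h0 : Γ.component g = ⊥
  · exact ⟨1, h0 ▸ bot_le⟩
  · obtain ⟨x, hx, hx0⟩ := Submodule.exists_mem_ne_zero_of_ne_bot h0
    obtain ⟨h, hh⟩ := Δ.exists_proj_ne_zero LinearMap.id hx0
    exact ⟨h, hg h _ (Δ.proj_mem h x) (hΔ.proj_mem h hx) hh⟩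

end Proj

/-! ## Gradings on composition algebras -/

section Composition

variable {F : Type u} {A : Type v} {G : Type t} [Field F] [NonUnitalNonAssocRing A] [Module F A]
  [IsScalarTower F A A] [SMulCommClass F A A] [Group G] {n : QuadraticForm F A} {e : A}
  (h : IsCompositionNorm n e) (Γ : GroupGrading F A G)

include h

/-- The part of `e` of degree 1 is already a left unit: compare degrees in `ey = y` for homogeneous
`y`. A left unit equals `e`. -/
theorem unit_mem : e ∈ Γ.component 1 := by
  have h1 : ∀ x, Γ.proj 1 e * x = x := by
    intro x
    refine Γ.homogeneous_induction x (fun g y hy => ?_) (by simp) fun y z hy hz => ?_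
    · have h2 : ∀ z, Γ.proj 1 z * y = Γ.proj g (z * y) := by
        intro z
        refine Γ.homogeneous_induction z (fun k a ha => ?_) (by simp) fun a b ha hb => ?_
        · by_cases hk : k = 1
          · subst hk
            have h3 := Γ.mul_mem ha hy
            rw [one_mul] at h3
            rw [Γ.proj_of_mem ha, Γ.proj_of_mem h3]
          · rw [Γ.proj_of_mem_of_ne ha hk, zero_mul,
              Γ.proj_of_mem_of_ne (Γ.mul_mem ha hy) fun hkg => hk (mul_eq_right.1 hkg)]
        · rw [map_add, add_mul, add_mul, map_add, ha, hb]
      rw [h2, h.one_mul, Γ.proj_of_mem hy]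
    · rw [mul_add, hy, hz]
  have h2 := h1 e
  rw [h.mul_one] at h2
  exact h2 ▸ Γ.proj_mem 1 e

/-- In `x² = t(x)x - n(x)e` take the part of degree `g`: neither `x²`, of degree `g²`, nor `e`
contributes when `g ≠ 1`, so `t(x)x = 0`. -/
theorem polar_unit_eq_zero {g : G} (hg : g ≠ 1) {x : A} (hx : x ∈ Γ.component g) :
    polar n x e = 0 := by
  have h1 := congrArg (Γ.proj g) (h.mul_self x)
  rw [Γ.proj_of_mem_of_ne (Γ.mul_mem hx hx) fun hgg => hg (mul_eq_right.1 hgg), map_sub, map_smul,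
    map_smul, Γ.proj_of_mem hx, Γ.proj_of_mem_of_ne (Γ.unit_mem h) hg.symm, smul_zero,
    sub_zero] at h1
  rcases smul_eq_zero.1 h1.symm with h2 | rfl
  · exact h2
  · exact QuadraticMap.polar_zero_left n e

theorem compConj_mem {g : G} {x : A} (hx : x ∈ Γ.component g) :
    compConj n e x ∈ Γ.component g := by
  by_cases hg : g = 1
  · subst hg
    exact sub_mem (Submodule.smul_mem _ _ (Γ.unit_mem h)) hx
  · rw [IsCompositionNorm.compConj_of_polar_eq_zero (Γ.polar_unit_eq_zero h hg hx)]
    exact neg_mem hx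

/-- The value `n(x,y)` is the trace of `xȳ`, which is homogeneous of degree `gk`. -/
theorem polar_eq_zero {g k : G} (hgk : g * k ≠ 1) {x y : A} (hx : x ∈ Γ.component g)
    (hy : y ∈ Γ.component k) : polar n x y = 0 := by
  rw [h.polar_eq_polar_mul_compConj]
  exact Γ.polar_unit_eq_zero h hgk (Γ.mul_mem hx (Γ.compConj_mem h hy))

/-- A criterion for a grading to have no proper refinement. -/
theorem Refines.symm_of_composition {H : Type w} [Group H] {Δ : GroupGrading F A H}
    {Γ : GroupGrading F A G} (hΔ : Δ.Refines Γ)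
    (hΓ : ∀ x ∈ Γ.component 1, polar n x e = 0 → x ∈ Submodule.span F {e})
    (hΓ' : ∀ g, g ≠ 1 → (∃ x, Γ.component g ≤ Submodule.span F {x}) ∨
      ∀ x ∈ Γ.component g, n x = 0 → x = 0) : Γ.Refines Δ := by
  have h1 : Γ.component 1 ≤ Δ.component 1 := by
    intro x hx
    refine Δ.mem_of_proj_mem fun k => ?_
    by_cases hk : k = 1
    · exact hk ▸ Δ.proj_mem k x
    -- A part of `x` of `Δ`-degree other than 1 has trace zero and still lies in the neutral
    -- component of `Γ`, so it is a multiple of `e`, which has `Δ`-degree 1.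
    · obtain ⟨c, hc⟩ := Submodule.mem_span_singleton.1 (hΓ _ (hΔ.proj_mem k hx)
        (Δ.polar_unit_eq_zero h hk (Δ.proj_mem k x)))
      rw [← hc]
      exact Submodule.smul_mem _ _ (Δ.unit_mem h)
  intro g
  by_cases hg : g = 1
  · exact ⟨1, hg ▸ h1⟩
  refine hΔ.exists_of_le fun k y hy hyg hy0 => ?_
  rcases hΓ' g hg with ⟨z, hz⟩ | hg'
  · refine hz.trans ?_
    obtain ⟨c, rfl⟩ := Submodule.mem_span_singleton.1 (hz hyg)
    have hc : c ≠ 0 := by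
      rintro rfl
      exact hy0 (zero_smul F z)
    rw [Submodule.span_singleton_le_iff_mem]
    simpa [smul_smul, hc] using Submodule.smul_mem _ c⁻¹ hy
  -- Anisotropic case. Since `y² = -n(y)e`, the degree satisfies `g² = 1`, so `xȳ` is neutral for
  -- `Γ`, hence for `Δ`; and `x` is recovered as `n(y)⁻¹(xȳ)y`.
  · have hny : n y ≠ 0 := fun hny => hy0 (hg' y hyg hny)
    have hty := Γ.polar_unit_eq_zero h hg hyg
    have hgg : g * g = 1 := by
      refine Γ.eq_of_mem_component (x := y * y) ?_ (Γ.mul_mem hyg hyg) ?_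
      · exact fun h0 => hy0 (h.eq_zero_of_mul_left_eq_zero hny h0)
      · rw [h.mul_self, hty, zero_smul, zero_sub]
        exact neg_mem (Submodule.smul_mem _ _ (Γ.unit_mem h))
    intro x hx
    have h2 := Δ.mul_mem (h1 (hgg ▸ Γ.mul_mem hx (Γ.compConj_mem h hyg))) hy
    rw [h.mul_compConj_mul', one_mul] at h2
    simpa [smul_smul, hny] using Submodule.smul_mem _ (n y)⁻¹ h2

omit h in
/-- A grading from a family of submodules; independence follows from the trace condition. -/
def ofComposition {H : Type w} [Group H] (h : IsCompositionNorm n e) (M : H → Submodule F A)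
    (unit_mem : e ∈ M 1) (polar_unit : ∀ k, k ≠ 1 → ∀ x ∈ M k, polar n x e = 0)
    (iSup_eq_top : ⨆ k, M k = ⊤)
    (mul_mem : ∀ {k l : H} {x y : A}, x ∈ M k → y ∈ M l → x * y ∈ M (k * l)) :
    GroupGrading F A H where
  component := M
  indep := by
    have conj_mem : ∀ k, ∀ x ∈ M k, compConj n e x ∈ M k := by
      intro k x hx
      by_cases hk : k = 1
      · subst hk
        exact sub_mem (Submodule.smul_mem _ _ unit_mem) hx
      · rw [IsCompositionNorm.compConj_of_polar_eq_zero (polar_unit k hk x hx)]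
        exact neg_mem hx
    have polar_zero : ∀ k l, k * l ≠ 1 → ∀ x ∈ M k, ∀ y ∈ M l, polar n x y = 0 := by
      intro k l hkl x hx y hy
      rw [h.polar_eq_polar_mul_compConj]
      exact polar_unit _ hkl _ (mul_mem hx (conj_mem l y hy))
    intro k
    rw [Submodule.disjoint_def]
    intro x hx hx'
    -- For `y` of degree `l`: if `kl = 1`, all `M j` with `j ≠ k` are orthogonal to `y`, and `x`
    -- lies in their sum; if `kl ≠ 1`, `M k` is orthogonal to `y`. So `x` is orthogonal to
    -- everything.
    refine h.eq_zero_of_polar x fun y => ?_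
    refine Submodule.iSup_induction M (motive := fun y => polar n x y = 0)
      (by rw [iSup_eq_top]; trivial) (fun l y hy => ?_)
      (QuadraticMap.polar_zero_right n x) fun y z hy hz => ?_
    · by_cases hkl : k * l = 1
      · have h1 : ⨆ (j) (_ : j ≠ k), M j ≤ LinearMap.ker (n.polarBilin.flip y) := by
          refine iSup₂_le fun j hj z hz => ?_
          refine polar_zero j l (fun hjl => hj ?_) z hz y hy
          rw [mul_eq_one_iff_eq_inv] at hkl hjl
          rw [hjl, hkl]
        exact h1 hx'
      · exact polar_zero k l hkl x hx y hy
    · rw [QuadraticMap.polar_add_right, hy, hz, add_zero]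
  iSup_eq_top := iSup_eq_top
  mul_mem := mul_mem

end Composition

end GroupGrading

namespace GroupGrading

/-! ## Equivalence of gradings and universal groups -/

section Universal

variable {F : Type u} {A : Type v} {G : Type t} {H : Type w} [Field F] [NonUnitalNonAssocRing A]
  [Module F A] [Group G] [Group H]

/-- The map of degrees is an arbitrary choice outside the support, so multiplicativity can be
claimed only where a nonzero product witnesses it. This is the input that the universal property
accepts. -/
theorem Refines.exists_map {Γ : GroupGrading F A G} {Δ : GroupGrading F A H}
    (hΓ : Γ.Refines Δ) : ∃ s : G → H, (∀ g, Γ.component g ≤ Δ.component (s g)) ∧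
      ∀ g k, ∀ x ∈ Γ.component g, ∀ y ∈ Γ.component k, x * y ≠ 0 → s g * s k = s (g * k) := by
  choose s hs using hΓ
  exact ⟨s, hs, fun g k x hx y hy hxy =>
    Δ.eq_of_mem_component hxy (Δ.mul_mem (hs g hx) (hs k hy)) (hs _ (Γ.mul_mem hx hy))⟩

/-- The universal property of the universal grading group, relative to groups in `Type t`. -/
def HasUniversalProperty (Δ : GroupGrading F A H) : Prop :=
  (∀ (G : Type t) [Group G] (s : H → G),
    (∀ g k, ∀ x ∈ Δ.component g, ∀ y ∈ Δ.component k, x * y ≠ 0 → s g * s k = s (g * k)) →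
      ∃ f : H →* G, ∀ k ∈ Δ.support, f k = s k) ∧
  Subgroup.closure Δ.support = ⊤

/-- Trades the presentation for a mapping property, which the listed gradings satisfy by a short
check on generators. -/
theorem IsUniversal.hasUniversalProperty {Γ : GroupGrading F A G} (hΓ : Γ.IsUniversal) :
    HasUniversalProperty.{u, v, t, w} Γ := by
  obtain ⟨φ, hφ⟩ := hΓ
  constructor
  · intro H _ s hs
    have hrel : ∀ r ∈ Γ.universalRels, FreeGroup.lift (fun g : Γ.support => s g) r = 1 := by
      rintro r ⟨s₁, s₂, s₃, ⟨x, hx, y, hy, hxy⟩, hmem, rfl⟩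
      -- A nonzero product has only one degree, so the relation already holds in `G`.
      have h1 : (s₁ : G) * s₂ = s₃ :=
        Γ.eq_of_mem_component hxy (Γ.mul_mem hx hy) (hmem x hx y hy)
      simp only [map_mul, map_inv, FreeGroup.lift_apply_of]
      rw [hs _ _ x hx y hy hxy, h1, mul_inv_cancel]
    refine ⟨(PresentedGroup.toGroup hrel).comp φ.symm.toMonoidHom, fun k hk => ?_⟩
    have h1 : φ.symm k = PresentedGroup.of ⟨k, hk⟩ := by
      rw [MulEquiv.symm_apply_eq, hφ]
    change PresentedGroup.toGroup hrel (φ.symm k) = s k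
    rw [h1, PresentedGroup.toGroup.of]
  · have h1 : φ.toMonoidHom.range = ⊤ := MonoidHom.range_eq_top.2 φ.surjective
    rw [eq_top_iff, ← h1, MonoidHom.range_eq_map, ← PresentedGroup.closure_range_of,
      MonoidHom.map_closure]
    refine Subgroup.closure_mono ?_
    rintro _ ⟨_, ⟨s, rfl⟩, rfl⟩
    change φ (PresentedGroup.of s) ∈ _
    rw [hφ]
    exact s.2

/-- Equivalent gradings by their universal groups are isomorphic as group gradings. -/
theorem HasUniversalProperty.exists_mulEquiv {Γ : GroupGrading F A G} {Δ : GroupGrading F A H}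
    (hΓ : HasUniversalProperty.{u, v, t, w} Γ) (hΔ : HasUniversalProperty.{u, v, w, t} Δ)
    (hΓΔ : Γ.Refines Δ) (hΔΓ : Δ.Refines Γ) :
    ∃ φ : G ≃* H, ∀ k ∈ Δ.support, Γ.component (φ.symm k) = Δ.component k := by
  obtain ⟨s, hs, hs'⟩ := hΓΔ.exists_map
  obtain ⟨r, hr, hr'⟩ := hΔΓ.exists_map
  obtain ⟨f, hf⟩ := hΓ.1 H s hs'
  obtain ⟨f', hf'⟩ := hΔ.1 G r hr'
  -- A nonzero vector has only one degree, so the two degree maps are mutually inverse on the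
  -- supports, which generate the groups.
  have hsr : ∀ k ∈ Δ.support, s (r k) = k := by
    intro k hk
    obtain ⟨x, hx, hx0⟩ := Submodule.exists_mem_ne_zero_of_ne_bot hk
    exact Δ.eq_of_mem_component hx0 (hs _ (hr k hx)) hx
  have hrs : ∀ g ∈ Γ.support, r (s g) = g := by
    intro g hg
    obtain ⟨x, hx, hx0⟩ := Submodule.exists_mem_ne_zero_of_ne_bot hg
    exact Γ.eq_of_mem_component hx0 (hr _ (hs g hx)) hx
  have hr_mem : ∀ k ∈ Δ.support, r k ∈ Γ.support := by
    intro k hk h0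
    exact hk (le_bot_iff.1 (h0 ▸ hr k))
  have hs_mem : ∀ g ∈ Γ.support, s g ∈ Δ.support := by
    intro g hg h0
    exact hg (le_bot_iff.1 (h0 ▸ hs g))
  have h1 : f'.comp f = MonoidHom.id G := by
    refine MonoidHom.eq_of_eqOn_dense hΓ.2 fun g hg => ?_
    simp only [MonoidHom.comp_apply, MonoidHom.id_apply]
    rw [hf g hg, hf' _ (hs_mem g hg), hrs g hg]
  have h2 : f.comp f' = MonoidHom.id H := by
    refine MonoidHom.eq_of_eqOn_dense hΔ.2 fun k hk => ?_
    simp only [MonoidHom.comp_apply, MonoidHom.id_apply]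
    rw [hf' k hk, hf _ (hr_mem k hk), hsr k hk]
  refine ⟨f.toMulEquiv f' h1 h2, fun k hk => ?_⟩
  change Γ.component (f' k) = _
  rw [hf' k hk]
  refine le_antisymm ?_ (hr k)
  have h3 := hs (r k)
  rwa [hsr k hk] at h3

/-- Transport of a grading to a larger universe. -/
def ulift {H : Type} [Group H] (Δ : GroupGrading F A H) : GroupGrading F A (ULift.{w} H) where
  component k := Δ.component k.down
  indep := Δ.indep.comp ULift.down_injective
  iSup_eq_top := by
    rw [← Δ.iSup_eq_top]
    exact Equiv.ulift.iSup_comp (g := Δ.component)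
  mul_mem hx hy := Δ.mul_mem hx hy

/-- Fineness quantifies over groups of one fixed universe; a grading by a group in `Type` is lifted
there before it is compared. -/
theorem IsFine.refines {P : GroupGrading F A (Multiplicative (ZMod 2))} {Γ : GroupGrading F A G}
    (hΓ : IsFine.{w, u, v, t} P Γ) {H : Type} [Group H] {Δ : GroupGrading F A H}
    (hΔ : IsSuper P Δ) (hΔΓ : Δ.Refines Γ) : Γ.Refines Δ := fun g => by
  obtain ⟨k, hk⟩ := hΓ (ULift.{w} H) Δ.ulift (fun k => hΔ k.down) (fun k => hΔΓ k.down) g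
  exact ⟨k.down, hk⟩

theorem isSuper_of_le {P : GroupGrading F A (Multiplicative (ZMod 2))} {Γ : GroupGrading F A G}
    (hΓ : ∀ g, ∃ i, Γ.component g ≤ P.component i) : IsSuper P Γ := by
  intro g
  refine le_antisymm ?_ (sup_le inf_le_left inf_le_left)
  obtain ⟨i, hi⟩ := hΓ g
  have h2 : ∀ i, i = Multiplicative.ofAdd (0 : ZMod 2) ∨ i = Multiplicative.ofAdd 1 := by decide
  rcases h2 i with rfl | rfl
  · exact le_sup_of_le_left (le_inf le_rfl hi)
  · exact le_sup_of_le_right (le_inf le_rfl hi)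

end Universal

end GroupGrading

/-! ## Gradings with a homogeneous spanning family -/

namespace GroupGrading

section Family

variable {F : Type u} {A : Type v} {G : Type t} [Field F] [NonUnitalNonAssocRing A] [Module F A]
  [Group G] {ι : Type w}

/-- The projection of degree `k` fixes the members of the family of degree `k` and kills the others.
-/
theorem component_eq_span (Γ : GroupGrading F A G) {b : ι → A} {d : ι → G}
    (hb : Submodule.span F (Set.range b) = ⊤) (hd : ∀ i, b i ∈ Γ.component (d i)) (k : G) :
    Γ.component k = Submodule.span F (b '' (d ⁻¹' {k})) := by
  refine le_antisymm (fun x hx => ?_) (Submodule.span_le.2 ?_)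
  · rw [← Γ.proj_of_mem hx]
    have h1 : x ∈ Submodule.span F (Set.range b) := hb ▸ Submodule.mem_top
    refine Submodule.span_induction ?_ (by simp) (fun y z _ _ hy hz => ?_) (fun c y _ hy => ?_) h1
    · rintro _ ⟨i, rfl⟩
      by_cases hi : d i = k
      · rw [Γ.proj_of_mem (hi ▸ hd i)]
        exact Submodule.subset_span ⟨i, hi, rfl⟩
      · rw [Γ.proj_of_mem_of_ne (hd i) hi]
        exact zero_mem _
    · rw [map_add]
      exact add_mem hy hz
    · rw [map_smul]
      exact Submodule.smul_mem _ c hy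
  · rintro _ ⟨i, hi, rfl⟩
    exact hi ▸ hd i

theorem component_eq_bot (Γ : GroupGrading F A G) {b : ι → A} {d : ι → G}
    (hb : Submodule.span F (Set.range b) = ⊤) (hd : ∀ i, b i ∈ Γ.component (d i)) {k : G}
    (hk : ∀ i, d i ≠ k) : Γ.component k = ⊥ := by
  rw [Γ.component_eq_span hb hd, Submodule.span_eq_bot]
  rintro _ ⟨i, hi, rfl⟩
  exact absurd hi (hk i)

/-- The grading of a composition algebra by a spanning family of homogeneous elements. -/
def ofFamily [IsScalarTower F A A] [SMulCommClass F A A] {n : QuadraticForm F A} {e : A}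
    (h : IsCompositionNorm n e) (b : ι → A) (d : ι → G)
    (hb : Submodule.span F (Set.range b) = ⊤) (he : e ∈ Submodule.span F (b '' (d ⁻¹' {1})))
    (ht : ∀ i, d i ≠ 1 → polar n (b i) e = 0)
    (hmul : ∀ i j, b i * b j = 0 ∨ ∃ k, d k = d i * d j ∧ (b i * b j = b k ∨ b i * b j = -b k)) :
    GroupGrading F A G :=
  ofComposition h (fun k => Submodule.span F (b '' (d ⁻¹' {k}))) he
    (by
      intro k hk
      have h1 : Submodule.span F (b '' (d ⁻¹' {k})) ≤ LinearMap.ker (n.polarBilin.flip e) := by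
        rw [Submodule.span_le]
        rintro _ ⟨i, hi, rfl⟩
        exact ht i fun h0 => hk (hi.symm.trans h0)
      exact fun x hx => h1 hx)
    (by
      rw [eq_top_iff, ← hb, Submodule.span_le]
      rintro _ ⟨i, rfl⟩
      exact Submodule.mem_iSup_of_mem (d i) (Submodule.subset_span ⟨i, rfl, rfl⟩))
    (by
      intro k l x y hx hy
      induction hx, hy using Submodule.span_induction₂ with
      | mem_mem x y hx hy =>
        obtain ⟨i, rfl, rfl⟩ := hx
        obtain ⟨j, rfl, rfl⟩ := hy
        rcases hmul i j with h0 | ⟨m, hm, h0 | h0⟩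
        · exact h0 ▸ zero_mem _
        · exact h0 ▸ Submodule.subset_span ⟨m, hm, rfl⟩
        · exact h0 ▸ neg_mem (Submodule.subset_span ⟨m, hm, rfl⟩)
      | zero_left y hy => rw [zero_mul]; exact zero_mem _
      | zero_right x hx => rw [mul_zero]; exact zero_mem _
      | add_left x y z _ _ _ hx hy => rw [add_mul]; exact add_mem hx hy
      | add_right x y z _ _ _ hx hy => rw [mul_add]; exact add_mem hx hy
      | smul_left c x y _ _ hxy => rw [smul_mul_assoc]; exact Submodule.smul_mem _ c hxy
      | smul_right c x y _ _ hxy => rw [mul_smul_comm]; exact Submodule.smul_mem _ c hxy)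

theorem refines_of_family {H : Type*} [Group H] {Δ : GroupGrading F A H} {Γ : GroupGrading F A G}
    {b : ι → A} {d : ι → H} (hb : Submodule.span F (Set.range b) = ⊤)
    (hd : ∀ i, b i ∈ Δ.component (d i))
    (hΓ : ∀ k, ∃ g, ∀ i, d i = k → b i ∈ Γ.component g) : Δ.Refines Γ := by
  intro k
  obtain ⟨g, hg⟩ := hΓ k
  refine ⟨g, ?_⟩
  rw [Δ.component_eq_span hb hd, Submodule.span_le]
  rintro _ ⟨i, hi, rfl⟩
  exact hg i hi

end Family

end GroupGrading

/-! ## Peirce decomposition -/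

namespace IsCompositionNorm

section Peirce

variable {F : Type u} {A : Type v} [Field F] [NonUnitalNonAssocRing A] [Module F A]
  [IsScalarTower F A A] [SMulCommClass F A A] {n : QuadraticForm F A} {e : A}

/-- An idempotent different from `0` and the unit, in terms of its norm and trace. -/
structure IsIdempotent (n : QuadraticForm F A) (e c : A) : Prop where
  map_eq_zero : n c = 0
  polar_unit : polar n c e = 1

/-- The Peirce component `{x | x ⟂ e, c x = x}`. -/
structure IsPeirce (n : QuadraticForm F A) (e c x : A) : Prop where
  polar_unit : polar n x e = 0
  mul_eq : c * x = x

theorem IsIdempotent.compConj (h : IsCompositionNorm n e) {c : A} (hc : IsIdempotent n e c) :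
    IsIdempotent n e (compConj n e c) :=
  ⟨by rw [h.map_compConj, hc.map_eq_zero], by rw [h.polar_compConj_unit, hc.polar_unit]⟩

theorem IsIdempotent.compConj_eq {c : A} (hc : IsIdempotent n e c) :
    _root_.compConj n e c = e - c := by
  rw [_root_.compConj, hc.polar_unit, one_smul]

theorem IsIdempotent.mul_self (h : IsCompositionNorm n e) {c : A} (hc : IsIdempotent n e c) :
    c * c = c := by
  rw [h.mul_self, hc.polar_unit, hc.map_eq_zero, one_smul, zero_smul, sub_zero]

theorem IsIdempotent.mul_compConj (h : IsCompositionNorm n e) {c : A}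
    (hc : IsIdempotent n e c) : c * _root_.compConj n e c = 0 := by
  rw [hc.compConj_eq, mul_sub, h.mul_one, hc.mul_self h, sub_self]

theorem IsIdempotent.compConj_mul (h : IsCompositionNorm n e) {c : A}
    (hc : IsIdempotent n e c) : _root_.compConj n e c * c = 0 := by
  rw [hc.compConj_eq, sub_mul, h.one_mul, hc.mul_self h, sub_self]

variable {c x y : A}

theorem IsPeirce.compConj_mul (h : IsCompositionNorm n e) (hc : IsIdempotent n e c)
    (hx : IsPeirce n e c x) : compConj n e c * x = 0 := by
  rw [hc.compConj_eq, sub_mul, h.one_mul, hx.mul_eq, sub_self]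

theorem IsPeirce.polar_idempotent (h : IsCompositionNorm n e) (hx : IsPeirce n e c x) :
    polar n c x = n c * polar n x e := by
  have h1 := h.polar_mul_self' c x
  rwa [hx.mul_eq, QuadraticMap.polar_comm] at h1

theorem IsPeirce.polar_eq_zero (h : IsCompositionNorm n e) (hx : IsPeirce n e c x) :
    polar n c x = 0 := by
  rw [hx.polar_idempotent h, hx.polar_unit, mul_zero]

theorem IsPeirce.mul_idempotent (h : IsCompositionNorm n e) (hc : IsIdempotent n e c)
    (hx : IsPeirce n e c x) : x * c = 0 := by
  rw [h.mul_comm_of_polar_eq_zero hx.polar_unit (hx.polar_eq_zero h), hx.compConj_mul h hc]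

theorem IsPeirce.mul_compConj (h : IsCompositionNorm n e) (hc : IsIdempotent n e c)
    (hx : IsPeirce n e c x) : x * compConj n e c = x := by
  rw [hc.compConj_eq, mul_sub, h.mul_one, hx.mul_idempotent h hc, sub_zero]

theorem IsPeirce.map_eq_zero (h : IsCompositionNorm n e) (hc : IsIdempotent n e c)
    (hx : IsPeirce n e c x) : n x = 0 := by
  rw [← hx.mul_eq, h.map_mul, hc.map_eq_zero, zero_mul]

theorem IsPeirce.mul_self (h : IsCompositionNorm n e) (hc : IsIdempotent n e c)
    (hx : IsPeirce n e c x) : x * x = 0 := by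
  rw [h.mul_self, hx.polar_unit, hx.map_eq_zero h hc, zero_smul, zero_smul, sub_zero]

theorem IsPeirce.polar_peirce (h : IsCompositionNorm n e) (hc : IsIdempotent n e c)
    (hx : IsPeirce n e c x) (hy : IsPeirce n e c y) : polar n x y = 0 := by
  rw [← hx.mul_eq, ← hy.mul_eq, h.polar_mul_mul_left, hc.map_eq_zero, zero_mul]

theorem IsPeirce.add (hx : IsPeirce n e c x) (hy : IsPeirce n e c y) : IsPeirce n e c (x + y) :=
  ⟨by rw [QuadraticMap.polar_add_left, hx.polar_unit, hy.polar_unit, add_zero],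
    by rw [mul_add, hx.mul_eq, hy.mul_eq]⟩

theorem IsPeirce.smul (a : F) (hx : IsPeirce n e c x) : IsPeirce n e c (a • x) :=
  ⟨by rw [QuadraticMap.polar_smul_left, hx.polar_unit, smul_zero],
    by rw [mul_smul_comm, hx.mul_eq]⟩

theorem IsPeirce.mul_anticomm (h : IsCompositionNorm n e) (hc : IsIdempotent n e c)
    (hx : IsPeirce n e c x) (hy : IsPeirce n e c y) : x * y = -(y * x) := by
  have h1 := (hx.add hy).mul_self h hc
  rw [add_mul, mul_add, mul_add, hx.mul_self h hc, hy.mul_self h hc, zero_add, add_zero] at h1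
  exact eq_neg_of_add_eq_zero_left h1

/-- Moving `c̄` past the trace-zero `x` turns it into `c`, which fixes `y`. The trace of `xy` is
`-n(x,y)`, and this vanishes because the Peirce component is totally isotropic. -/
theorem IsPeirce.mul (h : IsCompositionNorm n e) (hc : IsIdempotent n e c)
    (hx : IsPeirce n e c x) (hy : IsPeirce n e c y) : IsPeirce n e (compConj n e c) (x * y) := by
  constructor
  · rw [h.polar_mul_right, h.one_mul, compConj_of_polar_eq_zero hy.polar_unit,
      QuadraticMap.polar_neg_right, hx.polar_peirce h hc hy, neg_zero]
  · rw [h.mul_mul_of_polar_eq_zero hx.polar_unit, h.compConj_compConj, hy.mul_eq]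
    rw [hc.compConj_eq, QuadraticMap.polar_sub_left, hx.polar_eq_zero h, QuadraticMap.polar_comm,
      hx.polar_unit, sub_zero]

/-- Apply `left_linearized` to `c`, with `x̄ = -x`, `ȳ = -y`, `xc = 0` and `yc = y`. -/
theorem IsPeirce.mul_dual (h : IsCompositionNorm n e) (hc : IsIdempotent n e c)
    (hx : IsPeirce n e c x) (hy : IsPeirce n e (compConj n e c) y) :
    x * y = -(polar n x y • c) := by
  have h1 := h.left_linearized x y c
  have h2 := hy.mul_compConj h (hc.compConj h)
  rw [h.compConj_compConj] at h2
  rw [compConj_of_polar_eq_zero hx.polar_unit, compConj_of_polar_eq_zero hy.polar_unit, neg_mul,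
    neg_mul, h2, hx.mul_idempotent h hc, neg_zero, mul_zero, add_zero, mul_neg] at h1
  rw [← h1, neg_neg]

theorem IsPeirce.dual_mul (h : IsCompositionNorm n e) (hc : IsIdempotent n e c)
    (hx : IsPeirce n e c x) (hy : IsPeirce n e (compConj n e c) y) :
    y * x = -(polar n x y • compConj n e c) := by
  rw [QuadraticMap.polar_comm]
  refine hy.mul_dual h (hc.compConj h) ?_
  rwa [h.compConj_compConj]

/-- Left multiplication by `c` maps the orthogonal complement of `e` and `c` into the Peirce
component, because `c̄(cx) = n(c)x = 0`. -/
theorem isPeirce_mul (h : IsCompositionNorm n e) (hc : IsIdempotent n e c)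
    (hx : polar n x e = 0) (hcx : polar n c x = 0) : IsPeirce n e c (c * x) := by
  constructor
  · rw [h.polar_mul_left, h.mul_one, hc.compConj_eq, QuadraticMap.polar_sub_right, hx,
      QuadraticMap.polar_comm, hcx, sub_zero]
  · have h1 := h.compConj_mul_mul c x
    rw [hc.map_eq_zero, zero_smul, hc.compConj_eq, sub_mul, h.one_mul, sub_eq_zero] at h1
    exact h1.symm

theorem isPeirce_compConj_mul (h : IsCompositionNorm n e) (hc : IsIdempotent n e c)
    (hx : polar n x e = 0) (hcx : polar n c x = 0) :
    IsPeirce n e (compConj n e c) (compConj n e c * x) := by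
  refine isPeirce_mul h (hc.compConj h) hx ?_
  rw [hc.compConj_eq, QuadraticMap.polar_sub_left, hcx, QuadraticMap.polar_comm, hx, sub_zero]

theorem IsIdempotent.polar_compConj (hc : IsIdempotent n e c) :
    polar n c (_root_.compConj n e c) = 1 := by
  rw [_root_.compConj, QuadraticMap.polar_sub_right, QuadraticMap.polar_smul_right, hc.polar_unit,
    QuadraticMap.polar_self, hc.map_eq_zero]
  simp

/-- The map `σ` sends each index to that of a dual vector; pairing a linear relation with `b (σ j)`
isolates its `j`-th coefficient. -/
theorem linearIndependent_of_polar {ι : Type*} [Fintype ι] [DecidableEq ι] {b : ι → A}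
    (σ : ι → ι) (hb : ∀ i j, polar n (b i) (b (σ j)) = if i = j then 1 else 0) :
    LinearIndependent F b := by
  rw [Fintype.linearIndependent_iff]
  intro g hg j
  have h1 := congrArg (n.polarBilin.flip (b (σ j))) hg
  simpa [map_sum, hb] using h1

end Peirce

end IsCompositionNorm

/-! ### Canonical bases of split quaternion algebras and their `ℤ`-gradings -/

section CanonicalFour

variable {F : Type u} {A : Type v} [Field F] [NonUnitalNonAssocRing A] [Module F A]
  [IsScalarTower F A A] [SMulCommClass F A A] {n : QuadraticForm F A} {e : A}

namespace IsCompositionNorm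

theorem polar_unit_of_mul_self (h : IsCompositionNorm n e) {x : A} (hx : x * x = 0) :
    polar n x e = 0 := by
  have h1 := congrArg n hx
  rw [h.map_mul, QuadraticMap.map_zero, mul_self_eq_zero] at h1
  have h2 := h.mul_self x
  rw [hx, h1, zero_smul, sub_zero] at h2
  rcases smul_eq_zero.1 h2.symm with h3 | rfl
  · exact h3
  · exact QuadraticMap.polar_zero_left n e

/-- A nonzero annihilated vector forces `n(c) = 0`, and then `c = c² = t(c)c` forces trace 1. -/
theorem isIdempotent_of_orthogonal (h : IsCompositionNorm n e) {c c' : A} (hc : c ≠ 0)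
    (hc' : c' ≠ 0) (hcc : c * c = c) (hcc' : c * c' = 0) : IsIdempotent n e c := by
  have h0 : n c = 0 := by
    by_contra h0
    exact hc' (h.eq_zero_of_mul_left_eq_zero h0 hcc')
  refine ⟨h0, ?_⟩
  have h1 := h.mul_self c
  rw [hcc, h0, zero_smul, sub_zero] at h1
  have h2 : (polar n c e - 1) • c = 0 := by rw [sub_smul, ← h1, one_smul, sub_self]
  exact sub_eq_zero.1 ((smul_eq_zero.1 h2).resolve_right hc)

theorem isCanonicalBasisFour (h : IsCompositionNorm n e) (hA : Module.finrank F A = 4) {c x y : A}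
    (hc : IsIdempotent n e c) (hx : IsPeirce n e c x) (hy : IsPeirce n e (compConj n e c) y)
    (hxy : polar n x y = 1) : IsCanonicalBasisFour F c (compConj n e c) x y := by
  have hc' := hc.compConj h
  have hcc := h.compConj_compConj c
  have hx' : IsPeirce n e (compConj n e (compConj n e c)) x := by rwa [hcc]
  have hli : LinearIndependent F ![c, compConj n e c, x, y] := by
    -- The permutation pairs `c` with `c̄` and `x` with `y`: two hyperbolic planes, orthogonal to
    -- each other.
    refine linearIndependent_of_polar (n := n) ![1, 0, 3, 2] ?_
    have h1 := hc.polar_compConj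
    have h2 := hx.polar_eq_zero h
    have h3 := hy.polar_eq_zero h
    have h4 := hx'.polar_eq_zero h
    have h5 : polar n c y = 0 := by
      rw [← hcc, IsCompositionNorm.polar_compConj_left, compConj_of_polar_eq_zero hy.polar_unit,
        QuadraticMap.polar_neg_right, h3, neg_zero]
    rw [hcc] at h4
    have h6 : polar n (compConj n e c) x = 0 := by
      rw [IsCompositionNorm.polar_compConj_left, compConj_of_polar_eq_zero hx.polar_unit,
        QuadraticMap.polar_neg_right, h4, neg_zero]
    have h7 := hx.map_eq_zero h hc
    have h8 := hy.map_eq_zero h hc'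
    have h9 := hc.map_eq_zero
    have h10 := hc'.map_eq_zero
    have hs := fun a b => QuadraticMap.polar_comm n a b
    intro i j
    fin_cases i <;> fin_cases j <;>
      simp [h1, h2, h3, h5, h6, h7, h8, h9, h10, hxy, hs y c, hs x c, hs y x,
        hs y (compConj n e c), hs x (compConj n e c), hs (compConj n e c) c]
  have hfin : Module.Finite F A := Module.finite_of_finrank_pos (by omega)
  have hspan := hli.span_eq_top_of_card_eq_finrank (by simp [hA])
  simp only [Matrix.range_cons, Matrix.range_empty, Set.union_empty,
    Set.singleton_union] at hspan
  exact {
    linearIndependent := hli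
    span_eq_top := hspan
    e₁_e₁ := hc.mul_self h
    e₁_e₂ := hc.mul_compConj h
    e₂_e₁ := hc.compConj_mul h
    e₂_e₂ := hc'.mul_self h
    e₁_u₁ := hx.mul_eq
    e₂_u₁ := hx.compConj_mul h hc
    u₁_e₁ := hx.mul_idempotent h hc
    u₁_e₂ := hx.mul_compConj h hc
    e₁_v₁ := by simpa only [hcc] using hy.compConj_mul h hc'
    e₂_v₁ := hy.mul_eq
    v₁_e₁ := by simpa only [hcc] using hy.mul_compConj h hc'
    v₁_e₂ := hy.mul_idempotent h hc'
    u₁_u₁ := hx.mul_self h hc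
    v₁_v₁ := hy.mul_self h hc'
    u₁_v₁ := by rw [hx.mul_dual h hc hy, hxy, one_smul]
    v₁_u₁ := by rw [hx.dual_mul h hc hy, hxy, one_smul] }

end IsCompositionNorm

namespace IsCanonicalBasisFour

variable {e₁ e₂ u₁ v₁ : A}

theorem range_eq_top (hb : IsCanonicalBasisFour F e₁ e₂ u₁ v₁) :
    Submodule.span F (Set.range ![e₁, e₂, u₁, v₁]) = ⊤ := by
  simpa only [Matrix.range_cons, Matrix.range_empty, Set.union_empty, Set.singleton_union]
    using hb.span_eq_top

/-- The `ℤ`-grading of a canonical basis. -/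
def grading (hb : IsCanonicalBasisFour F e₁ e₂ u₁ v₁) (h : IsCompositionNorm n e)
    (he : e = e₁ + e₂) : GroupGrading F A (Multiplicative ℤ) :=
  GroupGrading.ofFamily h ![e₁, e₂, u₁, v₁]
    ![Multiplicative.ofAdd 0, Multiplicative.ofAdd 0, Multiplicative.ofAdd 1,
      Multiplicative.ofAdd (-1)] hb.range_eq_top
    (he ▸ add_mem (Submodule.subset_span ⟨0, rfl, rfl⟩) (Submodule.subset_span ⟨1, rfl, rfl⟩))
    (by
      have h1 := h.polar_unit_of_mul_self hb.u₁_u₁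
      have h2 := h.polar_unit_of_mul_self hb.v₁_v₁
      intro i
      fin_cases i
      · exact fun h0 => absurd rfl h0
      · exact fun h0 => absurd rfl h0
      · exact fun _ => h1
      · exact fun _ => h2)
    (by
      intro i j
      fin_cases i <;> fin_cases j
      · exact .inr ⟨0, rfl, .inl hb.e₁_e₁⟩
      · exact .inl hb.e₁_e₂
      · exact .inr ⟨2, rfl, .inl hb.e₁_u₁⟩
      · exact .inl hb.e₁_v₁
      · exact .inl hb.e₂_e₁
      · exact .inr ⟨1, rfl, .inl hb.e₂_e₂⟩
      · exact .inl hb.e₂_u₁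
      · exact .inr ⟨3, rfl, .inl hb.e₂_v₁⟩
      · exact .inl hb.u₁_e₁
      · exact .inr ⟨2, rfl, .inl hb.u₁_e₂⟩
      · exact .inl hb.u₁_u₁
      · exact .inr ⟨0, rfl, .inr hb.u₁_v₁⟩
      · exact .inr ⟨3, rfl, .inl hb.v₁_e₁⟩
      · exact .inl hb.v₁_e₂
      · exact .inr ⟨1, rfl, .inr hb.v₁_u₁⟩
      · exact .inl hb.v₁_v₁)

theorem grading_component (hb : IsCanonicalBasisFour F e₁ e₂ u₁ v₁) (h : IsCompositionNorm n e)
    (he : e = e₁ + e₂) :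
    (hb.grading h he).component (Multiplicative.ofAdd 0) = Submodule.span F {e₁, e₂} ∧
    (hb.grading h he).component (Multiplicative.ofAdd 1) = Submodule.span F {u₁} ∧
    (hb.grading h he).component (Multiplicative.ofAdd (-1)) = Submodule.span F {v₁} := by
  refine ⟨congrArg (Submodule.span F) ?_, congrArg (Submodule.span F) ?_,
    congrArg (Submodule.span F) ?_⟩ <;>
  · ext x
    simp [-ofAdd_zero, -ofAdd_neg, Fin.exists_fin_succ, eq_comm]

theorem mem_grading_component (hb : IsCanonicalBasisFour F e₁ e₂ u₁ v₁)
    (h : IsCompositionNorm n e) (he : e = e₁ + e₂) (i : Fin 4) :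
    ![e₁, e₂, u₁, v₁] i ∈ (hb.grading h he).component
      ((![Multiplicative.ofAdd 0, Multiplicative.ofAdd 0, Multiplicative.ofAdd 1,
        Multiplicative.ofAdd (-1)] : Fin 4 → Multiplicative ℤ) i) :=
  Submodule.subset_span ⟨i, rfl, rfl⟩

theorem grading_support (hb : IsCanonicalBasisFour F e₁ e₂ u₁ v₁) (h : IsCompositionNorm n e)
    (he : e = e₁ + e₂) (k : Multiplicative ℤ) :
    k ∈ (hb.grading h he).support ↔ k = Multiplicative.ofAdd 0 ∨ k = Multiplicative.ofAdd 1 ∨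
      k = Multiplicative.ofAdd (-1) := by
  obtain ⟨h0, h1, h2⟩ := hb.grading_component h he
  have hne := hb.linearIndependent.ne_zero
  constructor
  · intro hk
    by_contra! hk'
    refine hk ((hb.grading h he).component_eq_bot hb.range_eq_top (hb.mem_grading_component h he)
      fun i => ?_)
    fin_cases i
    exacts [hk'.1.symm, hk'.1.symm, hk'.2.1.symm, hk'.2.2.symm]
  · rintro (rfl | rfl | rfl) <;> refine (Submodule.ne_bot_iff _).2 ?_
    · exact ⟨_, hb.mem_grading_component h he 0, hne 0⟩
    · exact ⟨_, hb.mem_grading_component h he 2, hne 2⟩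
    · exact ⟨_, hb.mem_grading_component h he 3, hne 3⟩

/-- The product `e₁e₁ = e₁` forces degree 0 to go to 1, and `u₁v₁ = -e₁` forces degrees 1 and -1 to
go to inverse elements; a homomorphism from `ℤ` is free on the image of 1. -/
theorem hasUniversalProperty (hb : IsCanonicalBasisFour F e₁ e₂ u₁ v₁)
    (h : IsCompositionNorm n e) (he : e = e₁ + e₂) :
    (hb.grading h he).HasUniversalProperty := by
  have hmem := hb.mem_grading_component h he
  have hne := hb.linearIndependent.ne_zero
  constructor
  · intro G _ s hs
    have h0 := hs _ _ _ (hmem 0) _ (hmem 0) (hb.e₁_e₁.trans_ne (hne 0))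
    have h1 := hs _ _ _ (hmem 2) _ (hmem 3) (hb.u₁_v₁.trans_ne (neg_ne_zero.2 (hne 0)))
    replace h0 : s (Multiplicative.ofAdd 0) = 1 := mul_eq_left.1 h0
    replace h1 : s (Multiplicative.ofAdd 1) * s (Multiplicative.ofAdd (-1)) = 1 := h1.trans h0
    refine ⟨zpowersHom G (s (Multiplicative.ofAdd 1)), fun k hk => ?_⟩
    rcases (hb.grading_support h he k).1 hk with rfl | rfl | rfl
    · simpa using h0.symm
    · simp
    · simpa using inv_eq_of_mul_eq_one_right h1
  · rw [eq_top_iff]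
    intro k _
    have h1 : k = Multiplicative.ofAdd (1 : ℤ) ^ k.toAdd := by
      rw [← ofAdd_zsmul, smul_eq_mul, mul_one, ofAdd_toAdd]
    rw [h1]
    exact Subgroup.zpow_mem _ (Subgroup.subset_closure
      ((hb.grading_support h he _).2 (.inr (.inl rfl)))) _

/-- The sum `e₁ + e₂` is a left unit on the basis; evaluate this at `e`. -/
theorem unit_eq (hb : IsCanonicalBasisFour F e₁ e₂ u₁ v₁) (h : IsCompositionNorm n e) :
    e = e₁ + e₂ := by
  have h1 : LinearMap.mulLeft F (e₁ + e₂) = (LinearMap.id : A →ₗ[F] A) := by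
    refine LinearMap.ext_on_range (v := ![e₁, e₂, u₁, v₁]) hb.range_eq_top fun i => ?_
    fin_cases i <;>
      simp [add_mul, hb.e₁_e₁, hb.e₁_e₂, hb.e₂_e₁, hb.e₂_e₂, hb.e₁_u₁, hb.e₂_u₁, hb.e₁_v₁,
        hb.e₂_v₁]
  have h2 := LinearMap.congr_fun h1 e
  rw [LinearMap.mulLeft_apply, h.mul_one] at h2
  exact h2.symm

end IsCanonicalBasisFour

/-- Elements of trace zero in the span of two orthogonal idempotents, in characteristic two. -/
theorem IsCompositionNorm.mem_span_unit [CharP F 2] {c c' : A}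
    (hc : IsIdempotent n e c) (hc' : IsIdempotent n e c') (he : e = c + c') {x : A}
    (hx : x ∈ Submodule.span F {c, c'}) (hxe : polar n x e = 0) : x ∈ Submodule.span F {e} := by
  obtain ⟨a, b, rfl⟩ := Submodule.mem_span_pair.1 hx
  rw [QuadraticMap.polar_add_left, QuadraticMap.polar_smul_left, QuadraticMap.polar_smul_left,
    hc.polar_unit, hc'.polar_unit, smul_eq_mul, smul_eq_mul, mul_one, mul_one,
    CharTwo.add_eq_zero] at hxe
  rw [hxe, ← smul_add, ← he]
  exact Submodule.smul_mem _ _ (Submodule.mem_span_singleton_self e)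

end CanonicalFour

/-! ### Canonical bases of split Cayley algebras and their Cartan gradings -/

section CanonicalEight

variable {F : Type u} {A : Type v} [Field F] [NonUnitalNonAssocRing A] [Module F A]
  [IsScalarTower F A A] [SMulCommClass F A A] {n : QuadraticForm F A} {e : A}

namespace IsCompositionNorm

/-- Move `y` to the other side by its adjoint `-y`, then exchange `z` and `y` by anticommutativity.
-/
theorem IsPeirce.polar_mul_cycle (h : IsCompositionNorm n e) {c x y z : A}
    (hc : IsIdempotent n e c) (hy : IsPeirce n e c y) (hz : IsPeirce n e c z) :
    polar n (x * y) z = polar n (y * z) x := by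
  rw [h.polar_mul_right, compConj_of_polar_eq_zero hy.polar_unit, mul_neg,
    hz.mul_anticomm h hc hy, neg_neg, QuadraticMap.polar_comm]

theorem polar_compConj_of_isPeirce (h : IsCompositionNorm n e) {c x : A}
    (hx : IsPeirce n e c x) : polar n (compConj n e c) x = 0 := by
  rw [polar_compConj_left, compConj_of_polar_eq_zero hx.polar_unit,
    QuadraticMap.polar_neg_right, hx.polar_eq_zero h, neg_zero]

/-- One normalization suffices: the products `x (i+1) * x (i+2)` lie in the opposite Peirce
component and are dual to the `x i`, and the whole multiplication table follows from this duality.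
-/
theorem isCanonicalBasisEight (h : IsCompositionNorm n e) (hA : Module.finrank F A = 8) {c : A}
    {x : Fin 3 → A} (hc : IsIdempotent n e c) (hx : ∀ i, IsPeirce n e c (x i))
    (hxxx : polar n (x 0 * x 1) (x 2) = 1) :
    IsCanonicalBasisEight F c (compConj n e c) x fun i => x (i + 1) * x (i + 2) := by
  have hc' := hc.compConj h
  have hcc := h.compConj_compConj c
  obtain ⟨y, hy_def⟩ : ∃ y : Fin 3 → A, y = fun i => x (i + 1) * x (i + 2) := ⟨_, rfl⟩
  rw [← hy_def]
  have hyi : ∀ i, y i = x (i + 1) * x (i + 2) := fun i => congrFun hy_def i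
  have hy : ∀ i, IsPeirce n e (compConj n e c) (y i) := fun i => hyi i ▸ (hx _).mul h hc (hx _)
  -- On the diagonal stand the cyclic permutations of `n(x₀x₁,x₂) = 1`. Off the diagonal `x i` is a
  -- factor of `y j`, and `n(a,ab) = n(a)t(b)` and `n(b,ab) = t(a)n(b)` vanish.
  have hpolar : ∀ i j, polar n (x i) (y j) = if i = j then 1 else 0 := by
    have h1 : ∀ a b, polar n (x a) (x a * x b) = 0 := fun a b => by
      rw [QuadraticMap.polar_comm, h.polar_mul_self', (hx b).polar_unit, mul_zero]
    have h2 : ∀ a b, polar n (x b) (x a * x b) = 0 := fun a b => by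
      rw [QuadraticMap.polar_comm, h.polar_mul_self, (hx a).polar_unit, zero_mul]
    have h3 := (hx 1).polar_mul_cycle (x := x 0) h hc (hx 2)
    have h4 := (hx 2).polar_mul_cycle (x := x 1) h hc (hx 0)
    rw [hxxx] at h3
    rw [← h3] at h4
    intro i j
    rw [hyi]
    fin_cases i <;> fin_cases j
    · exact (QuadraticMap.polar_comm n _ _).trans h3.symm
    · exact h2 2 0
    · exact h1 0 1
    · exact h1 1 2
    · exact (QuadraticMap.polar_comm n _ _).trans h4.symm
    · exact h2 0 1
    · exact h2 1 2
    · exact h1 2 0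
    · exact (QuadraticMap.polar_comm n _ _).trans hxxx
  have hli : LinearIndependent F ![c, compConj n e c, x 0, x 1, x 2, y 0, y 1, y 2] := by
    -- The permutation pairs `c` with `c̄` and `x i` with `y i`.
    refine linearIndependent_of_polar (n := n) ![1, 0, 5, 6, 7, 2, 3, 4] ?_
    have h1 := hc.polar_compConj
    have h1' : polar n (compConj n e c) c = 1 := by rw [QuadraticMap.polar_comm, h1]
    have h2 : ∀ i, polar n c (x i) = 0 := fun i => (hx i).polar_eq_zero h
    have h2' : ∀ i, polar n (x i) c = 0 := fun i => by rw [QuadraticMap.polar_comm, h2]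
    have h3 : ∀ i, polar n (compConj n e c) (y i) = 0 := fun i => (hy i).polar_eq_zero h
    have h3' : ∀ i, polar n (y i) (compConj n e c) = 0 := fun i => by
      rw [QuadraticMap.polar_comm, h3]
    have h4 : ∀ i, polar n (compConj n e c) (x i) = 0 := fun i =>
      h.polar_compConj_of_isPeirce (hx i)
    have h4' : ∀ i, polar n (x i) (compConj n e c) = 0 := fun i => by
      rw [QuadraticMap.polar_comm, h4]
    have h5 : ∀ i, polar n c (y i) = 0 := fun i => by
      have h6 := h.polar_compConj_of_isPeirce (hy i)
      rwa [hcc] at h6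
    have h5' : ∀ i, polar n (y i) c = 0 := fun i => by rw [QuadraticMap.polar_comm, h5]
    have h6 : ∀ i j, polar n (x i) (x j) = 0 := fun i j => (hx i).polar_peirce h hc (hx j)
    have h7 : ∀ i j, polar n (y i) (y j) = 0 := fun i j => (hy i).polar_peirce h hc' (hy j)
    have h8 : ∀ i j, polar n (y i) (x j) = if j = i then 1 else 0 := fun i j => by
      rw [QuadraticMap.polar_comm, hpolar]
    have h9 : polar n c c = 0 := by rw [QuadraticMap.polar_self, hc.map_eq_zero, smul_zero]
    have h10 : polar n (compConj n e c) (compConj n e c) = 0 := by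
      rw [QuadraticMap.polar_self, hc'.map_eq_zero, smul_zero]
    intro i j
    fin_cases i <;> fin_cases j <;>
      simp [-QuadraticMap.polar_self, h1, h1', h2, h2', h3, h3', h4, h4', h5, h5', h6, h7, h8, h9,
        h10, hpolar]
  have hfin : Module.Finite F A := Module.finite_of_finrank_pos (by omega)
  have hspan := hli.span_eq_top_of_card_eq_finrank (by simp [hA])
  simp only [Matrix.range_cons, Matrix.range_empty, Set.union_empty,
    Set.singleton_union] at hspan
  have hxx : ∀ i, x i * x (i + 1) = y (i + 2) := fun i => by
    rw [hyi]
    fin_cases i <;> rfl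
  have hyy : ∀ i, y i * y (i + 1) = x (i + 2) := fun i => by
    -- The vectors `x (i+2)` and `y (i+1)` are orthogonal, so the identity has no right-hand side;
    -- its two terms are `-(y i * y (i+1))` and `c * x (i+2) = x (i+2)`.
    have h1 := h.right_linearized (x (i + 2)) (y (i + 1)) (x (i + 1))
    rw [compConj_of_polar_eq_zero (hx _).polar_unit, compConj_of_polar_eq_zero (hy _).polar_unit,
      hpolar, if_neg (by fin_cases i <;> decide), zero_smul, mul_neg, ← hyi, mul_neg,
      (hx _).mul_dual h hc (hy _), hpolar, if_pos rfl, one_smul, neg_neg, (hx _).mul_eq, neg_mul,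
      neg_add_eq_zero] at h1
    exact h1
  exact {
    linearIndependent := hli
    span_eq_top := hspan
    e₁_e₁ := hc.mul_self h
    e₁_e₂ := hc.mul_compConj h
    e₂_e₁ := hc.compConj_mul h
    e₂_e₂ := hc'.mul_self h
    e₁_u := fun i => (hx i).mul_eq
    e₂_u := fun i => (hx i).compConj_mul h hc
    u_e₁ := fun i => (hx i).mul_idempotent h hc
    u_e₂ := fun i => (hx i).mul_compConj h hc
    e₁_v := fun i => by simpa only [hcc] using (hy i).compConj_mul h hc'
    e₂_v := fun i => (hy i).mul_eq
    v_e₁ := fun i => by simpa only [hcc] using (hy i).mul_compConj h hc'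
    v_e₂ := fun i => (hy i).mul_idempotent h hc'
    u_u_self := fun i => (hx i).mul_self h hc
    u_u_succ := hxx
    succ_u_u := fun i => by rw [(hx _).mul_anticomm h hc (hx _), hxx]
    v_v_self := fun i => (hy i).mul_self h hc'
    v_v_succ := hyy
    succ_v_v := fun i => by rw [(hy _).mul_anticomm h hc' (hy _), hyy]
    u_v_self := fun i => by rw [(hx i).mul_dual h hc (hy i), hpolar, if_pos rfl, one_smul]
    v_u_self := fun i => by rw [(hx i).dual_mul h hc (hy i), hpolar, if_pos rfl, one_smul]
    u_v_of_ne := fun i j hij => by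
      rw [(hx i).mul_dual h hc (hy j), hpolar, if_neg hij, zero_smul, neg_zero]
    v_u_of_ne := fun i j hij => by
      rw [(hx j).dual_mul h hc (hy i), hpolar, if_neg hij.symm, zero_smul, neg_zero] }

end IsCompositionNorm

namespace IsCanonicalBasisEight

variable {e₁ e₂ : A} {x y : Fin 3 → A}

theorem range_eq_top (hb : IsCanonicalBasisEight F e₁ e₂ x y) :
    Submodule.span F (Set.range ![e₁, e₂, x 0, x 1, x 2, y 0, y 1, y 2]) = ⊤ := by
  simpa only [Matrix.range_cons, Matrix.range_empty, Set.union_empty, Set.singleton_union]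
    using hb.span_eq_top

/-- The degrees of the elements of a canonical basis in the Cartan grading. -/
def degree : Fin 8 → Multiplicative (ℤ × ℤ) :=
  ![Multiplicative.ofAdd (0, 0), Multiplicative.ofAdd (0, 0), Multiplicative.ofAdd (1, 0),
    Multiplicative.ofAdd (0, 1), Multiplicative.ofAdd (-1, -1), Multiplicative.ofAdd (-1, 0),
    Multiplicative.ofAdd (0, -1), Multiplicative.ofAdd (1, 1)]

theorem mul_basis (hb : IsCanonicalBasisEight F e₁ e₂ x y) (i j : Fin 8)
    {b : Fin 8 → A} (hb' : b = ![e₁, e₂, x 0, x 1, x 2, y 0, y 1, y 2]) :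
    b i * b j = 0 ∨
      ∃ k, degree k = degree i * degree j ∧ (b i * b j = b k ∨ b i * b j = -b k) := by
  subst hb'
  fin_cases i <;> fin_cases j
  · exact .inr ⟨0, by decide, .inl hb.e₁_e₁⟩
  · exact .inl hb.e₁_e₂
  · exact .inr ⟨2, by decide, .inl (hb.e₁_u 0)⟩
  · exact .inr ⟨3, by decide, .inl (hb.e₁_u 1)⟩
  · exact .inr ⟨4, by decide, .inl (hb.e₁_u 2)⟩
  · exact .inl (hb.e₁_v 0)
  · exact .inl (hb.e₁_v 1)
  · exact .inl (hb.e₁_v 2)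
  · exact .inl hb.e₂_e₁
  · exact .inr ⟨1, by decide, .inl hb.e₂_e₂⟩
  · exact .inl (hb.e₂_u 0)
  · exact .inl (hb.e₂_u 1)
  · exact .inl (hb.e₂_u 2)
  · exact .inr ⟨5, by decide, .inl (hb.e₂_v 0)⟩
  · exact .inr ⟨6, by decide, .inl (hb.e₂_v 1)⟩
  · exact .inr ⟨7, by decide, .inl (hb.e₂_v 2)⟩
  · exact .inl (hb.u_e₁ 0)
  · exact .inr ⟨2, by decide, .inl (hb.u_e₂ 0)⟩
  · exact .inl (hb.u_u_self 0)
  · exact .inr ⟨7, by decide, .inl (hb.u_u_succ 0)⟩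
  -- Indices wrap around in `Fin 3`: `succ_u_u 2` reads `x 0 * x 2 = -y 1`.
  · exact .inr ⟨6, by decide, .inr (hb.succ_u_u 2)⟩
  · exact .inr ⟨0, by decide, .inr (hb.u_v_self 0)⟩
  · exact .inl (hb.u_v_of_ne 0 1 (by decide))
  · exact .inl (hb.u_v_of_ne 0 2 (by decide))
  · exact .inl (hb.u_e₁ 1)
  · exact .inr ⟨3, by decide, .inl (hb.u_e₂ 1)⟩
  · exact .inr ⟨7, by decide, .inr (hb.succ_u_u 0)⟩
  · exact .inl (hb.u_u_self 1)
  · exact .inr ⟨5, by decide, .inl (hb.u_u_succ 1)⟩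
  · exact .inl (hb.u_v_of_ne 1 0 (by decide))
  · exact .inr ⟨0, by decide, .inr (hb.u_v_self 1)⟩
  · exact .inl (hb.u_v_of_ne 1 2 (by decide))
  · exact .inl (hb.u_e₁ 2)
  · exact .inr ⟨4, by decide, .inl (hb.u_e₂ 2)⟩
  · exact .inr ⟨6, by decide, .inl (hb.u_u_succ 2)⟩
  · exact .inr ⟨5, by decide, .inr (hb.succ_u_u 1)⟩
  · exact .inl (hb.u_u_self 2)
  · exact .inl (hb.u_v_of_ne 2 0 (by decide))
  · exact .inl (hb.u_v_of_ne 2 1 (by decide))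
  · exact .inr ⟨0, by decide, .inr (hb.u_v_self 2)⟩
  · exact .inr ⟨5, by decide, .inl (hb.v_e₁ 0)⟩
  · exact .inl (hb.v_e₂ 0)
  · exact .inr ⟨1, by decide, .inr (hb.v_u_self 0)⟩
  · exact .inl (hb.v_u_of_ne 0 1 (by decide))
  · exact .inl (hb.v_u_of_ne 0 2 (by decide))
  · exact .inl (hb.v_v_self 0)
  · exact .inr ⟨4, by decide, .inl (hb.v_v_succ 0)⟩
  · exact .inr ⟨3, by decide, .inr (hb.succ_v_v 2)⟩
  · exact .inr ⟨6, by decide, .inl (hb.v_e₁ 1)⟩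
  · exact .inl (hb.v_e₂ 1)
  · exact .inl (hb.v_u_of_ne 1 0 (by decide))
  · exact .inr ⟨1, by decide, .inr (hb.v_u_self 1)⟩
  · exact .inl (hb.v_u_of_ne 1 2 (by decide))
  · exact .inr ⟨4, by decide, .inr (hb.succ_v_v 0)⟩
  · exact .inl (hb.v_v_self 1)
  · exact .inr ⟨2, by decide, .inl (hb.v_v_succ 1)⟩
  · exact .inr ⟨7, by decide, .inl (hb.v_e₁ 2)⟩
  · exact .inl (hb.v_e₂ 2)
  · exact .inl (hb.v_u_of_ne 2 0 (by decide))
  · exact .inl (hb.v_u_of_ne 2 1 (by decide))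
  · exact .inr ⟨1, by decide, .inr (hb.v_u_self 2)⟩
  · exact .inr ⟨3, by decide, .inl (hb.v_v_succ 2)⟩
  · exact .inr ⟨2, by decide, .inr (hb.succ_v_v 1)⟩
  · exact .inl (hb.v_v_self 2)

/-- The Cartan grading of a canonical basis. -/
def grading (hb : IsCanonicalBasisEight F e₁ e₂ x y) (h : IsCompositionNorm n e)
    (he : e = e₁ + e₂) : GroupGrading F A (Multiplicative (ℤ × ℤ)) :=
  GroupGrading.ofFamily h ![e₁, e₂, x 0, x 1, x 2, y 0, y 1, y 2] degree hb.range_eq_top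
    (he ▸ add_mem (Submodule.subset_span ⟨0, rfl, rfl⟩) (Submodule.subset_span ⟨1, rfl, rfl⟩))
    (by
      have h1 := fun i => h.polar_unit_of_mul_self (hb.u_u_self i)
      have h2 := fun i => h.polar_unit_of_mul_self (hb.v_v_self i)
      intro i
      fin_cases i
      exacts [fun h0 => absurd rfl h0, fun h0 => absurd rfl h0, fun _ => h1 0, fun _ => h1 1,
        fun _ => h1 2, fun _ => h2 0, fun _ => h2 1, fun _ => h2 2])
    (fun i j => hb.mul_basis i j rfl)

theorem grading_component (hb : IsCanonicalBasisEight F e₁ e₂ x y) (h : IsCompositionNorm n e)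
    (he : e = e₁ + e₂) :
    (hb.grading h he).component (Multiplicative.ofAdd (0, 0)) = Submodule.span F {e₁, e₂} ∧
    (hb.grading h he).component (Multiplicative.ofAdd (1, 1)) = Submodule.span F {y 2} ∧
    (hb.grading h he).component (Multiplicative.ofAdd (-1, -1)) = Submodule.span F {x 2} ∧
    (hb.grading h he).component (Multiplicative.ofAdd (1, 0)) = Submodule.span F {x 0} ∧
    (hb.grading h he).component (Multiplicative.ofAdd (-1, 0)) = Submodule.span F {y 0} ∧
    (hb.grading h he).component (Multiplicative.ofAdd (0, 1)) = Submodule.span F {x 1} ∧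
    (hb.grading h he).component (Multiplicative.ofAdd (0, -1)) = Submodule.span F {y 1} := by
  refine ⟨congrArg (Submodule.span F) ?_, congrArg (Submodule.span F) ?_,
    congrArg (Submodule.span F) ?_, congrArg (Submodule.span F) ?_,
    congrArg (Submodule.span F) ?_, congrArg (Submodule.span F) ?_,
    congrArg (Submodule.span F) ?_⟩ <;>
  · ext z
    simp [-ofAdd_zero, -ofAdd_neg, degree, Fin.exists_fin_succ, eq_comm]

theorem mem_grading_component (hb : IsCanonicalBasisEight F e₁ e₂ x y)
    (h : IsCompositionNorm n e) (he : e = e₁ + e₂) (i : Fin 8) :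
    ![e₁, e₂, x 0, x 1, x 2, y 0, y 1, y 2] i ∈ (hb.grading h he).component (degree i) :=
  Submodule.subset_span ⟨i, rfl, rfl⟩

theorem grading_support (hb : IsCanonicalBasisEight F e₁ e₂ x y) (h : IsCompositionNorm n e)
    (he : e = e₁ + e₂) (k : Multiplicative (ℤ × ℤ)) :
    k ∈ (hb.grading h he).support ↔ ∃ i, degree i = k := by
  constructor
  · intro hk
    by_contra! hk'
    exact hk ((hb.grading h he).component_eq_bot hb.range_eq_top
      (hb.mem_grading_component h he) hk')
  · rintro ⟨i, rfl⟩
    exact (Submodule.ne_bot_iff _).2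
      ⟨_, hb.mem_grading_component h he i, hb.linearIndependent.ne_zero i⟩

/-- The target need not be abelian, but `u₁u₂` and `u₂u₁` are both nonzero in the line of `v₃`, so
the images `a`, `b` of the two generators commute and define a homomorphism from `ℤ²`. The products
`uᵢvᵢ = -e₁` fix the remaining degrees. -/
theorem hasUniversalProperty (hb : IsCanonicalBasisEight F e₁ e₂ x y)
    (h : IsCompositionNorm n e) (he : e = e₁ + e₂) :
    (hb.grading h he).HasUniversalProperty := by
  have hmem := hb.mem_grading_component h he
  have hne := hb.linearIndependent.ne_zero
  constructor
  · intro G _ s hs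
    have h0 := hs _ _ _ (hmem 0) _ (hmem 0) (hb.e₁_e₁.trans_ne (hne 0))
    have h1 := hs _ _ _ (hmem 2) _ (hmem 5) ((hb.u_v_self 0).trans_ne (neg_ne_zero.2 (hne 0)))
    have h2 := hs _ _ _ (hmem 3) _ (hmem 6) ((hb.u_v_self 1).trans_ne (neg_ne_zero.2 (hne 0)))
    have h3 := hs _ _ _ (hmem 4) _ (hmem 7) ((hb.u_v_self 2).trans_ne (neg_ne_zero.2 (hne 0)))
    have h4 := hs _ _ _ (hmem 2) _ (hmem 3) ((hb.u_u_succ 0).trans_ne (hne 7))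
    have h5 := hs _ _ _ (hmem 3) _ (hmem 2) ((hb.succ_u_u 0).trans_ne (neg_ne_zero.2 (hne 7)))
    obtain ⟨a, ha⟩ : ∃ a, a = s (Multiplicative.ofAdd (1, 0)) := ⟨_, rfl⟩
    obtain ⟨b, hb_eq⟩ : ∃ b, b = s (Multiplicative.ofAdd (0, 1)) := ⟨_, rfl⟩
    replace h0 : s (Multiplicative.ofAdd (0, 0)) = 1 := mul_eq_left.1 h0
    replace h1 : a * s (Multiplicative.ofAdd (-1, 0)) = 1 := ha ▸ h1.trans h0
    replace h2 : b * s (Multiplicative.ofAdd (0, -1)) = 1 := hb_eq ▸ h2.trans h0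
    replace h3 : s (Multiplicative.ofAdd (-1, -1)) * s (Multiplicative.ofAdd (1, 1)) = 1 :=
      h3.trans h0
    replace h4 : a * b = s (Multiplicative.ofAdd (1, 1)) := by rw [ha, hb_eq]; exact h4
    replace h5 : b * a = s (Multiplicative.ofAdd (1, 1)) := by rw [ha, hb_eq]; exact h5
    have hab : Commute a b := h4.trans h5.symm
    refine ⟨MonoidHom.mk' (fun k => a ^ k.toAdd.1 * b ^ k.toAdd.2) fun k l => ?_, fun k hk => ?_⟩
    · simp only [toAdd_mul, Prod.fst_add, Prod.snd_add, zpow_add]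
      exact ((hab.zpow_zpow _ _).symm.mul_mul_mul_comm _ _).symm
    · obtain ⟨i, rfl⟩ := (hb.grading_support h he k).1 hk
      fin_cases i
      · simpa [degree] using h0.symm
      · simpa [degree] using h0.symm
      · simpa [degree] using ha
      · simpa [degree] using hb_eq
      · simpa [degree, h4, ← mul_inv_rev, h5] using (eq_inv_of_mul_eq_one_left h3).symm
      · simpa [degree] using inv_eq_of_mul_eq_one_right h1
      · simpa [degree] using inv_eq_of_mul_eq_one_right h2
      · simpa [degree] using h4
  · rw [eq_top_iff]
    intro k _
    have h1 : k = Multiplicative.ofAdd ((1, 0) : ℤ × ℤ) ^ k.toAdd.1 *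
        Multiplicative.ofAdd ((0, 1) : ℤ × ℤ) ^ k.toAdd.2 := by
      rw [← ofAdd_zsmul, ← ofAdd_zsmul, ← ofAdd_add]
      simp
    rw [h1]
    exact mul_mem
      (Subgroup.zpow_mem _ (Subgroup.subset_closure ((hb.grading_support h he _).2 ⟨2, rfl⟩)) _)
      (Subgroup.zpow_mem _ (Subgroup.subset_closure ((hb.grading_support h he _).2 ⟨3, rfl⟩)) _)

theorem unit_eq (hb : IsCanonicalBasisEight F e₁ e₂ x y) (h : IsCompositionNorm n e) :
    e = e₁ + e₂ := by
  have h1 : LinearMap.mulLeft F (e₁ + e₂) = (LinearMap.id : A →ₗ[F] A) := by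
    refine LinearMap.ext_on_range (v := ![e₁, e₂, x 0, x 1, x 2, y 0, y 1, y 2])
      hb.range_eq_top fun i => ?_
    fin_cases i <;>
      simp [add_mul, hb.e₁_e₁, hb.e₁_e₂, hb.e₂_e₁, hb.e₂_e₂, hb.e₁_u, hb.e₂_u, hb.e₁_v, hb.e₂_v]
  have h2 := LinearMap.congr_fun h1 e
  rw [LinearMap.mulLeft_apply, h.mul_one] at h2
  exact h2.symm

end IsCanonicalBasisEight

end CanonicalEight

/-! ## The Cayley-Dickson doubling process inside a composition algebra -/

namespace IsCompositionNorm

section Doubling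

variable {F : Type u} {A : Type v} [Field F] [NonUnitalNonAssocRing A] [Module F A]
  [IsScalarTower F A A] [SMulCommClass F A A] {n : QuadraticForm F A} {e : A}

/-- `B` is a unital subalgebra and `z` is orthogonal to it. -/
structure IsDoubling (n : QuadraticForm F A) (e : A) (B : Submodule F A) (z : A) : Prop where
  unit_mem : e ∈ B
  mul_mem : ∀ {x y}, x ∈ B → y ∈ B → x * y ∈ B
  polar_eq_zero : ∀ {x}, x ∈ B → polar n x z = 0

namespace IsDoubling

variable {B : Submodule F A} {x y z : A}

theorem compConj_mem (hB : IsDoubling n e B z) (hx : x ∈ B) : compConj n e x ∈ B :=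
  sub_mem (Submodule.smul_mem _ _ hB.unit_mem) hx

theorem polar_unit (hB : IsDoubling n e B z) : polar n z e = 0 := by
  rw [QuadraticMap.polar_comm]
  exact hB.polar_eq_zero hB.unit_mem

theorem polar_mul (h : IsCompositionNorm n e) (hB : IsDoubling n e B z) (hx : x ∈ B)
    (hy : y ∈ B) : polar n x (y * z) = 0 := by
  rw [QuadraticMap.polar_comm, h.polar_mul_left, QuadraticMap.polar_comm]
  exact hB.polar_eq_zero (hB.mul_mem (hB.compConj_mem hy) hx)

/-- With `double_mul` and `double_mul_double` this is the Cayley-Dickson product on `B + Bz`. Only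
orthogonality of `z` to the subalgebra is needed; `B` need not be associative. -/
theorem mul_double (h : IsCompositionNorm n e) (hB : IsDoubling n e B z) (hx : x ∈ B)
    (hy : y ∈ B) : x * (y * z) = y * x * z :=
  h.mul_mul_double hB.polar_unit (hB.polar_eq_zero hx) (hB.polar_eq_zero hy)
    (hB.polar_eq_zero (hB.mul_mem hy hx))

theorem double_mul (h : IsCompositionNorm n e) (hB : IsDoubling n e B z) (hy : y ∈ B) :
    x * z * y = x * compConj n e y * z :=
  h.mul_mul_of_polar_eq_zero' hB.polar_unit (hB.polar_eq_zero hy) x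

theorem double_mul_double (h : IsCompositionNorm n e) (hB : IsDoubling n e B z) (hx : x ∈ B)
    (hy : y ∈ B) : x * z * (y * z) = -(n z • (compConj n e y * x)) := by
  refine h.double_mul_double hB.polar_unit ?_ (hB.polar_mul h (hB.compConj_mem hy) hx)
  rw [QuadraticMap.polar_comm]
  exact hB.polar_mul h hB.unit_mem hx

end IsDoubling

theorem mul_mem_span_unit (h : IsCompositionNorm n e) {w x y : A}
    (hx : x ∈ Submodule.span F {e, w}) (hy : y ∈ Submodule.span F {e, w}) :
    x * y ∈ Submodule.span F {e, w} := by
  obtain ⟨a, b, rfl⟩ := Submodule.mem_span_pair.1 hx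
  obtain ⟨c, d, rfl⟩ := Submodule.mem_span_pair.1 hy
  -- The coefficients come from `w² = t(w)w - n(w)e`.
  refine Submodule.mem_span_pair.2 ⟨a * c - b * d * n w, a * d + b * c + b * d * polar n w e, ?_⟩
  simp only [add_mul, mul_add, smul_mul_assoc, mul_smul_comm, h.one_mul, h.mul_one, h.mul_self w]
  module

theorem mul_comm_span_unit (h : IsCompositionNorm n e) {w x y : A}
    (hx : x ∈ Submodule.span F {e, w}) (hy : y ∈ Submodule.span F {e, w}) :
    x * y = y * x := by
  obtain ⟨a, b, rfl⟩ := Submodule.mem_span_pair.1 hx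
  obtain ⟨c, d, rfl⟩ := Submodule.mem_span_pair.1 hy
  simp only [add_mul, mul_add, smul_mul_assoc, mul_smul_comm, h.one_mul, h.mul_one]
  module

theorem mul_assoc_span_unit (h : IsCompositionNorm n e) {w x y z : A}
    (hx : x ∈ Submodule.span F {e, w}) (hy : y ∈ Submodule.span F {e, w})
    (hz : z ∈ Submodule.span F {e, w}) : x * y * z = x * (y * z) := by
  obtain ⟨a, b, rfl⟩ := Submodule.mem_span_pair.1 hx
  obtain ⟨c, d, rfl⟩ := Submodule.mem_span_pair.1 hy
  obtain ⟨f, g, rfl⟩ := Submodule.mem_span_pair.1 hz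
  simp only [add_mul, mul_add, smul_mul_assoc, mul_smul_comm, h.one_mul, h.mul_one, h.mul_self w,
    sub_mul, mul_sub]
  module

theorem isDoubling_span (h : IsCompositionNorm n e) {w z : A} (hze : polar n z e = 0)
    (hzw : polar n z w = 0) : IsDoubling n e (Submodule.span F {e, w}) z where
  unit_mem := Submodule.subset_span (Set.mem_insert e {w})
  mul_mem := h.mul_mem_span_unit
  polar_eq_zero hx := by
    obtain ⟨a, b, rfl⟩ := Submodule.mem_span_pair.1 hx
    rw [QuadraticMap.polar_comm, QuadraticMap.polar_add_right, QuadraticMap.polar_smul_right,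
      QuadraticMap.polar_smul_right, hze, hzw, smul_zero, smul_zero, add_zero]

section CharTwo

variable [CharP F 2]

theorem polar_unit_self (h : IsCompositionNorm n e) : polar n e e = 0 := by
  rw [h.polar_unit_unit, CharTwo.two_eq_zero]

theorem polar_self_eq_zero (x : A) : polar n x x = 0 := by
  rw [QuadraticMap.polar_self, two_nsmul, CharTwo.add_self_eq_zero]

/-- The pair `e, w` is nondegenerate. -/
theorem coeff_eq_zero_of_polar (h : IsCompositionNorm n e) {w : A} (hw : polar n w e ≠ 0)
    {a b : F} (h1 : polar n (a • e + b • w) e = 0) (h2 : polar n (a • e + b • w) w = 0) :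
    a = 0 ∧ b = 0 := by
  simp only [QuadraticMap.polar_add_left, QuadraticMap.polar_smul_left, h.polar_unit_self,
    polar_self_eq_zero, smul_eq_mul, mul_zero, zero_add, add_zero] at h1 h2
  rw [QuadraticMap.polar_comm] at h2
  exact ⟨(mul_eq_zero.1 h2).resolve_right hw, (mul_eq_zero.1 h1).resolve_right hw⟩

/-- Here characteristic 2 is decisive: `t(e) = 2 = 0`, so the trace of `ae + bw` is `b t(w)`. -/
theorem mem_span_unit_of_polar (h : IsCompositionNorm n e) {w x : A} (hw : polar n w e ≠ 0)
    (hx : x ∈ Submodule.span F {e, w}) (hxe : polar n x e = 0) : x ∈ Submodule.span F {e} := by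
  obtain ⟨a, b, rfl⟩ := Submodule.mem_span_pair.1 hx
  simp only [QuadraticMap.polar_add_left, QuadraticMap.polar_smul_left, h.polar_unit_self,
    smul_eq_mul, mul_zero, zero_add] at hxe
  rw [(mul_eq_zero.1 hxe).resolve_right hw, zero_smul, add_zero]
  exact Submodule.smul_mem _ _ (Submodule.mem_span_singleton_self e)

/-- The component of `x` orthogonal to `e` and `w`. -/
theorem exists_sub_orthogonal (h : IsCompositionNorm n e) {w : A} (hw : polar n w e ≠ 0) (x : A) :
    ∃ k ∈ Submodule.span F {e, w}, polar n (x - k) e = 0 ∧ polar n (x - k) w = 0 := by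
  -- In characteristic 2 `n(e,e) = n(w,w) = 0`, so the Gram matrix of `e, w` is antidiagonal: the
  -- coefficient of `e` is read off by pairing with `w`, and that of `w` by pairing with `e`.
  refine ⟨((polar n w e)⁻¹ * polar n x w) • e + ((polar n w e)⁻¹ * polar n x e) • w,
    Submodule.mem_span_pair.2 ⟨_, _, rfl⟩, ?_, ?_⟩
  · simp only [QuadraticMap.polar_sub_left, QuadraticMap.polar_add_left,
      QuadraticMap.polar_smul_left, h.polar_unit_self, smul_eq_mul]
    field_simp
    ring
  · simp only [QuadraticMap.polar_sub_left, QuadraticMap.polar_add_left,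
      QuadraticMap.polar_smul_left, polar_self_eq_zero, smul_eq_mul, QuadraticMap.polar_comm n e w]
    field_simp
    ring

/-- A four-dimensional subalgebra is obtained by doubling. -/
theorem le_sup_map_mulRight (h : IsCompositionNorm n e) {E : Submodule F A}
    (hE : Module.finrank F E = 4) (hE' : ∀ {x y}, x ∈ E → y ∈ E → x * y ∈ E) (he : e ∈ E) {w z : A}
    (hwE : w ∈ E) (hzE : z ∈ E) (hw : polar n w e ≠ 0) (hze : polar n z e = 0)
    (hzw : polar n z w = 0) (hz : ∀ k ∈ Submodule.span F {e, w}, k * z = 0 → k = 0) :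
    E ≤ Submodule.span F {e, w} ⊔ (Submodule.span F {e, w}).map (LinearMap.mulRight F z) := by
  have hD := h.isDoubling_span hze hzw
  have heK := hD.unit_mem
  have hwK : w ∈ Submodule.span F {e, w} := Submodule.subset_span (Set.mem_insert_of_mem e rfl)
  have hli : LinearIndependent F ![e, w, z, w * z] := by
    rw [Fintype.linearIndependent_iff]
    intro g hg
    rw [Fin.sum_univ_four] at hg
    change g 0 • e + g 1 • w + g 2 • z + g 3 • (w * z) = 0 at hg
    -- In a relation, the part in `K = Fe + Fw` lies in `Kz` and so is orthogonal to `K`; since `K`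
    -- is nondegenerate it vanishes, and `hz` disposes of the rest. Anisotropy of `z` is not
    -- required, so the lemma also serves to refute an isotropic `z`.
    have h1 : g 0 • e + g 1 • w = -((g 2 • e + g 3 • w) * z) := by
      rw [add_mul, smul_mul_assoc, smul_mul_assoc, h.one_mul, eq_neg_iff_add_eq_zero, ← add_assoc]
      exact hg
    have h2 : g 2 • e + g 3 • w ∈ Submodule.span F {e, w} :=
      Submodule.mem_span_pair.2 ⟨_, _, rfl⟩
    have h3 : ∀ y ∈ Submodule.span F {e, w}, polar n (g 0 • e + g 1 • w) y = 0 := by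
      intro y hy
      rw [h1, QuadraticMap.polar_neg_left, QuadraticMap.polar_comm, hD.polar_mul h hy h2,
        neg_zero]
    obtain ⟨h4, h5⟩ := h.coeff_eq_zero_of_polar hw (h3 e heK) (h3 w hwK)
    have h6 : g 2 • e + g 3 • w = 0 := by
      refine hz _ h2 ?_
      rw [h4, h5, zero_smul, zero_smul, add_zero, eq_comm, neg_eq_zero] at h1
      exact h1
    obtain ⟨h7, h8⟩ := h.coeff_eq_zero_of_polar (a := g 2) (b := g 3) hw
      (by rw [h6]; exact QuadraticMap.polar_zero_left n _)
      (by rw [h6]; exact QuadraticMap.polar_zero_left n _)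
    intro i
    fin_cases i
    exacts [h4, h5, h7, h8]
  have hfin : Module.Finite F E := Module.finite_of_finrank_pos (by omega)
  have h1 : Submodule.span F (Set.range ![e, w, z, w * z]) ≤ E := by
    rw [Submodule.span_le]
    rintro _ ⟨i, rfl⟩
    fin_cases i
    exacts [he, hwE, hzE, hE' hwE hzE]
  have h2 : Submodule.span F (Set.range ![e, w, z, w * z]) = E := by
    refine Submodule.eq_of_le_of_finrank_eq h1 ?_
    rw [finrank_span_eq_card hli, hE, Fintype.card_fin]
  rw [← h2, Submodule.span_le]
  rintro _ ⟨i, rfl⟩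
  fin_cases i
  · exact Submodule.mem_sup_left heK
  · exact Submodule.mem_sup_left hwK
  · exact Submodule.mem_sup_right ⟨e, heK, h.one_mul z⟩
  · exact Submodule.mem_sup_right ⟨w, hwK, rfl⟩

theorem map_mulRight_eq (h : IsCompositionNorm n e) {E O : Submodule F A}
    (hfin : Module.Finite F O) (hEO : Module.finrank F E = Module.finrank F O) {z : A}
    (hz : n z ≠ 0) (hEz : ∀ x ∈ E, x * z ∈ O) : E.map (LinearMap.mulRight F z) = O := by
  have hinj : Function.Injective (LinearMap.mulRight F z) := by
    rw [← LinearMap.ker_eq_bot, LinearMap.ker_eq_bot']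
    exact fun x hx => h.eq_zero_of_mul_right_eq_zero hz hx
  refine Submodule.eq_of_le_of_finrank_eq ?_ ?_
  · rintro _ ⟨x, hx, rfl⟩
    exact hEz x hx
  · rw [← hEO]
    exact (Submodule.equivMapOfInjective _ hinj E).finrank_eq.symm

end CharTwo

end Doubling

end IsCompositionNorm

/-! ### The `(ℤ/2)²`-grading of an iterated doubling -/

section DoublingGrading

variable {F : Type u} {A : Type v} [Field F] [NonUnitalNonAssocRing A] [Module F A]
  [IsScalarTower F A A] [SMulCommClass F A A] {n : QuadraticForm F A} {e : A}

/-- A grading is given by its universal group if each component contains an anisotropic vector. -/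
theorem GroupGrading.hasUniversalProperty_of_anisotropic {H : Type w} [Group H]
    (h : IsCompositionNorm n e) {Δ : GroupGrading F A H}
    (hΔ : ∀ k, ∃ x ∈ Δ.component k, n x ≠ 0) : Δ.HasUniversalProperty := by
  have hne : ∀ {x : A}, n x ≠ 0 → x ≠ 0 := by
    rintro x hx rfl
    exact hx (QuadraticMap.map_zero n)
  have hsupp : ∀ k, k ∈ Δ.support := fun k => by
    obtain ⟨x, hx, hx0⟩ := hΔ k
    exact (Submodule.ne_bot_iff _).2 ⟨x, hx, hne hx0⟩
  -- Products of anisotropic vectors are anisotropic, hence nonzero, so `s` itself is already a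
  -- homomorphism on the whole group.
  refine ⟨fun G _ s hs => ⟨MonoidHom.mk' s fun k l => ?_, fun _ _ => rfl⟩,
    eq_top_iff.2 fun k _ => Subgroup.subset_closure (hsupp k)⟩
  obtain ⟨x, hx, hx0⟩ := hΔ k
  obtain ⟨y, hy, hy0⟩ := hΔ l
  refine (hs k l x hx y hy (hne ?_)).symm
  rw [h.map_mul]
  exact mul_ne_zero hx0 hy0

namespace IsCompositionNorm

/-- The data of a doubling process `K ⊆ K ⊕ Kv = P₀`, `P₀ ⊕ P₀u = A` with `K = Fe + Fw`. -/
structure IsDoublingTriple (n : QuadraticForm F A) (e : A)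
    (P : GroupGrading F A (Multiplicative (ZMod 2))) (w v u : A) : Prop where
  finrank_even : Module.finrank F (P.component (Multiplicative.ofAdd 0)) = 4
  finrank_odd : Module.finrank F (P.component (Multiplicative.ofAdd 1)) = 4
  w_mem : w ∈ P.component (Multiplicative.ofAdd 0)
  v_mem : v ∈ P.component (Multiplicative.ofAdd 0)
  u_mem : u ∈ P.component (Multiplicative.ofAdd 1)
  polar_w : polar n w e ≠ 0
  polar_v : polar n v e = 0
  polar_v_w : polar n v w = 0
  map_v : n v ≠ 0
  map_u : n u ≠ 0

variable {P : GroupGrading F A (Multiplicative (ZMod 2))} {w v u : A}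

theorem isDoubling_even (h : IsCompositionNorm n e)
    (hu : u ∈ P.component (Multiplicative.ofAdd 1)) :
    IsDoubling n e (P.component (Multiplicative.ofAdd 0)) u where
  unit_mem := P.unit_mem h
  mul_mem hx hy := P.mul_mem hx hy
  polar_eq_zero hx := P.polar_eq_zero h (by decide) hx hu

/-- The even components `K` and `Kv` of the doubling grading. -/
def doublingPart (F : Type u) {A : Type v} [Field F] [NonUnitalNonAssocRing A] [Module F A]
    [IsScalarTower F A A] (e w v : A) (i : ZMod 2) : Submodule F A :=
  if i = 0 then Submodule.span F {e, w} else (Submodule.span F {e, w}).map (LinearMap.mulRight F v)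

/-- The components of the doubling grading. -/
def doublingComponent (F : Type u) {A : Type v} [Field F] [NonUnitalNonAssocRing A] [Module F A]
    [IsScalarTower F A A] (e w v u : A) (k : Multiplicative (ZMod 2 × ZMod 2)) :
    Submodule F A :=
  if k.toAdd.2 = 0 then doublingPart F e w v k.toAdd.1
  else (doublingPart F e w v k.toAdd.1).map (LinearMap.mulRight F u)

theorem doublingPart_zero : doublingPart F e w v 0 = Submodule.span F {e, w} := if_pos rfl

theorem doublingPart_one : doublingPart F e w v 1 =
    (Submodule.span F {e, w}).map (LinearMap.mulRight F v) := if_neg (by decide)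

theorem doublingComponent_zero (i : ZMod 2) :
    doublingComponent F e w v u (Multiplicative.ofAdd (i, 0)) = doublingPart F e w v i :=
  if_pos rfl

theorem doublingComponent_one (i : ZMod 2) :
    doublingComponent F e w v u (Multiplicative.ofAdd (i, 1)) =
      (doublingPart F e w v i).map (LinearMap.mulRight F u) :=
  if_neg (by simp)

theorem _root_.ZMod.two_cases (i : ZMod 2) : i = 0 ∨ i = 1 := by
  revert i
  decide

namespace IsDoublingTriple

theorem part_mul (h : IsCompositionNorm n e) (ht : IsDoublingTriple n e P w v u) {i j : ZMod 2}
    {x y : A} (hx : x ∈ doublingPart F e w v i) (hy : y ∈ doublingPart F e w v j) :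
    x * y ∈ doublingPart F e w v (i + j) := by
  have hD := h.isDoubling_span ht.polar_v ht.polar_v_w
  rcases ZMod.two_cases i with rfl | rfl <;> rcases ZMod.two_cases j with rfl | rfl
  · exact hD.mul_mem hx hy
  · rw [doublingPart_zero] at hx
    rw [zero_add, doublingPart_one] at *
    obtain ⟨b, hb, rfl⟩ := hy
    exact ⟨b * x, hD.mul_mem hb hx, (hD.mul_double h hx hb).symm⟩
  · rw [doublingPart_zero] at hy
    rw [add_zero, doublingPart_one] at *
    obtain ⟨a, ha, rfl⟩ := hx
    exact ⟨_, hD.mul_mem ha (hD.compConj_mem hy), (hD.double_mul h hy).symm⟩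
  · rw [doublingPart_one] at hx hy
    rw [CharTwo.add_self_eq_zero, doublingPart_zero]
    obtain ⟨a, ha, rfl⟩ := hx
    obtain ⟨b, hb, rfl⟩ := hy
    rw [LinearMap.mulRight_apply, LinearMap.mulRight_apply, hD.double_mul_double h ha hb]
    exact neg_mem (Submodule.smul_mem _ _ (hD.mul_mem (hD.compConj_mem hb) ha))

theorem polar_part (h : IsCompositionNorm n e) (ht : IsDoublingTriple n e P w v u) {i : ZMod 2}
    (hi : i ≠ 0) {x : A} (hx : x ∈ doublingPart F e w v i) : polar n x e = 0 := by
  have hD := h.isDoubling_span ht.polar_v ht.polar_v_w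
  rw [(ZMod.two_cases i).resolve_left hi, doublingPart_one] at hx
  obtain ⟨a, ha, rfl⟩ := hx
  rw [QuadraticMap.polar_comm]
  exact hD.polar_mul h hD.unit_mem ha

theorem compConj_part (h : IsCompositionNorm n e) (ht : IsDoublingTriple n e P w v u) {i : ZMod 2}
    {x : A} (hx : x ∈ doublingPart F e w v i) : compConj n e x ∈ doublingPart F e w v i := by
  by_cases hi : i = 0
  · subst hi
    exact (h.isDoubling_span ht.polar_v ht.polar_v_w).compConj_mem hx
  · rw [compConj_of_polar_eq_zero (ht.polar_part h hi hx)]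
    exact neg_mem hx

theorem part_le (h : IsCompositionNorm n e) (ht : IsDoublingTriple n e P w v u) (i : ZMod 2) :
    doublingPart F e w v i ≤ P.component (Multiplicative.ofAdd 0) := by
  have hK : Submodule.span F {e, w} ≤ P.component (Multiplicative.ofAdd 0) := by
    rw [Submodule.span_le]
    rintro _ (rfl | rfl)
    exacts [P.unit_mem h, ht.w_mem]
  rcases ZMod.two_cases i with rfl | rfl
  · exact hK
  · rw [doublingPart_one]
    rintro _ ⟨x, hx, rfl⟩
    exact P.mul_mem (hK hx) ht.v_mem

theorem map_part_le (h : IsCompositionNorm n e) (ht : IsDoublingTriple n e P w v u) (i : ZMod 2) :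
    (doublingPart F e w v i).map (LinearMap.mulRight F u) ≤
      P.component (Multiplicative.ofAdd 1) := by
  rintro _ ⟨x, hx, rfl⟩
  exact P.mul_mem (ht.part_le h i hx) ht.u_mem

theorem exists_component_le (h : IsCompositionNorm n e) (ht : IsDoublingTriple n e P w v u)
    (k : Multiplicative (ZMod 2 × ZMod 2)) :
    ∃ i, doublingComponent F e w v u k ≤ P.component i := by
  obtain ⟨i, j⟩ := k
  rcases ZMod.two_cases j with rfl | rfl
  · exact ⟨_, (doublingComponent_zero i).trans_le (ht.part_le h i)⟩
  · exact ⟨_, (doublingComponent_one i).trans_le (ht.map_part_le h i)⟩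

/-- The `(ℤ/2)²`-grading of a doubling process. -/
def grading [CharP F 2] (h : IsCompositionNorm n e) (ht : IsDoublingTriple n e P w v u) :
    GroupGrading F A (Multiplicative (ZMod 2 × ZMod 2)) :=
  GroupGrading.ofComposition h (doublingComponent F e w v u)
    (Submodule.subset_span (Set.mem_insert e {w}))
    (by
      rintro ⟨i, j⟩ hk x hx
      change x ∈ doublingComponent F e w v u (Multiplicative.ofAdd (i, j)) at hx
      rcases ZMod.two_cases j with rfl | rfl
      · rw [doublingComponent_zero] at hx
        refine ht.polar_part h (fun hi => hk ?_) hx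
        rw [hi]
        rfl
      · rw [doublingComponent_one] at hx
        exact P.polar_unit_eq_zero h (by decide) (ht.map_part_le h i hx))
    (by
      have heven : P.component (Multiplicative.ofAdd 0) ≤
          doublingPart F e w v 0 ⊔ doublingPart F e w v 1 := by
        rw [doublingPart_zero, doublingPart_one]
        exact h.le_sup_map_mulRight ht.finrank_even (fun hx hy => P.mul_mem hx hy) (P.unit_mem h)
          ht.w_mem ht.v_mem ht.polar_w ht.polar_v ht.polar_v_w
          fun k _ hk => h.eq_zero_of_mul_right_eq_zero ht.map_v hk
      -- Right multiplication by the anisotropic `u` is injective and the two parities have equal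
      -- dimension, so the odd part is the even part times `u`.
      have hodd := h.map_mulRight_eq (E := P.component (Multiplicative.ofAdd 0))
        (Module.finite_of_finrank_pos (by rw [ht.finrank_odd]; omega))
        (ht.finrank_even.trans ht.finrank_odd.symm) ht.map_u fun x hx => P.mul_mem hx ht.u_mem
      rw [eq_top_iff, ← P.iSup_eq_top]
      refine iSup_le fun i => ?_
      rcases ZMod.two_cases i.toAdd with hi | hi
      · rw [← ofAdd_toAdd i, hi]
        refine heven.trans (sup_le ?_ ?_)
        · exact (doublingComponent_zero (u := u) 0).symm.trans_le
            (le_iSup (doublingComponent F e w v u) _)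
        · exact (doublingComponent_zero (u := u) 1).symm.trans_le
            (le_iSup (doublingComponent F e w v u) _)
      · rw [← ofAdd_toAdd i, hi, ← hodd]
        refine (Submodule.map_mono heven).trans ?_
        rw [Submodule.map_sup]
        refine sup_le ?_ ?_
        · exact (doublingComponent_one 0).symm.trans_le (le_iSup (doublingComponent F e w v u) _)
        · exact (doublingComponent_one 1).symm.trans_le (le_iSup (doublingComponent F e w v u) _))
    (by
      rintro ⟨i, j⟩ ⟨i', j'⟩ x y hx hy
      change x ∈ doublingComponent F e w v u (Multiplicative.ofAdd (i, j)) at hx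
      change y ∈ doublingComponent F e w v u (Multiplicative.ofAdd (i', j')) at hy
      change x * y ∈ doublingComponent F e w v u (Multiplicative.ofAdd (i + i', j + j'))
      have hD := h.isDoubling_even ht.u_mem
      rcases ZMod.two_cases j with rfl | rfl <;> rcases ZMod.two_cases j' with rfl | rfl
      · rw [doublingComponent_zero] at hx hy
        rw [add_zero, doublingComponent_zero]
        exact ht.part_mul h hx hy
      · rw [doublingComponent_zero] at hx
        rw [doublingComponent_one] at hy
        rw [zero_add, doublingComponent_one]
        obtain ⟨b, hb, rfl⟩ := hy
        refine ⟨b * x, add_comm i' i ▸ ht.part_mul h hb hx, ?_⟩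
        exact (hD.mul_double h (ht.part_le h _ hx) (ht.part_le h _ hb)).symm
      · rw [doublingComponent_one] at hx
        rw [doublingComponent_zero] at hy
        rw [add_zero, doublingComponent_one]
        obtain ⟨a, ha, rfl⟩ := hx
        exact ⟨_, ht.part_mul h ha (ht.compConj_part h hy),
          (hD.double_mul h (ht.part_le h _ hy)).symm⟩
      · rw [doublingComponent_one] at hx hy
        rw [CharTwo.add_self_eq_zero, doublingComponent_zero]
        obtain ⟨a, ha, rfl⟩ := hx
        obtain ⟨b, hb, rfl⟩ := hy
        rw [LinearMap.mulRight_apply, LinearMap.mulRight_apply,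
          hD.double_mul_double h (ht.part_le h _ ha) (ht.part_le h _ hb)]
        exact neg_mem (Submodule.smul_mem _ _
          (add_comm i' i ▸ ht.part_mul h (ht.compConj_part h hb) ha)))

/-- For `k` in `K` one has `k(vu) = (vk)u = (k̄v)u`; the two spaces agree because `K` is stable
under conjugation, although `k(vu)` and `(kv)u` may differ. -/
theorem map_mulRight_mul (h : IsCompositionNorm n e) (ht : IsDoublingTriple n e P w v u) :
    ((Submodule.span F {e, w}).map (LinearMap.mulRight F v)).map (LinearMap.mulRight F u) =
      (Submodule.span F {e, w}).map (LinearMap.mulRight F (v * u)) := by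
  have hD := h.isDoubling_span ht.polar_v ht.polar_v_w
  have h1 : ∀ k ∈ Submodule.span F {e, w}, k * (v * u) = compConj n e k * v * u := by
    intro k hk
    rw [(h.isDoubling_even ht.u_mem).mul_double h (ht.part_le h 0 hk) ht.v_mem,
      h.mul_comm_of_polar_eq_zero ht.polar_v (hD.polar_eq_zero hk)]
  apply le_antisymm
  · rintro _ ⟨_, ⟨k, hk, rfl⟩, rfl⟩
    refine ⟨compConj n e k, hD.compConj_mem hk, ?_⟩
    rw [LinearMap.mulRight_apply, h1 _ (hD.compConj_mem hk), h.compConj_compConj]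
    rfl
  · rintro _ ⟨k, hk, rfl⟩
    exact ⟨_, ⟨_, hD.compConj_mem hk, rfl⟩, (h1 k hk).symm⟩

variable [CharP F 2]

theorem grading_component (h : IsCompositionNorm n e) (ht : IsDoublingTriple n e P w v u) :
    (ht.grading h).component (Multiplicative.ofAdd (0, 0)) = Submodule.span F {e, w} ∧
    (ht.grading h).component (Multiplicative.ofAdd (1, 0)) =
      (Submodule.span F {e, w}).map (LinearMap.mulRight F v) ∧
    (ht.grading h).component (Multiplicative.ofAdd (0, 1)) =
      (Submodule.span F {e, w}).map (LinearMap.mulRight F u) ∧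
    (ht.grading h).component (Multiplicative.ofAdd (1, 1)) =
      (Submodule.span F {e, w}).map (LinearMap.mulRight F (v * u)) :=
  ⟨(doublingComponent_zero (v := v) (u := u) 0).trans doublingPart_zero,
    (doublingComponent_zero (u := u) 1).trans doublingPart_one,
    (doublingComponent_one 0).trans (by rw [doublingPart_zero]),
    (doublingComponent_one 1).trans (by rw [doublingPart_one, ht.map_mulRight_mul h])⟩

theorem exists_anisotropic (h : IsCompositionNorm n e) (ht : IsDoublingTriple n e P w v u)
    (k : Multiplicative (ZMod 2 × ZMod 2)) : ∃ x ∈ (ht.grading h).component k, n x ≠ 0 := by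
  obtain ⟨h1, h2, h3, h4⟩ := ht.grading_component h
  have he : e ∈ Submodule.span F {e, w} := Submodule.subset_span (Set.mem_insert e {w})
  have hmem : ∀ x, x ∈ (Submodule.span F {e, w}).map (LinearMap.mulRight F x) :=
    fun x => ⟨e, he, h.one_mul x⟩
  obtain ⟨i, j⟩ := k
  rcases ZMod.two_cases i with rfl | rfl <;> rcases ZMod.two_cases j with rfl | rfl
  · exact ⟨e, h1.symm ▸ he, by rw [h.map_one]; exact one_ne_zero⟩
  · exact ⟨u, h3.symm ▸ hmem u, ht.map_u⟩
  · exact ⟨v, h2.symm ▸ hmem v, ht.map_v⟩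
  · exact ⟨v * u, h4.symm ▸ hmem _, by rw [h.map_mul]; exact mul_ne_zero ht.map_v ht.map_u⟩

end IsDoublingTriple

end IsCompositionNorm

end DoublingGrading

/-! ## Homogeneous elements of a grading on a composition superalgebra -/

namespace IsCompositionNorm

section Search

variable {F : Type u} {A : Type v} {G : Type t} [Field F] [CharP F 2] [NonUnitalNonAssocRing A]
  [Module F A] [IsScalarTower F A A] [SMulCommClass F A A] [Group G] {n : QuadraticForm F A} {e : A}
  {P : GroupGrading F A (Multiplicative (ZMod 2))} {Γ : GroupGrading F A G} {c x y : A}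

theorem exists_polar_ne_zero (h : IsCompositionNorm n e) (hx : x ≠ 0) : ∃ y, polar n x y ≠ 0 := by
  by_contra! h0
  exact hx (h.eq_zero_of_polar x h0)

theorem polar_proj_one (h : IsCompositionNorm n e) (Γ : GroupGrading F A G) (x : A) :
    polar n (Γ.proj 1 x) e = polar n x e := by
  have h1 : (n.polarBilin.flip e).comp (Γ.proj 1) = n.polarBilin.flip e := by
    refine Γ.linearMap_ext fun g y hy => ?_
    change polar n (Γ.proj 1 y) e = polar n y e
    by_cases hg : g = 1
    · rw [Γ.proj_of_mem (hg ▸ hy)]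
    · rw [Γ.proj_of_mem_of_ne hy hg, Γ.polar_unit_eq_zero h hg hy, QuadraticMap.polar_zero_left]
  exact LinearMap.congr_fun h1 x

/-- Left multiplication by the neutral `c` commutes with the projections, and these preserve trace
zero; so the Peirce components have homogeneous spanning sets. -/
theorem IsPeirce.proj (h : IsCompositionNorm n e) (hc : c ∈ Γ.component 1)
    (hx : IsPeirce n e c x) (g : G) : IsPeirce n e c (Γ.proj g x) := by
  refine ⟨?_, by rw [← Γ.proj_mul_left hc, hx.mul_eq]⟩
  by_cases hg : g = 1
  · rw [hg, h.polar_proj_one, hx.polar_unit]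
  · exact Γ.polar_unit_eq_zero h hg (Γ.proj_mem g x)

theorem _root_.GroupGrading.parity_eq (h : IsCompositionNorm n e) {i j : Multiplicative (ZMod 2)}
    (hx : x ∈ P.component i) (hy : y ∈ P.component j) (hxy : polar n x y ≠ 0) : j = i := by
  have h1 : i * j = 1 := by
    by_contra h1
    exact hxy (P.polar_eq_zero h h1 hx hy)
  clear hxy hx hy
  revert i j
  decide

/-- An element of nonzero trace in the neutral even component. -/
theorem exists_polar_unit_ne_zero (h : IsCompositionNorm n e) (hΓ : GroupGrading.IsSuper P Γ) :
    ∃ w ∈ P.component (Multiplicative.ofAdd 0), w ∈ Γ.component 1 ∧ polar n w e ≠ 0 := by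
  obtain ⟨z, hz⟩ := h.exists_polar_ne_zero h.unit_ne_zero
  rw [QuadraticMap.polar_comm] at hz
  refine ⟨Γ.proj 1 (P.proj (Multiplicative.ofAdd 0) z), hΓ.proj_mem 1 (P.proj_mem _ _),
    Γ.proj_mem _ _, ?_⟩
  rw [h.polar_proj_one]
  exact (h.polar_proj_one P z).trans_ne hz

/-- A homogeneous dual vector in the opposite Peirce component. -/
theorem IsPeirce.exists_dual (h : IsCompositionNorm n e) (hΓ : GroupGrading.IsSuper P Γ)
    (hc : IsIdempotent n e c) (hcP : c ∈ P.component (Multiplicative.ofAdd 0))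
    (hcΓ : c ∈ Γ.component 1) {i : Multiplicative (ZMod 2)} (hx : IsPeirce n e c x)
    (hxP : x ∈ P.component i) (hx0 : x ≠ 0) :
    ∃ g, ∃ y ∈ Γ.component g, y ∈ P.component i ∧ IsPeirce n e (compConj n e c) y ∧
      polar n x y = 1 := by
  obtain ⟨z, hz⟩ := h.exists_polar_ne_zero hx0
  obtain ⟨k, hk, hk1, hk2⟩ := h.exists_sub_orthogonal (w := c)
    (by rw [hc.polar_unit]; exact one_ne_zero) z
  have hxk : polar n x k = 0 := by
    rw [QuadraticMap.polar_comm]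
    exact (h.isDoubling_span hx.polar_unit
      (by rw [QuadraticMap.polar_comm, hx.polar_eq_zero h])).polar_eq_zero hk
  have hy := isPeirce_compConj_mul h hc hk1 (by rw [QuadraticMap.polar_comm, hk2])
  -- Passing to the opposite Peirce component costs nothing: `n(x, c̄z') = n(cx, z') = n(x, z')`
  -- with `z' = z - k`, and `x` is orthogonal to `k`.
  have hxy : polar n x (compConj n e c * (z - k)) ≠ 0 := by
    rwa [← h.polar_mul_left, hx.mul_eq, QuadraticMap.polar_sub_right, hxk, sub_zero]
  -- Some part of the vector, homogeneous for the parity and for `Γ`, still pairs nontrivially with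
  -- `x`; orthogonality of the parities then forces its parity to be that of `x`.
  obtain ⟨j, hj⟩ := P.exists_proj_ne_zero (n.polarBilin x) hxy
  obtain ⟨g, hg⟩ := Γ.exists_proj_ne_zero (n.polarBilin x) hj
  obtain rfl : j = i := GroupGrading.parity_eq h hxP (hΓ.proj_mem g (P.proj_mem j _)) hg
  have hz' := IsPeirce.proj h (Γ.compConj_mem h hcΓ)
    (IsPeirce.proj (Γ := P) h (P.compConj_mem h hcP) hy j) g
  obtain ⟨y, hy_def⟩ : ∃ y, y = Γ.proj g (P.proj j (compConj n e c * (z - k))) := ⟨_, rfl⟩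
  rw [← hy_def] at hg hz'
  refine ⟨g, (polar n x y)⁻¹ • y, Submodule.smul_mem _ _ (hy_def ▸ Γ.proj_mem g _),
    Submodule.smul_mem _ _ (hy_def ▸ hΓ.proj_mem g (P.proj_mem j _)), hz'.smul _, ?_⟩
  rw [QuadraticMap.polar_smul_right, smul_eq_mul]
  exact inv_mul_cancel₀ hg

/-- It suffices to find a nonzero vector of the same parity in the opposite Peirce component, since
its homogeneous dual lies in the component of `c`. Take `c̄x` if it is nonzero; otherwise `x = cx`,
and a dual of `x` serves. -/
theorem exists_isPeirce (h : IsCompositionNorm n e) (hΓ : GroupGrading.IsSuper P Γ)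
    (hc : IsIdempotent n e c) (hcP : c ∈ P.component (Multiplicative.ofAdd 0))
    (hcΓ : c ∈ Γ.component 1) {i : Multiplicative (ZMod 2)} (hxe : polar n x e = 0)
    (hcx : polar n c x = 0) (hxP : x ∈ P.component i) (hx0 : x ≠ 0) :
    ∃ g, ∃ y ∈ Γ.component g, y ∈ P.component i ∧ IsPeirce n e c y ∧ y ≠ 0 := by
  have hc' := hc.compConj h
  have hcP' := P.compConj_mem h (g := Multiplicative.ofAdd 0) hcP
  have hcΓ' := Γ.compConj_mem h hcΓ
  have key : ∀ z ∈ P.component i, IsPeirce n e (compConj n e c) z → z ≠ 0 →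
      ∃ g, ∃ y ∈ Γ.component g, y ∈ P.component i ∧ IsPeirce n e c y ∧ y ≠ 0 := by
    intro z hzP hz hz0
    obtain ⟨g, y, hyΓ, hyP, hy, hzy⟩ := hz.exists_dual h hΓ hc' hcP' hcΓ' hzP hz0
    rw [h.compConj_compConj] at hy
    refine ⟨g, y, hyΓ, hyP, hy, ?_⟩
    rintro rfl
    exact zero_ne_one ((QuadraticMap.polar_zero_right n z).symm.trans hzy)
  have hmem : ∀ d ∈ P.component (Multiplicative.ofAdd 0), d * x ∈ P.component i := by
    intro d hd
    have h1 := P.mul_mem hd hxP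
    rwa [ofAdd_zero, one_mul] at h1
  by_cases h0 : compConj n e c * x = 0
  · have h1 := isPeirce_mul h hc hxe hcx
    have h2 : c * x = x := by
      rw [hc.compConj_eq, sub_mul, h.one_mul, sub_eq_zero] at h0
      exact h0.symm
    rw [h2] at h1
    obtain ⟨g, y, -, hyP, hy, hxy⟩ := h1.exists_dual h hΓ hc hcP hcΓ hxP hx0
    refine key y hyP hy ?_
    rintro rfl
    exact zero_ne_one ((QuadraticMap.polar_zero_right n x).symm.trans hxy)
  · exact key _ (hmem _ hcP') (isPeirce_compConj_mul h hc hxe hcx) h0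

theorem exists_isPeirce_odd (h : IsCompositionNorm n e) (hΓ : GroupGrading.IsSuper P Γ)
    (hc : IsIdempotent n e c) (hcP : c ∈ P.component (Multiplicative.ofAdd 0))
    (hcΓ : c ∈ Γ.component 1) (hxP : x ∈ P.component (Multiplicative.ofAdd 1)) (hx0 : x ≠ 0) :
    ∃ g, ∃ y ∈ Γ.component g, y ∈ P.component (Multiplicative.ofAdd 1) ∧ IsPeirce n e c y ∧
      y ≠ 0 :=
  h.exists_isPeirce hΓ hc hcP hcΓ (P.polar_unit_eq_zero h (by decide) hxP)
    (P.polar_eq_zero h (by decide) hcP hxP) hxP hx0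

/-- Normalizing an isotropic vector of nonzero trace. -/
theorem isIdempotent_smul (hx : n x = 0) (hxe : polar n x e ≠ 0) :
    IsIdempotent n e ((polar n x e)⁻¹ • x) :=
  ⟨by rw [QuadraticMap.map_smul, hx, smul_zero],
    by rw [QuadraticMap.polar_smul_left, smul_eq_mul, inv_mul_cancel₀ hxe]⟩

theorem eq_zero_of_mem_span_unit (h : IsCompositionNorm n e) (hx : x ∈ Submodule.span F {e})
    (hnx : n x = 0) : x = 0 := by
  obtain ⟨a, rfl⟩ := Submodule.mem_span_singleton.1 hx
  rw [QuadraticMap.map_smul, h.map_one, smul_eq_mul, mul_one, mul_self_eq_zero] at hnx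
  rw [hnx, zero_smul]

end Search

end IsCompositionNorm

/-! ## Refinements of gradings on composition superalgebras -/

theorem GroupGrading.refines_of_degrees {F : Type u} {A : Type v} {G : Type t} {H ι : Type*}
    [Field F] [NonUnitalNonAssocRing A] [Module F A] [Group G] [Group H]
    {Δ : GroupGrading F A H} {Γ : GroupGrading F A G} {b : ι → A} {d : ι → H} (g : ι → G)
    (hb : Submodule.span F (Set.range b) = ⊤) (hd : ∀ i, b i ∈ Δ.component (d i))
    (hg : ∀ i, b i ∈ Γ.component (g i)) (hdg : ∀ i j, d i = d j → g i = g j) :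
    Δ.Refines Γ := by
  refine refines_of_family hb hd fun k => ?_
  by_cases hk : ∃ i, d i = k
  · obtain ⟨i, rfl⟩ := hk
    exact ⟨g i, fun j hj => hdg j i hj ▸ hg j⟩
  -- No member of the family has degree `k`, so any degree serves.
  · exact ⟨1, fun j hj => absurd ⟨j, hj⟩ hk⟩

namespace IsCompositionNorm

section Refinement

variable {F : Type u} {A : Type v} {G : Type t} [Field F] [CharP F 2] [NonUnitalNonAssocRing A]
  [Module F A] [IsScalarTower F A A] [SMulCommClass F A A] [Group G] {n : QuadraticForm F A} {e : A}
  {P : GroupGrading F A (Multiplicative (ZMod 2))} {Γ : GroupGrading F A G} {c x y : A}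

theorem eq_span_of_finrank (h : IsCompositionNorm n e) {E : Submodule F A}
    (hE : Module.finrank F E = 2) {w : A} (he : e ∈ E) (hw : w ∈ E) (hwe : polar n w e ≠ 0) :
    E = Submodule.span F {e, w} := by
  have hfin : Module.Finite F E := Module.finite_of_finrank_pos (by omega)
  have hli : LinearIndependent F ![e, w] := by
    rw [LinearIndependent.pair_iff]
    intro a b hab
    exact h.coeff_eq_zero_of_polar hwe (by rw [hab]; exact QuadraticMap.polar_zero_left n _)
      (by rw [hab]; exact QuadraticMap.polar_zero_left n _)
  have hrange : Set.range ![e, w] = {e, w} := by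
    simp only [Matrix.range_cons, Matrix.range_empty, Set.union_empty, Set.singleton_union]
  rw [← hrange]
  refine (Submodule.eq_of_le_of_finrank_eq ?_ ?_).symm
  · rw [hrange, Submodule.span_le]
    rintro _ (rfl | rfl)
    exacts [he, hw]
  · rw [finrank_span_eq_card hli, hE, Fintype.card_fin]

theorem even_eq_span (h : IsCompositionNorm n e)
    (hP : Module.finrank F (P.component (Multiplicative.ofAdd 0)) = 2) {w : A}
    (hw : w ∈ P.component (Multiplicative.ofAdd 0)) (hwe : polar n w e ≠ 0) :
    P.component (Multiplicative.ofAdd 0) = Submodule.span F {e, w} :=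
  h.eq_span_of_finrank hP (P.unit_mem h) hw hwe

/-- The even part is spanned by `e` and any even element of nonzero trace, and such an element
exists in degree 1. -/
theorem even_le_component_one (h : IsCompositionNorm n e) (hΓ : GroupGrading.IsSuper P Γ)
    (hP : Module.finrank F (P.component (Multiplicative.ofAdd 0)) = 2) :
    P.component (Multiplicative.ofAdd 0) ≤ Γ.component 1 := by
  obtain ⟨w, hwP, hwΓ, hw⟩ := h.exists_polar_unit_ne_zero hΓ
  rw [h.even_eq_span hP hwP hw, Submodule.span_le]
  rintro _ (rfl | rfl)
  exacts [Γ.unit_mem h, hwΓ]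

theorem eq_zero_of_isotropic_even (h : IsCompositionNorm n e)
    (hP : Module.finrank F (P.component (Multiplicative.ofAdd 0)) = 2)
    (hx : x ∈ P.component (Multiplicative.ofAdd 0)) (hnx : n x = 0) (hxe : polar n x e = 0) :
    x = 0 := by
  obtain ⟨w, hwP, -, hw⟩ := h.exists_polar_unit_ne_zero (Γ := P)
    (GroupGrading.isSuper_of_le fun g => ⟨g, le_rfl⟩)
  rw [h.even_eq_span hP hwP hw] at hx
  exact h.eq_zero_of_mem_span_unit (h.mem_span_unit_of_polar hw hx hxe) hnx

/-- A grading on a nonsplit superalgebra of dimension four is a coarsening of the main grading. -/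
theorem main_refines (h : IsCompositionNorm n e) (hΓ : GroupGrading.IsSuper P Γ)
    (hP : Module.finrank F (P.component (Multiplicative.ofAdd 0)) = 2)
    (hP' : Module.finrank F (P.component (Multiplicative.ofAdd 1)) = 2)
    (hE : ∀ x ∈ P.component (Multiplicative.ofAdd 0), n x = 0 → x = 0)
    (hO : ∃ u ∈ P.component (Multiplicative.ofAdd 1), n u ≠ 0) : P.Refines Γ := by
  have hEΓ := h.even_le_component_one hΓ hP
  have hfin : Module.Finite F (P.component (Multiplicative.ofAdd 1)) :=
    Module.finite_of_finrank_pos (by omega)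
  obtain ⟨u, hu, hnu⟩ := hO
  have hmul : ∀ y ∈ P.component (Multiplicative.ofAdd 1), n y ≠ 0 →
      (P.component (Multiplicative.ofAdd 0)).map (LinearMap.mulRight F y) =
        P.component (Multiplicative.ofAdd 1) := fun y hy hny =>
    h.map_mulRight_eq hfin (hP.trans hP'.symm) hny fun x hx => P.mul_mem hx hy
  have hu0 : u ≠ 0 := by
    rintro rfl
    exact hnu (QuadraticMap.map_zero n)
  obtain ⟨g, hg⟩ := Γ.exists_proj_ne_zero LinearMap.id hu0
  have hgP := hΓ.proj_mem g hu
  -- The odd part is the even part times `u`, so the homogeneous part of `u` is `bu` with `b ≠ 0`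
  -- even, and `b` is anisotropic.
  have hg' : n (Γ.proj g u) ≠ 0 := by
    have h1 := hgP
    rw [← hmul u hu hnu] at h1
    obtain ⟨b, hb, hbu⟩ := h1
    rw [← hbu, LinearMap.mulRight_apply, h.map_mul]
    refine mul_ne_zero (fun hb0 => hg ?_) hnu
    rw [LinearMap.id_apply, ← hbu, hE b hb hb0, map_zero]
  intro i
  rcases ZMod.two_cases i.toAdd with hi | hi
  · exact ⟨1, by rw [← ofAdd_toAdd i, hi]; exact hEΓ⟩
  · refine ⟨g, ?_⟩
    rw [← ofAdd_toAdd i, hi, ← hmul _ hgP hg']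
    rintro _ ⟨b, hb, rfl⟩
    have h1 := Γ.mul_mem (hEΓ hb) (Γ.proj_mem g u)
    rwa [one_mul] at h1

/-- A grading on a split superalgebra of dimension four is a coarsening of a `3`-grading. -/
theorem exists_canonicalBasisFour (h : IsCompositionNorm n e) (hA : Module.finrank F A = 4)
    (hΓ : GroupGrading.IsSuper P Γ)
    (hP : Module.finrank F (P.component (Multiplicative.ofAdd 0)) = 2)
    (hx : x ∈ P.component (Multiplicative.ofAdd 0)) (hx0 : x ≠ 0) (hnx : n x = 0)
    (hy : y ∈ P.component (Multiplicative.ofAdd 1)) (hy0 : y ≠ 0) :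
    ∃ (e₁ e₂ u₁ v₁ : A) (hb : IsCanonicalBasisFour F e₁ e₂ u₁ v₁),
      (hb.grading h (hb.unit_eq h)).Refines Γ ∧ (hb.grading h (hb.unit_eq h)).Refines P ∧
      P.component (Multiplicative.ofAdd 0) = Submodule.span F {e₁, e₂} ∧
      P.component (Multiplicative.ofAdd 1) = Submodule.span F {u₁, v₁} := by
  have hxe : polar n x e ≠ 0 := fun h0 => hx0 (h.eq_zero_of_isotropic_even hP hx hnx h0)
  have hc := isIdempotent_smul hnx hxe
  have hcP := Submodule.smul_mem _ (polar n x e)⁻¹ hx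
  obtain ⟨c, hc_def⟩ : ∃ c, c = (polar n x e)⁻¹ • x := ⟨_, rfl⟩
  rw [← hc_def] at hc hcP
  have hEΓ := h.even_le_component_one hΓ hP
  have hcP' := P.compConj_mem h (g := Multiplicative.ofAdd 0) hcP
  obtain ⟨g, z, hzΓ, hzP, hz, hz0⟩ := h.exists_isPeirce_odd hΓ hc hcP (hEΓ hcP) hy hy0
  obtain ⟨k, z', hzΓ', hzP', hz', hzz⟩ := hz.exists_dual h hΓ hc hcP (hEΓ hcP) hzP hz0
  have hb := h.isCanonicalBasisFour hA hc hz hz' hzz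
  have hbP : ∀ i, ![c, compConj n e c, z, z'] i ∈ P.component
      ((![Multiplicative.ofAdd 0, Multiplicative.ofAdd 0, Multiplicative.ofAdd 1,
        Multiplicative.ofAdd 1] : Fin 4 → Multiplicative (ZMod 2)) i) := by
    intro i
    fin_cases i
    exacts [hcP, hcP', hzP, hzP']
  refine ⟨c, compConj n e c, z, z', hb, ?_, ?_, ?_, ?_⟩
  · refine GroupGrading.refines_of_degrees ![1, 1, g, k] hb.range_eq_top
      (hb.mem_grading_component h _) (fun i => ?_) fun i j => ?_
    · fin_cases i
      exacts [hEΓ hcP, hEΓ hcP', hzΓ, hzΓ']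
    · fin_cases i <;> fin_cases j <;> intro hij <;> first | rfl | exact absurd hij (by decide)
  · refine GroupGrading.refines_of_degrees _ hb.range_eq_top
      (hb.mem_grading_component h _) hbP fun i j => ?_
    fin_cases i <;> fin_cases j <;> intro hij <;> first | rfl | exact absurd hij (by decide)
  · rw [P.component_eq_span hb.range_eq_top hbP]
    congr 1
    ext a
    simp [-ofAdd_zero, Fin.exists_fin_succ, eq_comm]
  · rw [P.component_eq_span hb.range_eq_top hbP]
    congr 1
    ext a
    simp [-ofAdd_zero, Fin.exists_fin_succ, eq_comm]

theorem exists_not_mem_span_pair {E : Submodule F A} (hE : Module.finrank F E = 4) (x y : A) :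
    ∃ z ∈ E, z ∉ Submodule.span F {x, y} := by
  by_contra! h0
  have hfin : Module.Finite F (Submodule.span F {x, y}) :=
    Module.Finite.span_of_finite F (Set.toFinite _)
  have h1 : Module.finrank F E ≤ Module.finrank F (Submodule.span F {x, y}) :=
    Submodule.finrank_mono h0
  have h2 : Module.finrank F (Submodule.span F {x, y}) ≤ 2 := by
    classical
    have h3 := finrank_span_finset_le_card (R := F) ({x, y} : Finset A)
    rw [Finset.coe_pair] at h3
    exact h3.trans Finset.card_le_two
  omega

/-- A grading with a neutral even isotropic element of nonzero trace is a coarsening of a Cartan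
grading. -/
theorem exists_canonicalBasisEight (h : IsCompositionNorm n e) (hA : Module.finrank F A = 8)
    (hΓ : GroupGrading.IsSuper P Γ)
    (hP : Module.finrank F (P.component (Multiplicative.ofAdd 0)) = 4)
    (hx : x ∈ P.component (Multiplicative.ofAdd 0)) (hxΓ : x ∈ Γ.component 1)
    (hxe : polar n x e ≠ 0) (hnx : n x = 0)
    (hy : y ∈ P.component (Multiplicative.ofAdd 1)) (hy0 : y ≠ 0) :
    ∃ (e₁ e₂ : A) (u v : Fin 3 → A) (hb : IsCanonicalBasisEight F e₁ e₂ u v),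
      (hb.grading h (hb.unit_eq h)).Refines Γ ∧ (hb.grading h (hb.unit_eq h)).Refines P ∧
      P.component (Multiplicative.ofAdd 0) = Submodule.span F {e₁, e₂, u 2, v 2} ∧
      P.component (Multiplicative.ofAdd 1) = Submodule.span F {u 0, u 1, v 0, v 1} := by
  have hc := isIdempotent_smul hnx hxe
  have hcP := Submodule.smul_mem _ (polar n x e)⁻¹ hx
  have hcΓ := Submodule.smul_mem _ (polar n x e)⁻¹ hxΓ
  obtain ⟨c, hc_def⟩ : ∃ c, c = (polar n x e)⁻¹ • x := ⟨_, rfl⟩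
  rw [← hc_def] at hc hcP hcΓ
  have hc' := hc.compConj h
  have hcP' := P.compConj_mem h (g := Multiplicative.ofAdd 0) hcP
  have hcΓ' := Γ.compConj_mem h hcΓ
  -- The even part has dimension 4, so it has a nonzero vector orthogonal to `e` and `c`; this
  -- produces the even basis vector `u₂`.
  obtain ⟨z, hzP, hz⟩ := exists_not_mem_span_pair hP e c
  obtain ⟨k, hk, hzk, hzk'⟩ := h.exists_sub_orthogonal (w := c)
    (by rw [hc.polar_unit]; exact one_ne_zero) z
  have hkP : k ∈ P.component (Multiplicative.ofAdd 0) := by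
    refine (Submodule.span_le.2 ?_ : Submodule.span F {e, c} ≤ _) hk
    rintro _ (rfl | rfl)
    exacts [P.unit_mem h, hcP]
  have hzk0 : z - k ≠ 0 := fun h0 => hz (sub_eq_zero.1 h0 ▸ hk)
  obtain ⟨g₂, u₂, hu₂Γ, hu₂P, hu₂, hu₂0⟩ := h.exists_isPeirce hΓ hc hcP hcΓ hzk
    (by rw [QuadraticMap.polar_comm, hzk']) (sub_mem hzP hkP) hzk0
  obtain ⟨g₀, u₀, hu₀Γ, hu₀P, hu₀, hu₀0⟩ := h.exists_isPeirce_odd hΓ hc hcP hcΓ hy hy0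
  obtain ⟨-, v, -, hvP, hv, hu₂v⟩ := hu₂.exists_dual h hΓ hc hcP hcΓ hu₂P hu₂0
  -- For the even dual `v` of `u₂`, `left_linearized` gives `u₀ = -(v(u₂u₀)) - u₂(vu₀)`, and `vu₀ =
  -- 0` because `v` and `u₀` have different parities and are orthogonal.
  have hne : u₂ * u₀ ≠ 0 := by
    intro h0
    have h1 := h.left_linearized v u₂ u₀
    rw [compConj_of_polar_eq_zero hu₂.polar_unit, compConj_of_polar_eq_zero hv.polar_unit,
      neg_mul, neg_mul, h0, hu₀.dual_mul h hc hv, P.polar_eq_zero h (by decide) hu₀P hvP, zero_smul,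
      neg_zero, neg_zero, mul_zero, mul_zero, add_zero, QuadraticMap.polar_comm, hu₂v,
      one_smul] at h1
    exact hu₀0 h1.symm
  -- The third vector is a homogeneous dual of the odd product `u₂u₀`; cyclicity turns `n(u₂u₀,u₁) =
  -- 1` into the required normalization.
  obtain ⟨g₁, u₁, hu₁Γ, hu₁P, hu₁, hu⟩ := (hu₂.mul h hc hu₀).exists_dual h hΓ hc' hcP' hcΓ'
    (i := Multiplicative.ofAdd 1) (P.mul_mem hu₂P hu₀P) hne
  rw [h.compConj_compConj] at hu₁
  rw [hu₀.polar_mul_cycle h hc hu₁] at hu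
  have hpeirce : ∀ i, IsPeirce n e c (![u₀, u₁, u₂] i) := by
    intro i
    fin_cases i
    exacts [hu₀, hu₁, hu₂]
  have hb := h.isCanonicalBasisEight hA hc hpeirce hu
  have hbP : ∀ i, ![c, compConj n e c, u₀, u₁, u₂, u₁ * u₂, u₂ * u₀, u₀ * u₁] i ∈ P.component
      ((![Multiplicative.ofAdd 0, Multiplicative.ofAdd 0, Multiplicative.ofAdd 1,
        Multiplicative.ofAdd 1, Multiplicative.ofAdd 0, Multiplicative.ofAdd 1,
        Multiplicative.ofAdd 1, Multiplicative.ofAdd 0] : Fin 8 → Multiplicative (ZMod 2)) i) := by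
    intro i
    fin_cases i
    exacts [hcP, hcP', hu₀P, hu₁P, hu₂P, P.mul_mem hu₁P hu₂P, P.mul_mem hu₂P hu₀P,
      P.mul_mem hu₀P hu₁P]
  have hbΓ : ∀ i, ![c, compConj n e c, u₀, u₁, u₂, u₁ * u₂, u₂ * u₀, u₀ * u₁] i ∈ Γ.component
      (![1, 1, g₀, g₁, g₂, g₁ * g₂, g₂ * g₀, g₀ * g₁] i) := by
    intro i
    fin_cases i
    exacts [hcΓ, hcΓ', hu₀Γ, hu₁Γ, hu₂Γ, Γ.mul_mem hu₁Γ hu₂Γ, Γ.mul_mem hu₂Γ hu₀Γ,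
      Γ.mul_mem hu₀Γ hu₁Γ]
  refine ⟨c, compConj n e c, _, _, hb, ?_, ?_, ?_, ?_⟩
  · refine GroupGrading.refines_of_degrees _ hb.range_eq_top
      (hb.mem_grading_component h _) hbΓ fun i j => ?_
    fin_cases i <;> fin_cases j <;> intro hij <;> first | rfl | exact absurd hij (by decide)
  · refine GroupGrading.refines_of_degrees _ hb.range_eq_top
      (hb.mem_grading_component h _) hbP fun i j => ?_
    fin_cases i <;> fin_cases j <;> intro hij <;> first | rfl | exact absurd hij (by decide)
  · rw [P.component_eq_span hb.range_eq_top hbP]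
    congr 1
    ext a
    simp [-ofAdd_zero, Fin.exists_fin_succ, eq_comm]
  · rw [P.component_eq_span hb.range_eq_top hbP]
    congr 1
    ext a
    simp [-ofAdd_zero, Fin.exists_fin_succ, eq_comm]

/-- A grading without neutral even isotropic elements of nonzero trace is a coarsening of a
doubling grading. -/
theorem exists_doublingTriple (h : IsCompositionNorm n e) (hΓ : GroupGrading.IsSuper P Γ)
    (hP : Module.finrank F (P.component (Multiplicative.ofAdd 0)) = 4)
    (hP' : Module.finrank F (P.component (Multiplicative.ofAdd 1)) = 4)
    (hiso : ∀ x ∈ P.component (Multiplicative.ofAdd 0), x ∈ Γ.component 1 → n x = 0 →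
      polar n x e = 0)
    (hy : y ∈ P.component (Multiplicative.ofAdd 1)) (hy0 : y ≠ 0) :
    ∃ (w v u : A) (ht : IsDoublingTriple n e P w v u), (ht.grading h).Refines Γ ∧
      ∀ x ∈ Submodule.span F {e, w}, n x = 0 → x = 0 := by
  obtain ⟨w, hwP, hwΓ, hw⟩ := h.exists_polar_unit_ne_zero hΓ
  have hKP : Submodule.span F {e, w} ≤ P.component (Multiplicative.ofAdd 0) := by
    rw [Submodule.span_le]
    rintro _ (rfl | rfl)
    exacts [P.unit_mem h, hwP]
  have hKΓ : Submodule.span F {e, w} ≤ Γ.component 1 := by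
    rw [Submodule.span_le]
    rintro _ (rfl | rfl)
    exacts [Γ.unit_mem h, hwΓ]
  -- An isotropic element of `K` is even and neutral, so it has trace zero and is a multiple of `e`;
  -- as `n(ae) = a²`, it is zero.
  have hK : ∀ x ∈ Submodule.span F {e, w}, n x = 0 → x = 0 := fun x hx hnx =>
    h.eq_zero_of_mem_span_unit (h.mem_span_unit_of_polar hw hx
      (hiso x (hKP hx) (hKΓ hx) hnx)) hnx
  obtain ⟨a, v, hvΓ, hvP, hv0, hve, hvw⟩ : ∃ a, ∃ v ∈ Γ.component a,
      v ∈ P.component (Multiplicative.ofAdd 0) ∧ v ≠ 0 ∧ polar n v e = 0 ∧ polar n v w = 0 := by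
    obtain ⟨z, hzP, hz⟩ := exists_not_mem_span_pair hP e w
    obtain ⟨a, ha⟩ : ∃ a, Γ.proj a z ∉ Submodule.span F {e, w} := by
      by_contra! h0
      exact hz (Γ.mem_of_proj_mem h0)
    have haP := hΓ.proj_mem a hzP
    -- A part of degree other than 1 is automatically orthogonal to `K`; in degree 1 its component
    -- in `K` is subtracted.
    by_cases ha1 : a = 1
    · subst ha1
      obtain ⟨k, hk, hk1, hk2⟩ := h.exists_sub_orthogonal hw (Γ.proj 1 z)
      exact ⟨1, _, sub_mem (Γ.proj_mem 1 z) (hKΓ hk), sub_mem haP (hKP hk),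
        fun h0 => ha (sub_eq_zero.1 h0 ▸ hk), hk1, hk2⟩
    · refine ⟨a, _, Γ.proj_mem a z, haP, fun h0 => ha (h0 ▸ zero_mem _),
        Γ.polar_unit_eq_zero h ha1 (Γ.proj_mem a z),
        Γ.polar_eq_zero h (by rwa [mul_one]) (Γ.proj_mem a z) hwΓ⟩
  -- If `v` were isotropic, then `n(kv,v) = t(k)n(v) = 0` would make it orthogonal to `K + Kv`, the
  -- whole even part, and hence to everything.
  have hnv : n v ≠ 0 := by
    intro hnv
    have h1 := h.le_sup_map_mulRight hP (fun hx hy => P.mul_mem hx hy) (P.unit_mem h) hwP hvP hw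
      hve hvw fun k hk hkv => hK k hk (by
        by_contra hnk
        exact hv0 (h.eq_zero_of_mul_left_eq_zero hnk hkv))
    have hker : P.component (Multiplicative.ofAdd 0) ≤ LinearMap.ker (n.polarBilin.flip v) := by
      refine h1.trans (sup_le ?_ ?_)
      · exact fun k hk => (h.isDoubling_span hve hvw).polar_eq_zero hk
      · rintro _ ⟨k, hk, rfl⟩
        exact (h.polar_mul_self v k).trans (by rw [hnv, mul_zero])
    obtain ⟨z, hz⟩ := h.exists_polar_ne_zero hv0
    obtain ⟨i, hi⟩ := P.exists_proj_ne_zero (n.polarBilin v) hz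
    obtain rfl : i = Multiplicative.ofAdd 0 := GroupGrading.parity_eq h hvP (P.proj_mem i z) hi
    exact hi ((QuadraticMap.polar_comm n _ _).trans (hker (P.proj_mem _ z)))
  obtain ⟨b, u, huΓ, huP, hnu⟩ : ∃ b, ∃ u ∈ Γ.component b,
      u ∈ P.component (Multiplicative.ofAdd 1) ∧ n u ≠ 0 := by
    -- Choose homogeneous odd parts `y'`, `z'` with `n(y',z') ≠ 0`; their degrees are inverse. If
    -- `z'` is isotropic, `y'z'` is an even neutral isotropic element of trace `-n(y',z') ≠ 0`,
    -- against `hiso`.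
    by_contra! h0
    obtain ⟨z, hz⟩ := h.exists_polar_ne_zero hy0
    obtain ⟨i, hi⟩ := P.exists_proj_ne_zero (n.polarBilin y) hz
    obtain ⟨b, hb⟩ := Γ.exists_proj_ne_zero (n.polarBilin y) hi
    obtain rfl : i = Multiplicative.ofAdd 1 :=
      GroupGrading.parity_eq h hy (hΓ.proj_mem b (P.proj_mem i z)) hb
    obtain ⟨a, ha⟩ := Γ.exists_proj_ne_zero (n.polarBilin.flip
      (Γ.proj b (P.proj (Multiplicative.ofAdd 1) z))) hb
    have hzP := hΓ.proj_mem b (P.proj_mem (Multiplicative.ofAdd 1) z)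
    have hzΓ := Γ.proj_mem b (P.proj (Multiplicative.ofAdd 1) z)
    obtain ⟨z', hz'⟩ : ∃ z', z' = Γ.proj b (P.proj (Multiplicative.ofAdd 1) z) := ⟨_, rfl⟩
    rw [← hz'] at ha hzP hzΓ
    change polar n (Γ.proj a y) z' ≠ 0 at ha
    have hyΓ := Γ.proj_mem a y
    have hab : a * b = 1 := by
      by_contra hab
      exact ha (Γ.polar_eq_zero h hab hyΓ hzΓ)
    have h1 : Γ.proj a y * z' ∈ P.component (Multiplicative.ofAdd 0) :=
      P.mul_mem (hΓ.proj_mem a hy) hzP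
    have h2 := hiso _ h1 (hab ▸ Γ.mul_mem hyΓ hzΓ) (by rw [h.map_mul, h0 b z' hzΓ hzP, mul_zero])
    rw [h.polar_mul_right, h.one_mul, compConj_of_polar_eq_zero
      (P.polar_unit_eq_zero h (by decide) hzP), QuadraticMap.polar_neg_right, neg_eq_zero] at h2
    exact ha h2
  have ht : IsDoublingTriple n e P w v u := ⟨hP, hP', hwP, hvP, huP, hw, hve, hvw, hnv, hnu⟩
  refine ⟨w, v, u, ht, ?_, hK⟩
  obtain ⟨h1, h2, h3, h4⟩ := ht.grading_component h
  have hmul : ∀ g, ∀ z ∈ Γ.component g,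
      (Submodule.span F {e, w}).map (LinearMap.mulRight F z) ≤ Γ.component g := by
    rintro g z hz _ ⟨k, hk, rfl⟩
    have h5 := Γ.mul_mem (hKΓ hk) hz
    rwa [one_mul] at h5
  rintro ⟨i, j⟩
  rcases ZMod.two_cases i with rfl | rfl <;> rcases ZMod.two_cases j with rfl | rfl
  · exact ⟨1, h1.trans_le hKΓ⟩
  · exact ⟨b, h3.trans_le (hmul b u huΓ)⟩
  · exact ⟨a, h2.trans_le (hmul a v hvΓ)⟩
  · exact ⟨a * b, h4.trans_le (hmul _ _ (Γ.mul_mem hvΓ huΓ))⟩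

end Refinement

end IsCompositionNorm

/-! ## Hurwitz algebras and their doubles are composition algebras -/

namespace IsCompositionNorm

variable {F : Type u} {A : Type v} [Field F] [NonUnitalNonAssocRing A] [Module F A]
  [IsScalarTower F A A] [SMulCommClass F A A] {n : QuadraticForm F A} {e : A}

/-- The double of a commutative associative algebra is associative. -/
theorem IsDoubling.mul_assoc (h : IsCompositionNorm n e) {B : Submodule F A} {z : A}
    (hB : IsDoubling n e B z) (hcomm : ∀ x ∈ B, ∀ y ∈ B, x * y = y * x)
    (hassoc : ∀ x ∈ B, ∀ y ∈ B, ∀ w ∈ B, x * y * w = x * (y * w))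
    (htop : ⊤ ≤ B ⊔ B.map (LinearMap.mulRight F z)) (x y w : A) : x * y * w = x * (y * w) := by
  have hex : ∀ x, ∃ a ∈ B, ∃ b ∈ B, x = a + b * z := fun x => by
    obtain ⟨a, ha, _, ⟨b, hb, rfl⟩, hab⟩ := Submodule.mem_sup.1 (htop (x := x) trivial)
    exact ⟨a, ha, b, hb, hab.symm⟩
  obtain ⟨a, ha, b, hb, rfl⟩ := hex x
  obtain ⟨c, hc, d, hd, rfl⟩ := hex y
  obtain ⟨f, hf, g, hg, rfl⟩ := hex w
  have hm := fun {x y} => @hB.mul_mem x y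
  have hj := fun {x} => @IsDoubling.compConj_mem _ _ _ _ _ _ _ _ _ _ x z hB
  -- The associator of three sums has eight terms: one inside `B`, and the seven below, which the
  -- doubling rules reduce to identities in `B`.
  have h1 : a * c * (g * z) = a * (c * (g * z)) := by
    rw [hB.mul_double h (hm ha hc) hg, hB.mul_double h hc hg, hB.mul_double h ha (hm hg hc),
      hassoc g hg c hc a ha, hcomm a ha c hc]
  have h2 : a * (d * z) * f = a * (d * z * f) := by
    rw [hB.mul_double h ha hd, hB.double_mul h hf, hB.double_mul h hf,
      hB.mul_double h ha (hm hd (hj hf)), hassoc d hd a ha _ (hj hf), hassoc d hd _ (hj hf) a ha,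
      hcomm a ha _ (hj hf)]
  have h3 : a * (d * z) * (g * z) = a * (d * z * (g * z)) := by
    rw [hB.mul_double h ha hd, hB.double_mul_double h (hm hd ha) hg, hB.double_mul_double h hd hg,
      mul_neg, mul_smul_comm, ← hassoc _ (hj hg) d hd a ha, hcomm a ha _ (hm (hj hg) hd)]
  have h4 : b * z * c * f = b * z * (c * f) := by
    rw [hB.double_mul h hc, hB.double_mul h hf, hB.double_mul h (hm hc hf), h.compConj_mul,
      hassoc b hb _ (hj hc) _ (hj hf), hcomm _ (hj hc) _ (hj hf)]
  have h5 : b * z * c * (g * z) = b * z * (c * (g * z)) := by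
    rw [hB.double_mul h hc, hB.double_mul_double h (hm hb (hj hc)) hg, hB.mul_double h hc hg,
      hB.double_mul_double h hb (hm hg hc), h.compConj_mul, hcomm _ (hj hc) _ (hj hg),
      hassoc _ (hj hg) _ (hj hc) b hb, hcomm b hb _ (hj hc)]
  have h6 : b * z * (d * z) * f = b * z * (d * z * f) := by
    rw [hB.double_mul_double h hb hd, hB.double_mul h hf,
      hB.double_mul_double h hb (hm hd (hj hf)), h.compConj_mul, h.compConj_compConj, neg_mul,
      smul_mul_assoc, hcomm _ (hm (hj hd) hb) f hf, hassoc f hf _ (hj hd) b hb]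
  have h7 : b * z * (d * z) * (g * z) = b * z * (d * z * (g * z)) := by
    rw [hB.double_mul_double h hb hd, hB.double_mul_double h hd hg, neg_mul, mul_neg,
      smul_mul_assoc, mul_smul_comm, hB.mul_double h (hm (hj hd) hb) hg,
      hB.double_mul h (hm (hj hg) hd), h.compConj_mul, h.compConj_compConj,
      hcomm g hg _ (hm (hj hd) hb), hcomm _ (hj hd) b hb, hassoc b hb _ (hj hd) g hg]
  simp only [mul_add, add_mul, hassoc a ha c hc f hf, h1, h2, h3, h4, h5, h6, h7]

/-- In dimension 2 the algebra is `Fe + Fw`, and in dimension 4 it is a double of this commutative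
associative subalgebra by an anisotropic vector. Associativity of `Q` is what makes the norm of its
double multiplicative. -/
theorem mul_assoc_of_finrank [CharP F 2] (h : IsCompositionNorm n e)
    (hA : Module.finrank F A = 2 ∨ Module.finrank F A = 4) (x y z : A) :
    x * y * z = x * (y * z) := by
  obtain ⟨w, hw⟩ := h.exists_polar_ne_zero h.unit_ne_zero
  rw [QuadraticMap.polar_comm] at hw
  rcases hA with hA | hA
  · have h1 := h.eq_span_of_finrank (E := ⊤) (by rw [finrank_top, hA]) (w := w) trivial trivial hw
    exact h.mul_assoc_span_unit (w := w) (by rw [← h1]; trivial) (by rw [← h1]; trivial)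
      (by rw [← h1]; trivial)
  · have hA' : Module.finrank F (⊤ : Submodule F A) = 4 := by rw [finrank_top, hA]
    obtain ⟨v, hv, hve, hvw⟩ : ∃ v, n v ≠ 0 ∧ polar n v e = 0 ∧ polar n v w = 0 := by
      -- If the complement of `Fe + Fw` were totally isotropic, the polar form would vanish on it,
      -- and its nonzero vectors would be orthogonal to the whole algebra.
      by_contra! h0
      obtain ⟨z, -, hz⟩ := exists_not_mem_span_pair hA' e w
      obtain ⟨k, hk, hk1, hk2⟩ := h.exists_sub_orthogonal hw z
      have hz0 : z - k ≠ 0 := fun h1 => hz (sub_eq_zero.1 h1 ▸ hk)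
      obtain ⟨y, hy⟩ := h.exists_polar_ne_zero hz0
      obtain ⟨l, hl, hl1, hl2⟩ := h.exists_sub_orthogonal hw y
      have h1 : polar n (z - k) l = 0 := by
        rw [QuadraticMap.polar_comm]
        exact (h.isDoubling_span hk1 hk2).polar_eq_zero hl
      have h2 : ∀ x, polar n x e = 0 → polar n x w = 0 → n x = 0 := fun x hx hx' => by
        by_contra hnx
        exact h0 x hnx hx hx'
      refine hy ?_
      have h3 := QuadraticMap.polar_sub_right (Q := n) (z - k) y l
      rw [h1, sub_zero] at h3
      rw [← h3, QuadraticMap.polar, h2 _ hk1 hk2, h2 _ hl1 hl2, h2 (z - k + (y - l)), sub_zero,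
        sub_zero]
      · rw [QuadraticMap.polar_add_left, hk1, hl1, add_zero]
      · rw [QuadraticMap.polar_add_left, hk2, hl2, add_zero]
    exact (h.isDoubling_span hve hvw).mul_assoc h (fun _ hx _ hy => h.mul_comm_span_unit hx hy)
      (fun _ hx _ hy _ hz => h.mul_assoc_span_unit hx hy hz)
      (h.le_sup_map_mulRight hA' (fun _ _ => trivial) trivial trivial trivial hw hve hvw
        fun k _ hk => h.eq_zero_of_mul_right_eq_zero hv hk) x y z

end IsCompositionNorm

namespace CD

variable {F : Type u} {Q : Type v} [Field F] [NonAssocRing Q] [Module F Q]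
  {q : QuadraticForm F Q} {α : F}

theorem mainGrading_zero : (mainGrading q α).component (Multiplicative.ofAdd 0) = even q α :=
  mainComponent_of_eq q α rfl

theorem mainGrading_one : (mainGrading q α).component (Multiplicative.ofAdd 1) = odd q α :=
  mainComponent_of_ne q α (i := Multiplicative.ofAdd 1) (by decide)

theorem finrank_even : Module.finrank F (even q α) = Module.finrank F Q :=
  LinearMap.finrank_range_of_inj (f := incl q α) LinearMap.inl_injective

theorem finrank_odd : Module.finrank F (odd q α) = Module.finrank F Q :=
  LinearMap.finrank_range_of_inj (f := inclU q α) LinearMap.inr_injective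

theorem finrank_eq [Module.Finite F Q] :
    Module.finrank F (CD q α) = Module.finrank F Q + Module.finrank F Q :=
  Module.finrank_prod

end CD

section Hurwitz

variable {F : Type u} {Q : Type v} [Field F] [NonAssocRing Q] [Module F Q] [IsScalarTower F Q Q]
  [SMulCommClass F Q Q] {q : QuadraticForm F Q}

/-- Regularity alone allows a one-dimensional radical of the polar form. A nonzero `r` in it would
have `q(r) ≠ 0`, and right multiplication by `r` would embed `Q` in this radical, so dimension at
least 2 excludes it. -/
theorem IsHurwitzNorm.isCompositionNorm (hq : IsHurwitzNorm q) (hQ : 2 ≤ Module.finrank F Q) :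
    IsCompositionNorm q (1 : Q) := by
  have hrad : ∀ x, q x = 0 → (∀ y, polar q x y = 0) → x = 0 := by
    intro x hx hxy
    have h1 : x ∈ q.radical := ⟨hx, LinearMap.ext hxy⟩
    rw [hq.regular.radical_eq_bot] at h1
    exact h1
  have : Nontrivial Q := Module.nontrivial_of_finrank_pos (R := F) (by omega)
  refine ⟨one_mul, mul_one, ?_, hq.map_mul, ?_⟩
  · obtain ⟨x, hx⟩ : ∃ x, q x ≠ 0 := by
      by_contra! h0
      exact one_ne_zero (hrad 1 (h0 1) fun y => by simp [polar, h0])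
    have h1 := hq.map_mul x 1
    rw [mul_one] at h1
    exact mul_left_cancel₀ hx (h1.symm.trans (mul_one _).symm)
  · intro r hr
    by_contra hr0
    have hqr : q r ≠ 0 := fun h0 => hr0 (hrad r h0 hr)
    have hmem : ∀ x, LinearMap.mulRight F r x ∈ LinearMap.ker q.polarBilin := by
      intro x
      rw [LinearMap.mem_ker]
      refine LinearMap.ext fun y => ?_
      have h1 := QuadraticForm.polar_mul_mul_add hq.map_mul x r 1 y
      rw [one_mul, one_mul, hr, hr, mul_zero, add_zero] at h1
      exact h1
    have hinj : Function.Injective ((LinearMap.mulRight F r).codRestrict _ hmem) := by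
      rw [← LinearMap.ker_eq_bot, LinearMap.ker_eq_bot']
      intro x hx
      have hxr : x * r = 0 := congrArg Subtype.val hx
      refine hrad x ?_ fun y => ?_
      · have h1 := hq.map_mul x r
        rw [hxr, QuadraticMap.map_zero] at h1
        exact (mul_eq_zero.1 h1.symm).resolve_right hqr
      · have h1 := QuadraticForm.polar_mul_mul_right hq.map_mul r x y
        rw [hxr, QuadraticMap.polar_zero_left] at h1
        exact (mul_eq_zero.1 h1.symm).resolve_right hqr
    have h1 := (LinearMap.rank_le_of_injective _ hinj).trans hq.regular.rank_rad_polar_le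
    have h2 : Module.finrank F Q ≤ 1 := Module.finrank_le_of_rank_le (by exact_mod_cast h1)
    omega

namespace CD

variable {α : F}

theorem hurwitzConj_eq (x : Q) : hurwitzConj q x = compConj q 1 x := rfl

theorem polar_norm (x y : CD q α) :
    polar (norm q α) x y = polar q x.1 y.1 + α * polar q x.2 y.2 := by
  simp only [polar, norm_apply, fst_add, snd_add]
  ring

theorem isCompositionNorm (h : IsCompositionNorm q (1 : Q))
    (hassoc : ∀ x y z : Q, x * y * z = x * (y * z)) (hα : α ≠ 0) :
    IsCompositionNorm (norm q α) (incl q α 1) := by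
  have h1 : (incl q α 1 : CD q α).1 = 1 := rfl
  have h2 : (incl q α 1 : CD q α).2 = 0 := rfl
  refine ⟨fun x => ?_, fun x => ?_, ?_, fun x y => ?_, fun x hx => ?_⟩
  · ext <;> simp [h1, h2]
  · have h3 : compConj q 1 (0 : Q) = 0 := by simp [compConj]
    ext <;> simp [h1, h2, hurwitzConj_eq, h.compConj_unit, h3]
  · rw [norm_apply, h1, h2, h.map_one, QuadraticMap.map_zero, mul_zero, add_zero]
  · have h3 : polar q (x.1 * y.1) (compConj q 1 y.2 * x.2) =
        polar q (y.2 * x.1) (x.2 * compConj q 1 y.1) := by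
      rw [h.polar_mul_left y.2, h.polar_mul_right x.1, hassoc]
    rw [norm_apply, norm_apply, norm_apply, fst_mul, snd_mul, hurwitzConj_eq, hurwitzConj_eq,
      sub_eq_add_neg, QuadraticMap.map_add q, QuadraticMap.map_add q, QuadraticMap.map_neg,
      QuadraticMap.polar_neg_right, QuadraticMap.map_smul, QuadraticMap.polar_smul_right, h3,
      h.map_mul, h.map_mul, h.map_mul, h.map_mul, h.map_compConj, h.map_compConj, smul_eq_mul,
      smul_eq_mul]
    ring
  · simp only [polar_norm] at hx
    refine ext (h.eq_zero_of_polar _ fun y => ?_) (h.eq_zero_of_polar _ fun y => ?_)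
    · have h3 := hx (incl q α y)
      change polar q x.1 y + α * polar q x.2 0 = 0 at h3
      rwa [QuadraticMap.polar_zero_right, mul_zero, add_zero] at h3
    · have h3 := hx (inclU q α y)
      change polar q x.1 0 + α * polar q x.2 y = 0 at h3
      rw [QuadraticMap.polar_zero_right, zero_add] at h3
      exact (mul_eq_zero.1 h3).resolve_left hα

end CD

end Hurwitz

/-! ## The classification -/

namespace GroupGrading

variable {F : Type u} {A : Type v} {G : Type t} [Field F] [CharP F 2] [NonUnitalNonAssocRing A]
  [Module F A] [IsScalarTower F A A] [SMulCommClass F A A] [Group G] {n : QuadraticForm F A} {e : A}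
  {P : GroupGrading F A (Multiplicative (ZMod 2))} {Γ : GroupGrading F A G}

/-- A grading with one-dimensional components and a neutral component spanned by two orthogonal
idempotents is fine. -/
theorem isFine_of_degrees (h : IsCompositionNorm n e) {ι : Type*} {b : ι → A} {d : ι → G}
    (hb : Submodule.span F (Set.range b) = ⊤) (hd : ∀ i, b i ∈ Γ.component (d i)) {c c' : A}
    (hc : c ≠ 0) (hc' : c' ≠ 0) (hcc : c * c = c) (hcc' : c' * c' = c') (h0 : c * c' = 0)
    (h0' : c' * c = 0) (he : e = c + c') (h1 : Γ.component 1 = Submodule.span F {c, c'})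
    (hdim : ∀ i, d i ≠ 1 → ∃ x, Γ.component (d i) = Submodule.span F {x}) :
    IsFine.{w, u, v, t} P Γ := by
  intro H _ Δ _ hΔ
  refine hΔ.symm_of_composition h (fun x hx hxe => ?_) fun g hg => .inl ?_
  · rw [h1] at hx
    exact IsCompositionNorm.mem_span_unit (h.isIdempotent_of_orthogonal hc hc' hcc h0)
      (h.isIdempotent_of_orthogonal hc' hc hcc' h0') he hx hxe
  · by_cases hgd : ∃ i, d i = g
    · obtain ⟨i, rfl⟩ := hgd
      obtain ⟨x, hx⟩ := hdim i hg
      exact ⟨x, hx.le⟩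
    · push Not at hgd
      exact ⟨0, (Γ.component_eq_bot hb hd hgd).trans_le bot_le⟩

end GroupGrading

/-! ### The listed gradings are fine -/

namespace CD

variable {F : Type u} [Field F] [CharP F 2] {Q : Type v} [NonAssocRing Q] [Module F Q]
  [IsScalarTower F Q Q] [SMulCommClass F Q Q] {q : QuadraticForm F Q} {α : F} {G : Type t} [Group G]
  {Γ : GroupGrading F (CD q α) G}

theorem isFine_of_isMainGrading (h : IsCompositionNorm (norm q α) (incl q α 1)) (hα : α ≠ 0)
    (hQ : Module.finrank F Q = 2) (hns : ¬ IsSplitNorm q) (hΓ : IsMainGrading Γ) :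
    GroupGrading.IsFine.{w, u, v, t} (mainGrading q α) Γ := by
  obtain ⟨φ, hφ⟩ := hΓ
  intro H _ Δ _ hΔ
  refine hΔ.symm_of_composition h (fun x hx hxe => ?_) fun g hg => .inr fun x hx hnx => ?_
  · have h1 := hφ (Multiplicative.ofAdd 0)
    rw [ofAdd_zero, map_one] at h1
    obtain ⟨w, hwP, -, hw⟩ := h.exists_polar_unit_ne_zero (P := mainGrading q α)
      (GroupGrading.isSuper_of_le (Γ := mainGrading q α) fun g => ⟨g, le_rfl⟩)
    rw [h1] at hx
    refine h.mem_span_unit_of_polar hw ?_ hxe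
    rw [← h.even_eq_span (by rw [mainGrading_zero, finrank_even, hQ]) hwP hw]
    exact hx
  · have hg1 : φ g ≠ 1 := fun h0 => hg (φ.map_eq_one_iff.1 h0)
    have h2 : ∀ i : Multiplicative (ZMod 2), i ≠ 1 → i = Multiplicative.ofAdd 1 := by decide
    have h1 := hφ (φ g)
    rw [φ.symm_apply_apply, h2 _ hg1, mainGrading_one] at h1
    rw [h1, mem_odd] at hx
    rw [norm_apply, hx, QuadraticMap.map_zero, zero_add] at hnx
    have h3 : x.2 = 0 := by
      by_contra h0
      exact hns ⟨x.2, h0, (mul_eq_zero.1 hnx).resolve_left hα⟩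
    exact ext hx h3

theorem isFine_of_isThreeGrading (h : IsCompositionNorm (norm q α) (incl q α 1))
    (hΓ : IsThreeGrading Γ) : GroupGrading.IsFine.{w, u, v, t} (mainGrading q α) Γ := by
  obtain ⟨φ, e₁, e₂, u₁, v₁, hb, -, -, h0, h1, h2⟩ := hΓ
  have hne := hb.linearIndependent.ne_zero
  have h0' := h0
  rw [ofAdd_zero, map_one] at h0'
  refine GroupGrading.isFine_of_degrees h (b := ![e₁, e₂, u₁, v₁])
    (d := ![φ.symm (Multiplicative.ofAdd 0), φ.symm (Multiplicative.ofAdd 0),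
      φ.symm (Multiplicative.ofAdd 1), φ.symm (Multiplicative.ofAdd (-1))])
    hb.range_eq_top ?_ (hne 0) (hne 1) hb.e₁_e₁ hb.e₂_e₂ hb.e₁_e₂ hb.e₂_e₁ (hb.unit_eq h) h0' ?_
  · intro i
    fin_cases i
    · exact h0.symm ▸ Submodule.subset_span (by simp)
    · exact h0.symm ▸ Submodule.subset_span (by simp)
    · exact h1.symm ▸ Submodule.subset_span (by simp)
    · exact h2.symm ▸ Submodule.subset_span (by simp)
  · intro i
    fin_cases i
    · exact fun hi => absurd (map_one φ.symm) hi
    · exact fun hi => absurd (map_one φ.symm) hi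
    · exact fun _ => ⟨_, h1⟩
    · exact fun _ => ⟨_, h2⟩

theorem isFine_of_isCartanGrading (h : IsCompositionNorm (norm q α) (incl q α 1))
    (hΓ : IsCartanGrading Γ) : GroupGrading.IsFine.{w, u, v, t} (mainGrading q α) Γ := by
  obtain ⟨φ, e₁, e₂, x, y, hb, -, -, h0, h1, h2, h3, h4, h5, h6⟩ := hΓ
  have hne := hb.linearIndependent.ne_zero
  have h0' := h0
  rw [show (Multiplicative.ofAdd ((0, 0) : ℤ × ℤ)) = 1 from rfl, map_one] at h0'
  refine GroupGrading.isFine_of_degrees h (b := ![e₁, e₂, x 0, x 1, x 2, y 0, y 1, y 2])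
    (d := fun i => φ.symm (IsCanonicalBasisEight.degree i))
    hb.range_eq_top ?_ (hne 0) (hne 1) hb.e₁_e₁ hb.e₂_e₂ hb.e₁_e₂ hb.e₂_e₁ (hb.unit_eq h) h0' ?_
  · intro i
    fin_cases i
    · exact h0.symm ▸ Submodule.subset_span (by simp)
    · exact h0.symm ▸ Submodule.subset_span (by simp)
    · exact h3.symm ▸ Submodule.subset_span (by simp)
    · exact h5.symm ▸ Submodule.subset_span (by simp)
    · exact h2.symm ▸ Submodule.subset_span (by simp)
    · exact h4.symm ▸ Submodule.subset_span (by simp)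
    · exact h6.symm ▸ Submodule.subset_span (by simp)
    · exact h1.symm ▸ Submodule.subset_span (by simp)
  · intro i
    fin_cases i
    exacts [fun hi => absurd (map_one φ.symm) hi, fun hi => absurd (map_one φ.symm) hi,
      fun _ => ⟨_, h3⟩, fun _ => ⟨_, h5⟩, fun _ => ⟨_, h2⟩, fun _ => ⟨_, h4⟩, fun _ => ⟨_, h6⟩,
      fun _ => ⟨_, h1⟩]

theorem isFine_of_isNonsplitDoublingGrading (h : IsCompositionNorm (norm q α) (incl q α 1))
    (hΓ : IsNonsplitDoublingGrading Γ) :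
    GroupGrading.IsFine.{w, u, v, t} (mainGrading q α) Γ := by
  obtain ⟨φ, w, v, u, K, -, -, -, hw, -, -, hnv, hnu, rfl, hK, h0, h1, h2, h3⟩ := hΓ
  -- Multiplicativity carries anisotropy from `K` to `Kz` for each anisotropic `z`, which covers the
  -- three other components.
  have hmul : ∀ z, norm q α z ≠ 0 → ∀ x ∈ (Submodule.span F {incl q α 1, w}).map
      (LinearMap.mulRight F z), norm q α x = 0 → x = 0 := by
    rintro z hz _ ⟨k, hk, rfl⟩ hnk
    rw [LinearMap.mulRight_apply, h.map_mul] at hnk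
    rw [hK k hk ((mul_eq_zero.1 hnk).resolve_right hz), map_zero]
  intro H _ Δ _ hΔ
  refine hΔ.symm_of_composition h (fun x hx hxe => ?_) fun g hg => .inr ?_
  · rw [show (Multiplicative.ofAdd ((0, 0) : ZMod 2 × ZMod 2)) = 1 from rfl, map_one] at h0
    rw [h0] at hx
    exact h.mem_span_unit_of_polar hw hx hxe
  · obtain ⟨k, rfl⟩ := φ.symm.surjective g
    obtain ⟨i, j⟩ := k
    rcases ZMod.two_cases i with rfl | rfl <;> rcases ZMod.two_cases j with rfl | rfl
    · exact absurd (map_one φ.symm) hg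
    · exact fun x hx => hmul u hnu x (h2.le hx)
    · exact fun x hx => hmul v hnv x (h1.le hx)
    · exact fun x hx => hmul (v * u) (by rw [h.map_mul]; exact mul_ne_zero hnv hnu) x (h3.le hx)

/-! ### Every fine grading by its universal group is listed -/

variable (hQ1 : IsCompositionNorm q 1) (hα : α ≠ 0)
  (h : IsCompositionNorm (norm q α) (incl q α 1)) (hsuper : GroupGrading.IsSuper (mainGrading q α) Γ) (huniv : Γ.IsUniversal)
  (hfine : GroupGrading.IsFine.{w, u, v, t} (mainGrading q α) Γ)

include hQ1 hα

theorem inclU_one_mem_and_norm_ne_zero :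
    inclU q α 1 ∈ (mainGrading q α).component (Multiplicative.ofAdd 1) ∧
      norm q α (inclU q α 1) ≠ 0 := by
  refine ⟨mainGrading_one.ge ⟨1, rfl⟩, ?_⟩
  change q 0 + α * q 1 ≠ 0
  rwa [QuadraticMap.map_zero, zero_add, hQ1.map_one, mul_one]

theorem inclU_one_ne_zero : (inclU q α 1 : CD q α) ≠ 0 := fun h0 =>
  (inclU_one_mem_and_norm_ne_zero hQ1 hα).2 (h0 ▸ QuadraticMap.map_zero _)

include h hsuper huniv hfine

theorem isMainGrading_of_isFine (hQ : Module.finrank F Q = 2) (hns : ¬ IsSplitNorm q) :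
    IsMainGrading Γ := by
  obtain ⟨hu, hnu⟩ := inclU_one_mem_and_norm_ne_zero hQ1 hα
  have hP : (mainGrading q α).Refines Γ := by
    refine h.main_refines hsuper (by rw [mainGrading_zero, finrank_even, hQ])
      (by rw [mainGrading_one, finrank_odd, hQ]) (fun x hx hnx => ?_) ⟨_, hu, hnu⟩
    rw [mainGrading_zero, mem_even] at hx
    rw [norm_apply, hx, QuadraticMap.map_zero, mul_zero, add_zero] at hnx
    have h1 : x.1 = 0 := by
      by_contra h0
      exact hns ⟨x.1, h0, hnx⟩
    exact ext h1 hx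
  have hanis : ∀ i, ∃ x ∈ (mainGrading q α).component i, norm q α x ≠ 0 := by
    intro i
    rcases ZMod.two_cases i.toAdd with hi | hi
    · rw [← ofAdd_toAdd i, hi]
      exact ⟨_, (mainGrading q α).unit_mem h, by rw [h.map_one]; exact one_ne_zero⟩
    · rw [← ofAdd_toAdd i, hi]
      exact ⟨_, hu, hnu⟩
  obtain ⟨φ, hφ⟩ := huniv.hasUniversalProperty.exists_mulEquiv
    (GroupGrading.hasUniversalProperty_of_anisotropic h hanis)
    (hfine.refines (GroupGrading.isSuper_of_le fun g => ⟨g, le_rfl⟩) hP) hP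
  refine ⟨φ, fun i => hφ i ?_⟩
  obtain ⟨x, hx, hnx⟩ := hanis i
  refine (Submodule.ne_bot_iff _).2 ⟨x, hx, ?_⟩
  rintro rfl
  exact hnx (QuadraticMap.map_zero _)

theorem isThreeGrading_of_isFine (hQ : Module.finrank F Q = 2) (hs : IsSplitNorm q) :
    IsThreeGrading Γ := by
  have hfin : Module.Finite F Q := Module.finite_of_finrank_pos (by omega)
  obtain ⟨hu, -⟩ := inclU_one_mem_and_norm_ne_zero hQ1 hα
  obtain ⟨x, hx0, hnx⟩ := hs
  obtain ⟨e₁, e₂, u₁, v₁, hb, hbΓ, hbP, heven, hodd⟩ := h.exists_canonicalBasisFour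
    (by rw [finrank_eq, hQ]) hsuper (by rw [mainGrading_zero, finrank_even, hQ])
    (x := incl q α x) (mainGrading_zero.ge ⟨x, rfl⟩) (fun h0 => hx0 (congrArg Prod.fst h0))
    (by change q x + α * q 0 = 0; rw [hnx, QuadraticMap.map_zero, mul_zero, add_zero]) hu
    (inclU_one_ne_zero hQ1 hα)
  have he := hb.unit_eq h
  obtain ⟨φ, hφ⟩ := huniv.hasUniversalProperty.exists_mulEquiv (hb.hasUniversalProperty h he)
    (hfine.refines (GroupGrading.isSuper_of_le hbP) hbΓ) hbΓ
  obtain ⟨h0, h1, h2⟩ := hb.grading_component h he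
  have hsupp := hb.grading_support h he
  exact ⟨φ, e₁, e₂, u₁, v₁, hb, mainGrading_zero.symm.trans heven, mainGrading_one.symm.trans hodd,
    (hφ _ ((hsupp _).2 (by simp))).trans h0, (hφ _ ((hsupp _).2 (by simp))).trans h1,
    (hφ _ ((hsupp _).2 (by simp))).trans h2⟩

theorem isCartanGrading_or_isNonsplitDoublingGrading_of_isFine (hQ : Module.finrank F Q = 4) :
    IsNonsplitDoublingGrading Γ ∨ (IsSplitNorm q ∧ IsCartanGrading Γ) := by
  have hfin : Module.Finite F Q := Module.finite_of_finrank_pos (by omega)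
  obtain ⟨hu, -⟩ := inclU_one_mem_and_norm_ne_zero hQ1 hα
  have hu0 := inclU_one_ne_zero hQ1 hα
  have hP : Module.finrank F ((mainGrading q α).component (Multiplicative.ofAdd 0)) = 4 := by
    rw [mainGrading_zero, finrank_even, hQ]
  have hP' : Module.finrank F ((mainGrading q α).component (Multiplicative.ofAdd 1)) = 4 := by
    rw [mainGrading_one, finrank_odd, hQ]
  -- The dichotomy concerns only the neutral even part: `Q` itself may be split in the first case.
  by_cases hiso : ∀ x ∈ (mainGrading q α).component (Multiplicative.ofAdd 0),
      x ∈ Γ.component 1 → norm q α x = 0 → polar (norm q α) x (incl q α 1) = 0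
  · left
    obtain ⟨w, v, u, ht, htΓ, hK⟩ := h.exists_doublingTriple hsuper hP hP' hiso hu hu0
    obtain ⟨h1, h2, h3, h4⟩ := ht.grading_component h
    have hanis := ht.exists_anisotropic h
    obtain ⟨φ, hφ⟩ := huniv.hasUniversalProperty.exists_mulEquiv
      (GroupGrading.hasUniversalProperty_of_anisotropic h hanis)
      (hfine.refines (GroupGrading.isSuper_of_le (ht.exists_component_le h)) htΓ) htΓ
    have hsupp : ∀ k, k ∈ (ht.grading h).support := by
      intro k
      obtain ⟨x, hx, hnx⟩ := hanis k
      refine (Submodule.ne_bot_iff _).2 ⟨x, hx, ?_⟩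
      rintro rfl
      exact hnx (QuadraticMap.map_zero _)
    exact ⟨φ, w, v, u, _, mainGrading_zero.le ht.w_mem, mainGrading_zero.le ht.v_mem,
      mainGrading_one.le ht.u_mem, ht.polar_w, ht.polar_v, ht.polar_v_w, ht.map_v, ht.map_u, rfl, hK,
      (hφ _ (hsupp _)).trans h1, (hφ _ (hsupp _)).trans h2, (hφ _ (hsupp _)).trans h3,
      (hφ _ (hsupp _)).trans h4⟩
  · right
    push Not at hiso
    obtain ⟨x, hx, hxΓ, hnx, hxe⟩ := hiso
    obtain ⟨e₁, e₂, x', y', hb, hbΓ, hbP, heven, hodd⟩ := h.exists_canonicalBasisEight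
      (by rw [finrank_eq, hQ]) hsuper hP hx hxΓ hxe hnx hu hu0
    have he := hb.unit_eq h
    obtain ⟨φ, hφ⟩ := huniv.hasUniversalProperty.exists_mulEquiv (hb.hasUniversalProperty h he)
      (hfine.refines (GroupGrading.isSuper_of_le hbP) hbΓ) hbΓ
    obtain ⟨h0, h1, h2, h3, h4, h5, h6⟩ := hb.grading_component h he
    have hsupp := fun i => hφ _ ((hb.grading_support h he _).2 ⟨i, rfl⟩)
    -- The isotropic vector of nonzero trace is even and nonzero, so its `Q`-coordinate shows that
    -- `Q` is split. The arguments of `hsupp` are positions in the list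
    -- `IsCanonicalBasisEight.degree`.
    refine ⟨⟨x.1, fun h0 => hxe ?_, ?_⟩, φ, e₁, e₂, x', y', hb, mainGrading_zero.symm.trans heven,
      mainGrading_one.symm.trans hodd, (hsupp 0).trans h0, (hsupp 7).trans h1, (hsupp 4).trans h2,
      (hsupp 2).trans h3, (hsupp 5).trans h4, (hsupp 3).trans h5, (hsupp 6).trans h6⟩
    · have h7 : x = 0 := ext h0 (mem_even.1 (mainGrading_zero.le hx))
      rw [h7, QuadraticMap.polar_zero_left]
    · rwa [norm_apply, mem_even.1 (mainGrading_zero.le hx), QuadraticMap.map_zero, mul_zero,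
        add_zero] at hnx

end CD

theorem mainTheorem1 {F : Type u} [Field F] [CharP F 2] {Q : Type v} [NonAssocRing Q]
    [Module F Q] [IsScalarTower F Q Q] [SMulCommClass F Q Q]
    (q : QuadraticForm F Q) (hq : IsHurwitzNorm q) (α : F) (hα : α ≠ 0)
    {G : Type t} [Group G] (Γ : GroupGrading F (CD q α) G)
    (hsuper : GroupGrading.IsSuper (CD.mainGrading q α) Γ) (huniv : Γ.IsUniversal) :
    (Module.finrank F Q = 2 →
      (GroupGrading.IsFine.{w, u, v, t} (CD.mainGrading q α) Γ ↔
        (¬ IsSplitNorm q ∧ CD.IsMainGrading Γ) ∨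
        (IsSplitNorm q ∧ CD.IsThreeGrading Γ))) ∧
    (Module.finrank F Q = 4 →
      (GroupGrading.IsFine.{w, u, v, t} (CD.mainGrading q α) Γ ↔
        CD.IsNonsplitDoublingGrading Γ ∨
        (IsSplitNorm q ∧ CD.IsCartanGrading Γ))) := by
  refine ⟨fun hQ => ?_, fun hQ => ?_⟩
  · have hQ1 := hq.isCompositionNorm (by omega)
    have h := CD.isCompositionNorm hQ1 (hQ1.mul_assoc_of_finrank (.inl hQ)) hα
    refine ⟨fun hfine => ?_, ?_⟩
    · by_cases hs : IsSplitNorm q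
      · exact .inr ⟨hs, CD.isThreeGrading_of_isFine hQ1 hα h hsuper huniv hfine hQ hs⟩
      · exact .inl ⟨hs, CD.isMainGrading_of_isFine hQ1 hα h hsuper huniv hfine hQ hs⟩
    · rintro (⟨hns, hΓ⟩ | ⟨-, hΓ⟩)
      · exact CD.isFine_of_isMainGrading h hα hQ hns hΓ
      · exact CD.isFine_of_isThreeGrading h hΓ
  · have hQ1 := hq.isCompositionNorm (by omega)
    have h := CD.isCompositionNorm hQ1 (hQ1.mul_assoc_of_finrank (.inr hQ)) hα
    refine ⟨CD.isCartanGrading_or_isNonsplitDoublingGrading_of_isFine hQ1 hα h hsuper huniv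
      (hQ := hQ), ?_⟩
    rintro (hΓ | ⟨-, hΓ⟩)
    · exact CD.isFine_of_isNonsplitDoublingGrading h hΓ
    · exact CD.isFine_of_isCartanGrading h hΓ
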